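/- Let $G(d,k)$ be the Grassmannian of $k$-dimensional linear subspaces of $\mathbb{R}^d$, with its normalized $O(d)$-invariant measure $\gamma^{(d,k)}$ (the image of the normalized Haar measure of $O(d)$ under $\theta\mapsto\theta(L_0)$ for any fixed $L_0\in G(d,k)$); $L^p(G(d,k))$ is taken with respect to this measure. For $L\in G(d,k)$, $a\in\mathbb{R}^d$ and $\delta>0$ let the plate $L_\delta(a)$ be the $\delta$-neighbourhood in $\mathbb{R}^d$ of $B(a,\tfrac12)\cap(a+L)$, and define $$\mathcal{M}^k_\delta[f](L)=\sup_{a\in\mathbb{R}^d}\frac{1}{|L_\delta(a)|}\int_{L_\delta(a)}|f(y)|\,dy,\qquad \mathcal{N}^k[f](L)=\sup_{x\in\mathbb{R}^d}\int_{x+L}|f(y)|\,dy,$$ where $dy$ in the second integral is $k$-dimensional Lebesgue measure on $x+L$; both take values in $[0,\infty]$. **Proposition.** Let $d,k$ be integers with $2\le k\le d$, let $2\le p<\infty$ and $\alpha\in\mathbb{R}$. Suppose that there is a constant $A$ such that $$\|\mathcal{M}^{k-1}_\delta f\|_{L^p(G(d-1,k-1))}\le A\,\delta^{-\alpha/p}\,\|f\|_{L^p(\mathbb{R}^{d-1})}$$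 for all $0<\delta<1$ and all $f\in L^p(\mathbb{R}^{d-1})$. Then there is a constant $C$, independent of $\delta$ and $f$, such that the following holds. 1. If $\alpha>1$, then for all $0<\delta<1$ and all $f\in L^p(\mathbb{R}^d)$ $$\|\mathcal{M}^k_\delta f\|_{L^p(G(d,k))}\le C\,\delta^{-(\alpha-1)/p}\,\|f\|_{L^p(\mathbb{R}^d)}.$$ 2. If $\alpha=1$, then for all $0<\delta<1$ and all $f\in L^p(\mathbb{R}^d)$ $$\|\mathcal{M}^k_\delta f\|_{L^p(G(d,k))}\le C\,\bigl(1+\log\tfrac1\delta\bigr)\,\|f\|_{L^p(\mathbb{R}^d)}.$$ 3. If $\alpha<1$, then for all $f\in L^p(\mathbb{R}^d)$ supported in the closed unit ball, $\mathcal{N}^k f$ is $\gamma^{(d,k)}$-a.e. equal to a measurable function and $$\|\mathcal{N}^k f\|_{L^p(G(d,k))}\le C\,\|f\|_{L^p(\mathbb{R}^d)}.$$ -/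

import Mathlib

open MeasureTheory
open scoped NNReal ENNReal

namespace KPlane

/-- Euclidean space `ℝ^d`, with the Euclidean norm and Lebesgue measure. -/
abbrev E (d : ℕ) : Type := EuclideanSpace ℝ (Fin d)

/-- The orthogonal group `O(d)`, with the operator norm topology. -/
abbrev O (d : ℕ) : Type := unitary (E d →L[ℝ] E d)

/-- `G(d,k)`, the set of `k`-dimensional linear subspaces of `ℝ^d`. -/
def Gr (d k : ℕ) : Type := {L : Submodule ℝ (E d) // Module.finrank ℝ L = k}

/-- The usual topology of `G(d,k)`: a subspace is identified with the orthogonal projection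
onto it. -/
noncomputable instance (d k : ℕ) : TopologicalSpace (Gr d k) :=
  TopologicalSpace.induced (fun L => L.1.starProjection) inferInstance

noncomputable instance (d k : ℕ) : MeasurableSpace (Gr d k) := borel _

instance (d k : ℕ) : BorelSpace (Gr d k) := ⟨rfl⟩

/-- The image `θ(L)` of a subspace `L ∈ G(d,k)` under `θ ∈ O(d)`. -/
noncomputable def rotate {d k : ℕ} (θ : O d) (L : Gr d k) : Gr d k :=
  ⟨L.1.map (Unitary.linearIsometryEquiv θ).toLinearEquiv.toLinearMap, by
    rw [LinearEquiv.finrank_map_eq]; exact L.2⟩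

instance (d : ℕ) : ContinuousStar (E d →L[ℝ] E d) :=
  ⟨(ContinuousLinearMap.adjoint (𝕜 := ℝ) (E := E d) (F := E d)).continuous⟩

instance (d : ℕ) : CompactSpace (O d) := by
  refine isCompact_iff_compactSpace (s := (unitary (E d →L[ℝ] E d) : Set (E d →L[ℝ] E d))).1 ?_
  refine Metric.isCompact_of_isClosed_isBounded isClosed_unitary ?_
  refine (Metric.isBounded_iff_subset_closedBall 0).2 ⟨1, fun θ hθ => ?_⟩
  rw [mem_closedBall_zero_iff]
  refine ContinuousLinearMap.opNorm_le_bound _ zero_le_one fun x => ?_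
  have := (Unitary.linearIsometryEquiv (⟨θ, hθ⟩ : O d)).norm_map x
  rw [one_mul]
  exact this.le

/-- The normalized Haar measure of `O(d)`. -/
noncomputable def haarO (d : ℕ) : Measure (O d) := Measure.haarMeasure ⊤

/-- The invariant probability measure `γ^{(d,k)}` on `G(d,k)`:
`γ(F) = haarO {θ | θ(L₀) ∈ F}` for any fixed `L₀ ∈ G(d,k)`.  (If `d < k`, then `G(d,k)` is empty,
and the measure is zero.) -/
noncomputable def gamma (d k : ℕ) : Measure (Gr d k) :=
  open Classical in
  if h : Nonempty (Gr d k) then (haarO d).map (fun θ => rotate θ h.some) else 0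

/-- The plate `L_δ(a)`: the `δ`-neighbourhood in `ℝ^d` of `B(a,1/2) ∩ (a + L)`. -/
def plate {d k : ℕ} (δ : ℝ) (L : Gr d k) (a : E d) : Set (E d) :=
  Metric.thickening δ (Metric.ball a (1 / 2) ∩ {x | x - a ∈ L.1})

/-- The maximal function `M^k_δ[f](L)`, the supremum of the averages of `|f|` over the plates
`L_δ(a)`, `a ∈ ℝ^d`. -/
noncomputable def maxM {d k : ℕ} (δ : ℝ) (f : E d → ℝ) (L : Gr d k) : ℝ≥0∞ :=
  ⨆ a : E d, (volume (plate δ L a))⁻¹ * ∫⁻ y in plate δ L a, ‖f y‖ₑ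

/-- `k`-dimensional Lebesgue measure on a subspace `L ∈ G(d,k)`: the Haar measure that gives the
unit cube of an orthonormal basis of `L` measure one. -/
noncomputable def leb {d k : ℕ} (L : Gr d k) : Measure L.1 :=
  (stdOrthonormalBasis ℝ L.1).toBasis.addHaar

/-- The maximal function `N^k[f](L)`, the supremum of the integrals of `|f|` over all translates
`x + L` of `L`. -/
noncomputable def maxN {d k : ℕ} (f : E d → ℝ) (L : Gr d k) : ℝ≥0∞ :=
  ⨆ x : E d, ∫⁻ y : L.1, ‖f (x + (y : E d))‖ₑ ∂(leb L)

end KPlane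

/-!
The integral of `f` over the plane `θ(ℝ e₀ ⊕ L)` is the integral over `L` of the X-ray transform
`y ↦ ∫ f(θ(t, y)) dt` of `f` in the direction `θ e₀`. So the plane maximal function on `ℝ^(n+1)` is
dominated by the one on `ℝ^n` applied to X-ray transforms, and averaging over `θ ∈ O(n+1)` recovers
the `L^p` norm over the Grassmannian.

To apply the hypothesis, decompose `f` into differences of its averages over balls of radii `r` and
`2r`, for dyadic `r`. Such a difference varies at scale `r`, so the integrals of its X-ray transform
over planes are comparable to averages over plates of width `r`, which costs `r^(-α/p)` by
hypothesis. On the other hand, X-ray transformation smooths by half a derivative: integrating over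
the lines through a point turns the `L²` norm of the X-ray transform into a quadratic form with the
kernel `|z|^(-n)`, and the difference of averages of this kernel at scales `r` and `2r` has integral
of order `r`. This gains `r^(1/2)` in `L²`, hence `r^(1/p)` in `L^p` by interpolation with the
trivial `L^∞` bound. The piece at scale `r` therefore contributes `r^(-(α-1)/p)`. Plates of width
`δ` only see the scales `r ≥ δ`, and the three cases are those in which the geometric series up to
`δ` is dominated by its last term, by the number of its terms, or by a constant; in the last case
`δ` may tend to `0` for lower semicontinuous functions, which approximate `f` from above.
-/

namespace KPlane

open Filter Topology Set

section OrthogonalGroup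

variable {d k : ℕ}

theorem unitary_apply_star_apply (θ : O d) (x : E d) : θ.1 ((star θ).1 x) = x :=
  (Unitary.linearIsometryEquiv θ).apply_symm_apply x

@[fun_prop]
theorem continuous_unitary_apply : Continuous fun q : O d × E d => q.1.1 q.2 :=
  (continuous_subtype_val.comp continuous_fst).clm_apply continuous_snd

theorem exists_unitary_apply_eq {x y : E d} (h : ‖x‖ = ‖y‖) : ∃ θ : O d, θ.1 x = y :=
  ⟨Unitary.linearIsometryEquiv.symm (Submodule.reflection (ℝ ∙ (x - y))ᗮ),
    Submodule.reflection_sub h⟩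

instance : (haarO d).IsHaarMeasure := by unfold haarO; infer_instance

instance : IsProbabilityMeasure (haarO d) :=
  ⟨by simpa [haarO] using
    Measure.haarMeasure_self (K₀ := (⊤ : TopologicalSpace.PositiveCompacts (O d)))⟩

instance : (haarO d).IsMulRightInvariant := ⟨fun g => by
  have h_haar : (Measure.map (· * g) (haarO d)).IsHaarMeasure := inferInstance
  have h_prob : IsProbabilityMeasure (Measure.map (· * g) (haarO d)) :=
    Measure.isProbabilityMeasure_map (by fun_prop)
  exact Measure.isHaarMeasure_eq_of_isProbabilityMeasure _ _⟩

end OrthogonalGroup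

section Grassmannian

variable {d k : ℕ}

theorem mem_rotate {θ : O d} {L : Gr d k} {x : E d} :
    x ∈ (rotate θ L).1 ↔ ∃ y ∈ L.1, θ.1 y = x := Iff.rfl

theorem rotate_mul (θ ρ : O d) (L : Gr d k) : rotate (θ * ρ) L = rotate θ (rotate ρ L) :=
  Subtype.ext (Submodule.map_comp (Unitary.linearIsometryEquiv ρ).toLinearEquiv.toLinearMap
    (Unitary.linearIsometryEquiv θ).toLinearEquiv.toLinearMap L.1)

theorem starProjection_rotate (θ : O d) (L : Gr d k) :
    (rotate θ L).1.starProjection = θ.1 * L.1.starProjection * (star θ).1 :=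
  ContinuousLinearMap.ext
    (Submodule.starProjection_map_apply (Unitary.linearIsometryEquiv θ) L.1)

theorem isInducing_starProjection : IsInducing (fun L : Gr d k => L.1.starProjection) := ⟨rfl⟩

instance : SecondCountableTopology (Gr d k) :=
  isInducing_starProjection.secondCountableTopology

instance : T2Space (Gr d k) :=
  .of_injective_continuous (fun _ _ h => Subtype.ext (Submodule.starProjection_inj.1 h))
    isInducing_starProjection.continuous

theorem continuous_rotate_prod : Continuous fun q : O d × Gr d k => rotate q.1 q.2 := by
  rw [isInducing_starProjection.continuous_iff]
  simp only [Function.comp_def, starProjection_rotate]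
  exact ((continuous_subtype_val.comp continuous_fst).mul
    (isInducing_starProjection.continuous.comp continuous_snd)).mul
    (continuous_subtype_val.comp (continuous_star.comp continuous_fst))

theorem continuous_rotate (L : Gr d k) : Continuous fun θ : O d => rotate θ L :=
  continuous_rotate_prod.comp (continuous_id.prodMk continuous_const)

theorem exists_linearIsometry_range_eq (L : Gr d k) :
    ∃ U : E k →ₗᵢ[ℝ] E d, LinearMap.range U.toLinearMap = L.1 := by
  let e : E k ≃ₗᵢ[ℝ] L.1 := ((stdOrthonormalBasis ℝ L.1).reindex (finCongr L.2)).repr.symm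
  refine ⟨L.1.subtypeₗᵢ.comp e.toLinearIsometry, Submodule.ext fun x => ⟨?_, fun hx => ?_⟩⟩
  · rintro ⟨y, rfl⟩
    exact (e y).2
  · exact ⟨e.symm ⟨x, hx⟩, by simp⟩

theorem exists_rotate_eq (L L' : Gr d k) : ∃ θ : O d, rotate θ L = L' := by
  let e : L.1 ≃ₗᵢ[ℝ] L'.1 :=
    ((stdOrthonormalBasis ℝ L.1).reindex (finCongr L.2)).repr.trans
      ((stdOrthonormalBasis ℝ L'.1).reindex (finCongr L'.2)).repr.symm
  let W : E d →ₗᵢ[ℝ] E d := (L'.1.subtypeₗᵢ.comp e.toLinearIsometry).extend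
  have hW (x : L.1) : W x = e x := LinearIsometry.extend_apply _ x
  refine ⟨Unitary.linearIsometryEquiv.symm (W.toLinearIsometryEquiv rfl),
    Subtype.ext (Submodule.ext fun x => mem_rotate.trans ⟨?_, fun hx => ?_⟩)⟩
  · rintro ⟨y, hy, rfl⟩
    change W ↑(⟨y, hy⟩ : L.1) ∈ L'.1
    rw [hW]
    exact (e _).2
  · refine ⟨e.symm ⟨x, hx⟩, (e.symm _).2, ?_⟩
    change W _ = _
    rw [hW, e.apply_symm_apply]

theorem isQuotientMap_rotate (L : Gr d k) : IsQuotientMap fun θ : O d => rotate θ L :=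
  (continuous_rotate L).isClosedMap.isQuotientMap (continuous_rotate L) (exists_rotate_eq L)

theorem lowerSemicontinuous_of_rotate {F : Gr d k → ℝ≥0∞}
    (h : ∀ L, LowerSemicontinuous fun θ : O d => F (rotate θ L)) : LowerSemicontinuous F := by
  rcases isEmpty_or_nonempty (Gr d k) with hE | ⟨⟨L⟩⟩
  · exact fun x => isEmptyElim x
  · rw [lowerSemicontinuous_iff_isOpen_preimage]
    intro c
    rw [← (isQuotientMap_rotate L).isOpen_preimage]
    exact (h L).isOpen_preimage c

theorem gamma_eq_map (L : Gr d k) : gamma d k = (haarO d).map (fun θ => rotate θ L) := by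
  have hne : Nonempty (Gr d k) := ⟨L⟩
  obtain ⟨ρ, hρ⟩ := exists_rotate_eq L hne.some
  rw [gamma, dif_pos hne]
  simp_rw [← hρ, ← rotate_mul]
  conv_rhs => rw [← map_mul_right_eq_self (haarO d) ρ]
  rw [Measure.map_map (continuous_rotate L).measurable (by fun_prop)]
  rfl

instance [Nonempty (Gr d k)] : IsProbabilityMeasure (gamma d k) := by
  rw [gamma_eq_map (Classical.arbitrary (Gr d k))]
  exact Measure.isProbabilityMeasure_map (continuous_rotate _).measurable.aemeasurable

theorem lintegral_gamma (L : Gr d k) {F : Gr d k → ℝ≥0∞} (hF : Measurable F) :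
    ∫⁻ M, F M ∂gamma d k = ∫⁻ θ, F (rotate θ L) ∂haarO d := by
  rw [gamma_eq_map L, lintegral_map hF (continuous_rotate L).measurable]

theorem nonempty_gr_of_le (h : k ≤ d) : Nonempty (Gr d k) := by
  obtain ⟨b, hb⟩ := exists_linearIndependent_of_le_finrank
    (show k ≤ Module.finrank ℝ (E d) by simpa using h)
  exact ⟨⟨Submodule.span ℝ (Set.range b), by simpa using finrank_span_eq_card hb⟩⟩

end Grassmannian

section Cons

variable {n m : ℕ}

/-- The first vector of the standard basis of `ℝ^(n+1)`. -/
noncomputable def e0 (n : ℕ) : E (n + 1) := EuclideanSpace.single 0 1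

/-- The projection of `ℝ^(n+1) = ℝ × ℝ^n` onto the second factor. -/
noncomputable def tail (n : ℕ) : E (n + 1) →L[ℝ] E n :=
  LinearMap.toContinuousLinearMap
    { toFun := fun x => WithLp.toLp 2 (fun i => x i.succ)
      map_add' := fun _ _ => rfl
      map_smul' := fun _ _ => rfl }

/-- The embedding `y ↦ (0, y)` of `ℝ^n` into `ℝ^(n+1)`. -/
noncomputable def incl (n : ℕ) : E n →L[ℝ] E (n + 1) :=
  LinearMap.toContinuousLinearMap
    { toFun := fun x => WithLp.toLp 2 (Fin.cons 0 x.ofLp)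
      map_add' := fun x y => by ext i; refine Fin.cases ?_ (fun j => ?_) i <;> simp
      map_smul' := fun c y => by ext i; refine Fin.cases ?_ (fun j => ?_) i <;> simp }

/-- The point `(t, y)` of `ℝ^(n+1) = ℝ × ℝ^n`. -/
noncomputable def cons (t : ℝ) (y : E n) : E (n + 1) := t • e0 n + incl n y

theorem norm_e0 (n : ℕ) : ‖e0 n‖ = 1 := by simp [e0]

@[simp] theorem incl_zero_apply (y : E n) : incl n y 0 = 0 := rfl
@[simp] theorem incl_succ_apply (y : E n) (i : Fin n) : incl n y i.succ = y i := rfl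
@[simp] theorem tail_apply (x : E (n + 1)) (i : Fin n) : tail n x i = x i.succ := rfl
@[simp] theorem cons_zero_apply (t : ℝ) (y : E n) : cons t y 0 = t := by simp [cons, e0]
@[simp] theorem cons_succ_apply (t : ℝ) (y : E n) (i : Fin n) : cons t y i.succ = y i := by
  simp [cons, e0]

theorem cons_eq_toLp (t : ℝ) (y : E n) : cons t y = WithLp.toLp 2 (Fin.cons t y.ofLp) := by
  ext i; refine Fin.cases ?_ (fun j => ?_) i <;> simp

@[simp] theorem cons_head_tail (x : E (n + 1)) : cons (x 0) (tail n x) = x := by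
  ext i; refine Fin.cases ?_ (fun j => ?_) i <;> simp

@[simp] theorem tail_cons (t : ℝ) (y : E n) : tail n (cons t y) = y := by
  ext i; simp

theorem cons_zero_right (t : ℝ) : cons t (0 : E n) = t • e0 n := by simp [cons]

theorem cons_add (s t : ℝ) (x y : E n) : cons (s + t) (x + y) = cons s x + cons t y := by
  simp only [cons, map_add, add_smul]; abel

theorem cons_smul (c t : ℝ) (y : E n) : cons (c * t) (c • y) = c • cons t y := by
  simp [cons, mul_smul]

theorem norm_cons_sq (t : ℝ) (y : E n) : ‖cons t y‖ ^ 2 = t ^ 2 + ‖y‖ ^ 2 := by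
  simp [EuclideanSpace.norm_sq_eq, Fin.sum_univ_succ]

theorem inner_cons (s t : ℝ) (x y : E n) :
    inner ℝ (cons s x) (cons t y) = s * t + inner ℝ x y := by
  simp [PiLp.inner_apply, Fin.sum_univ_succ, mul_comm]

theorem norm_le_norm_cons (t : ℝ) (y : E n) : ‖y‖ ≤ ‖cons t y‖ := by
  have := norm_cons_sq t y
  exact (sq_le_sq₀ (norm_nonneg _) (norm_nonneg _)).1 (by nlinarith [sq_nonneg t])

theorem abs_le_norm_cons (t : ℝ) (y : E n) : |t| ≤ ‖cons t y‖ := by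
  have := norm_cons_sq t y
  exact abs_le_of_sq_le_sq (by nlinarith [sq_nonneg ‖y‖]) (norm_nonneg _)

@[fun_prop]
theorem continuous_cons : Continuous fun q : ℝ × E n => cons q.1 q.2 := by
  unfold cons; fun_prop

@[fun_prop]
theorem measurable_cons : Measurable fun q : ℝ × E n => cons q.1 q.2 :=
  continuous_cons.measurable

theorem measurePreserving_cons :
    MeasurePreserving (fun q : ℝ × E n => cons q.1 q.2) (volume.prod volume) volume := by
  have h_ofLp : MeasurePreserving (fun q : ℝ × E n => (q.1, q.2.ofLp)) (volume.prod volume)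
      (volume.prod volume) :=
    (MeasurePreserving.id _).prod (PiLp.volume_preserving_ofLp (Fin n))
  have h_insert := (volume_preserving_piFinSuccAbove (fun _ : Fin (n + 1) => ℝ) 0).symm
  have h_cons : (fun q : ℝ × E n => cons q.1 q.2) = WithLp.toLp 2 ∘
      (MeasurableEquiv.piFinSuccAbove (fun _ => ℝ) 0).symm ∘ fun q => (q.1, q.2.ofLp) := by
    funext q
    simp [cons_eq_toLp, MeasurableEquiv.piFinSuccAbove]
    rfl
  rw [h_cons]
  exact (PiLp.volume_preserving_toLp (Fin (n + 1))).comp (h_insert.comp h_ofLp)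

/-- The splitting `(t, y) ↦ t e₀ + y` of the preimage of a subspace of `ℝ^n` under the projection
`ℝ^(n+1) → ℝ^n`. -/
noncomputable def consEquivComap (K : Submodule ℝ (E n)) :
    (ℝ × K) ≃ₗ[ℝ] K.comap (tail n).toLinearMap where
  toFun q := ⟨cons q.1 q.2, by simp⟩
  invFun x := (x.1 0, ⟨tail n x, x.2⟩)
  map_add' q q' := Subtype.ext (cons_add _ _ _ _)
  map_smul' c q := Subtype.ext (cons_smul _ _ _)
  left_inv q := by simp
  right_inv x := by simp

/-- The subspace `ℝ e₀ ⊕ L` of `ℝ^(n+1)`. -/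
noncomputable def Gr.cons (L : Gr n m) : Gr (n + 1) (m + 1) :=
  ⟨L.1.comap (tail n).toLinearMap, by
    rw [← (consEquivComap L.1).finrank_eq, Module.finrank_prod, Module.finrank_self, L.2,
      add_comm]⟩

theorem Gr.mem_cons {L : Gr n m} {x : E (n + 1)} : x ∈ L.cons.1 ↔ tail n x ∈ L.1 := Iff.rfl

theorem Gr.starProjection_cons (L : Gr n m) (x : E (n + 1)) :
    L.cons.1.starProjection x = KPlane.cons (x 0) (L.1.starProjection (tail n x)) := by
  refine Submodule.eq_starProjection_of_mem_of_inner_eq_zero ?_ fun w hw => ?_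
  · rw [Gr.mem_cons, tail_cons]
    exact Submodule.starProjection_apply_mem _ _
  · have h_tail := Submodule.starProjection_inner_eq_zero (K := L.1) (tail n x) _ (Gr.mem_cons.1 hw)
    rw [← cons_head_tail w, inner_sub_left, inner_cons]
    nth_rw 1 [← cons_head_tail x]
    rw [inner_cons, add_sub_add_left_eq_sub, ← inner_sub_left, h_tail]

theorem Gr.continuous_cons : Continuous (Gr.cons : Gr n m → Gr (n + 1) (m + 1)) := by
  rw [isInducing_starProjection.continuous_iff]
  have h_proj : (fun L : Gr (n + 1) (m + 1) => L.1.starProjection) ∘ Gr.cons = fun L : Gr n m =>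
      (EuclideanSpace.proj (𝕜 := ℝ) (0 : Fin (n + 1))).smulRight (e0 n) +
        (incl n).comp (L.1.starProjection.comp (tail n)) := by
    funext L
    ext1 x
    simp only [Function.comp_apply, Gr.starProjection_cons]
    rfl
  rw [h_proj]
  exact continuous_const.add (continuous_const.clm_comp
    (isInducing_starProjection.continuous.clm_comp continuous_const))

theorem lintegral_gamma_succ [Nonempty (Gr n m)] {F : Gr (n + 1) (m + 1) → ℝ≥0∞}
    (hF : Measurable F) :
    ∫⁻ M, F M ∂gamma (n + 1) (m + 1) =
      ∫⁻ θ, ∫⁻ L, F (rotate θ L.cons) ∂gamma n m ∂haarO (n + 1) := by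
  have hF_rotate : Measurable fun q : O (n + 1) × Gr n m => F (rotate q.1 q.2.cons) :=
    hF.comp (continuous_rotate_prod.comp
      (continuous_fst.prodMk (Gr.continuous_cons.comp continuous_snd))).measurable
  rw [lintegral_lintegral_swap hF_rotate.aemeasurable]
  simp_rw [← lintegral_gamma _ hF]
  simp

end Cons

section PlaneMax

variable {d k : ℕ}

theorem lowerSemicontinuous_lintegral {X Y : Type*} [TopologicalSpace X]
    [FirstCountableTopology X] [MeasurableSpace Y] {ν : Measure Y} {H : X → Y → ℝ≥0∞}
    (hm : ∀ x, Measurable (H x)) (hl : ∀ y, LowerSemicontinuous fun x => H x y) :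
    LowerSemicontinuous fun x => ∫⁻ y, H x y ∂ν :=
  lowerSemicontinuous_iff_le_liminf.2 fun x =>
    (lintegral_mono fun y => lowerSemicontinuous_iff_le_liminf.1 (hl y) x).trans
      (lintegral_liminf_le hm)

theorem lowerSemicontinuous_measure {X Y : Type*} [TopologicalSpace X]
    [FirstCountableTopology X] [MeasurableSpace Y] {ν : Measure Y} {S : X → Set Y}
    (hm : ∀ x, MeasurableSet (S x)) (ho : ∀ y, IsOpen {x | y ∈ S x}) :
    LowerSemicontinuous fun x => ν (S x) := by
  simp_rw [← lintegral_indicator_one (hm _)]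
  exact lowerSemicontinuous_lintegral (fun x => measurable_one.indicator (hm x)) fun y =>
    (ho y).lowerSemicontinuous_indicator (y := (1 : ℝ≥0∞)) zero_le_one

theorem exists_measurePreserving_leb {L : Gr d k} {U : E k →ₗᵢ[ℝ] E d}
    (hU : LinearMap.range U.toLinearMap = L.1) :
    ∃ e : E k ≃ₗᵢ[ℝ] L.1, MeasurePreserving e volume (leb L) ∧ ∀ v, ((e v : L.1) : E d) = U v := by
  let W : E k →ₗᵢ[ℝ] L.1 :=
    { toLinearMap := U.toLinearMap.codRestrict L.1 fun v => hU ▸ ⟨v, rfl⟩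
      norm_map' := fun v => U.norm_map v }
  let e : E k ≃ₗᵢ[ℝ] L.1 := W.toLinearIsometryEquiv (by simp [L.2])
  exact ⟨e, e.measurePreserving, fun v => rfl⟩

theorem lintegral_leb {L : Gr d k} {U : E k →ₗᵢ[ℝ] E d}
    (hU : LinearMap.range U.toLinearMap = L.1) (G : E d → ℝ≥0∞) :
    ∫⁻ y : L.1, G y ∂leb L = ∫⁻ v, G (U v) := by
  obtain ⟨e, he, heU⟩ := exists_measurePreserving_leb hU
  rw [← he.lintegral_comp_emb e.toHomeomorph.measurableEmbedding]
  simp only [heU]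

/-- The maximal function of `G : ℝ^d → [0,∞]` over planes: the supremum of the integrals of `G` over
the translates of `L`. For `G = |f|` it is `maxN f`. -/
noncomputable def planeMax (G : E d → ℝ≥0∞) (L : Gr d k) : ℝ≥0∞ :=
  ⨆ x : E d, ∫⁻ y : L.1, G (x + (y : E d)) ∂leb L

theorem planeMax_eq_iSup {L : Gr d k} {U : E k →ₗᵢ[ℝ] E d}
    (hU : LinearMap.range U.toLinearMap = L.1) (G : E d → ℝ≥0∞) :
    planeMax G L = ⨆ x : E d, ∫⁻ v, G (x + U v) :=
  iSup_congr fun x => lintegral_leb hU fun y => G (x + y)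

theorem planeMax_mono {G G' : E d → ℝ≥0∞} (h : ∀ x, G x ≤ G' x) (L : Gr d k) :
    planeMax G L ≤ planeMax G' L :=
  iSup_mono fun _ => lintegral_mono fun _ => h _

theorem planeMax_add_le {G G' : E d → ℝ≥0∞} (hG' : Measurable G') (L : Gr d k) :
    planeMax (fun x => G x + G' x) L ≤ planeMax G L + planeMax G' L := by
  refine iSup_le fun x => ?_
  rw [lintegral_add_right _ (by fun_prop)]
  exact add_le_add (le_iSup (fun x : E d => ∫⁻ y : L.1, G (x + (y : E d)) ∂leb L) x)
    (le_iSup (fun x : E d => ∫⁻ y : L.1, G' (x + (y : E d)) ∂leb L) x)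

/-- The composition `θ ∘ U` of a linear isometry `U` into `ℝ^d` with `θ ∈ O(d)`. -/
noncomputable def rotateIsometry (θ : O d) (U : E k →ₗᵢ[ℝ] E d) : E k →ₗᵢ[ℝ] E d :=
  (Unitary.linearIsometryEquiv θ).toLinearIsometry.comp U

@[simp] theorem rotateIsometry_apply (θ : O d) (U : E k →ₗᵢ[ℝ] E d) (v : E k) :
    rotateIsometry θ U v = θ.1 (U v) := rfl

theorem range_rotateIsometry {L : Gr d k} {U : E k →ₗᵢ[ℝ] E d}
    (hU : LinearMap.range U.toLinearMap = L.1) (θ : O d) :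
    LinearMap.range (rotateIsometry θ U).toLinearMap = (rotate θ L).1 :=
  (LinearMap.range_comp _ _).trans (congrArg (Submodule.map _) hU)

theorem lowerSemicontinuous_planeMax {G : E d → ℝ≥0∞} (hG : LowerSemicontinuous G) :
    LowerSemicontinuous (planeMax G : Gr d k → ℝ≥0∞) := by
  refine lowerSemicontinuous_of_rotate fun L => ?_
  obtain ⟨U, hU⟩ := exists_linearIsometry_range_eq L
  simp_rw [planeMax_eq_iSup (range_rotateIsometry hU _), rotateIsometry_apply]
  exact lowerSemicontinuous_iSup fun x => lowerSemicontinuous_lintegral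
    (fun θ => hG.measurable.comp (by fun_prop)) fun v => hG.comp (by fun_prop)

end PlaneMax

section Plates

variable {d k : ℕ}

theorem mem_plate {δ : ℝ} {L : Gr d k} {a y : E d} :
    y ∈ plate δ L a ↔ ∃ v ∈ L.1, ‖v‖ < 1 / 2 ∧ ‖y - a - v‖ < δ := by
  rw [plate, Metric.mem_thickening_iff]
  constructor
  · rintro ⟨z, ⟨hz1, hz2⟩, hz3⟩
    refine ⟨z - a, hz2, ?_, ?_⟩
    · rwa [mem_ball_iff_norm] at hz1
    · rwa [sub_sub_sub_cancel_right, ← dist_eq_norm]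
  · rintro ⟨v, hv, h1, h2⟩
    refine ⟨a + v, ⟨?_, ?_⟩, ?_⟩
    · simpa [mem_ball_iff_norm] using h1
    · simpa using hv
    · rwa [dist_eq_norm, ← sub_sub]

theorem mem_plate_iff_of_range_eq {δ : ℝ} {L : Gr d k} {U : E k →ₗᵢ[ℝ] E d}
    (hU : LinearMap.range U.toLinearMap = L.1) {a y : E d} :
    y ∈ plate δ L a ↔ ∃ v : E k, ‖v‖ < 1 / 2 ∧ ‖y - a - U v‖ < δ := by
  rw [mem_plate, ← hU]
  constructor
  · rintro ⟨_, ⟨v, rfl⟩, h1, h2⟩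
    exact ⟨v, by simpa using h1, h2⟩
  · rintro ⟨v, h1, h2⟩
    exact ⟨U v, ⟨v, rfl⟩, by simpa using h1, h2⟩

theorem isOpen_plate {δ : ℝ} {L : Gr d k} {a : E d} : IsOpen (plate δ L a) :=
  Metric.isOpen_thickening

theorem plate_eq_preimage_add (δ : ℝ) (L : Gr d k) (a : E d) :
    plate δ L a = (fun x => -a + x) ⁻¹' plate δ L 0 := by
  ext y
  simp only [mem_plate, mem_preimage, sub_zero, neg_add_eq_sub]

theorem plate_eq_preimage_rotate (δ : ℝ) (θ : O d) (L : Gr d k) :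
    plate δ L 0 = Unitary.linearIsometryEquiv θ ⁻¹' plate δ (rotate θ L) 0 := by
  ext y
  simp only [mem_plate, mem_preimage, sub_zero, mem_rotate]
  change _ ↔ ∃ v, _ ∧ _ ∧ ‖θ.1 y - v‖ < δ
  constructor
  · rintro ⟨v, hv, hv_norm, hyv⟩
    exact ⟨θ.1 v, ⟨v, hv, rfl⟩, by rwa [Unitary.norm_map],
      by rwa [← map_sub, Unitary.norm_map]⟩
  · rintro ⟨_, ⟨v, hv, rfl⟩, hv_norm, hyv⟩
    exact ⟨v, hv, by rwa [Unitary.norm_map] at hv_norm,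
      by rwa [← map_sub, Unitary.norm_map] at hyv⟩

theorem volume_plate_eq_volume_plate (δ : ℝ) (L L' : Gr d k) (a b : E d) :
    volume (plate δ L a) = volume (plate δ L' b) := by
  obtain ⟨θ, rfl⟩ := exists_rotate_eq L L'
  rw [plate_eq_preimage_add, measure_preimage_add, plate_eq_preimage_add δ _ b,
    measure_preimage_add, plate_eq_preimage_rotate δ θ L]
  exact (Unitary.linearIsometryEquiv θ).measurePreserving.measure_preimage
    isOpen_plate.measurableSet.nullMeasurableSet

theorem ball_subset_plate {δ : ℝ} {L : Gr d k} {a : E d} : Metric.ball a δ ⊆ plate δ L a :=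
  fun y hy => mem_plate.2
    ⟨0, L.1.zero_mem, by norm_num, by simpa [dist_eq_norm] using hy⟩

theorem volume_plate_pos {δ : ℝ} (hδ : 0 < δ) (L : Gr d k) (a : E d) :
    0 < volume (plate δ L a) :=
  lt_of_lt_of_le (Metric.measure_ball_pos _ _ hδ) (measure_mono ball_subset_plate)

theorem plate_subset_ball {δ : ℝ} {L : Gr d k} {a : E d} :
    plate δ L a ⊆ Metric.ball a (1 / 2 + δ) := by
  intro y hy
  obtain ⟨v, -, h1, h2⟩ := mem_plate.1 hy
  rw [mem_ball_iff_norm]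
  calc ‖y - a‖ = ‖v + (y - a - v)‖ := by congr 1; abel
    _ ≤ ‖v‖ + ‖y - a - v‖ := norm_add_le _ _
    _ < _ := by linarith

/-- The maximal function of `G : ℝ^d → [0,∞]` over plates: the supremum of the averages of `G` over
the translates of the plate of thickness `δ`. For `G = |f|` it is `maxM δ f`. -/
noncomputable def plateMax (δ : ℝ) (G : E d → ℝ≥0∞) (L : Gr d k) : ℝ≥0∞ :=
  ⨆ a : E d, (volume (plate δ L a))⁻¹ * ∫⁻ y in plate δ L a, G y

theorem isOpen_setOf_mem_plate_rotate (δ : ℝ) (L : Gr d k) (a y : E d) :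
    IsOpen {θ : O d | y ∈ plate δ (rotate θ L) a} := by
  obtain ⟨U, hU⟩ := exists_linearIsometry_range_eq L
  simp only [mem_plate_iff_of_range_eq (range_rotateIsometry hU _), rotateIsometry_apply,
    ofPred_exists, ofPred_and]
  exact isOpen_iUnion fun v => isOpen_const.inter (isOpen_lt (by fun_prop) continuous_const)

theorem lowerSemicontinuous_plateMax {δ : ℝ} (hδ : 0 < δ) (G : E d → ℝ≥0∞) :
    LowerSemicontinuous (plateMax δ G : Gr d k → ℝ≥0∞) := by
  refine lowerSemicontinuous_of_rotate fun L => lowerSemicontinuous_iSup fun a => ?_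
  simp_rw [fun θ : O d => volume_plate_eq_volume_plate δ (rotate θ L) L a a,
    ← withDensity_apply G (isOpen_plate (δ := δ) (a := a)).measurableSet]
  refine (ENNReal.continuous_const_mul (ENNReal.inv_ne_top.2
    (volume_plate_pos hδ L a).ne')).comp_lowerSemicontinuous ?_ fun x y h => mul_le_mul_right h _
  exact lowerSemicontinuous_measure (fun _ => isOpen_plate.measurableSet)
    (isOpen_setOf_mem_plate_rotate δ L a)

theorem setLIntegral_plate_le_mul_plateMax {δ : ℝ} (hδ : 0 < δ) (G : E d → ℝ≥0∞) (L : Gr d k)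
    (a : E d) : ∫⁻ y in plate δ L a, G y ≤ volume (plate δ L a) * plateMax δ G L := by
  have h_finite : volume (plate δ L a) ≠ ∞ :=
    ((measure_mono plate_subset_ball).trans_lt measure_ball_lt_top).ne
  calc ∫⁻ y in plate δ L a, G y
      = volume (plate δ L a) * ((volume (plate δ L a))⁻¹ * ∫⁻ y in plate δ L a, G y) := by
        rw [← mul_assoc, ENNReal.mul_inv_cancel (volume_plate_pos hδ L a).ne' h_finite, one_mul]
    _ ≤ _ := mul_le_mul_right
        (le_iSup (fun a => (volume (plate δ L a))⁻¹ * ∫⁻ y in plate δ L a, G y) a) _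

end Plates

section Volume

variable {d k : ℕ}

/-- The volume of the unit ball of `ℝ^n`. -/
noncomputable def unitBallVolume (n : ℕ) : ℝ≥0∞ := volume (Metric.ball (0 : E n) 1)

theorem unitBallVolume_ne_zero (n : ℕ) : unitBallVolume n ≠ 0 :=
  (Metric.measure_ball_pos _ _ one_pos).ne'

theorem unitBallVolume_ne_top (n : ℕ) : unitBallVolume n ≠ ∞ := measure_ball_lt_top.ne

theorem volume_ball_eq_mul {n : ℕ} (x : E n) {r : ℝ} (hr : 0 < r) :
    volume (Metric.ball x r) = ENNReal.ofReal r ^ n * unitBallVolume n := by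
  rw [Measure.addHaar_ball_of_pos _ _ hr, unitBallVolume, ENNReal.ofReal_pow hr.le]
  simp

theorem volume_setOf_norm_sub_lt_le (U : E k →ₗᵢ[ℝ] E d) (p : E d) {r : ℝ} (hr : 0 < r) :
    volume {v : E k | ‖p - U v‖ < r} ≤ ENNReal.ofReal (2 * r) ^ k * unitBallVolume k := by
  rcases Set.eq_empty_or_nonempty {v : E k | ‖p - U v‖ < r} with h | ⟨v0, hv0⟩
  · simp [h]
  · rw [← volume_ball_eq_mul v0 (by positivity)]
    refine measure_mono fun v hv => ?_
    rw [mem_ball_iff_norm, ← U.norm_map, map_sub]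
    calc ‖U v - U v0‖ = ‖(p - U v0) - (p - U v)‖ := by congr 1; abel
      _ ≤ _ := norm_sub_le _ _
      _ < _ := by simp only [mem_ofPred_eq] at hv hv0; linarith

theorem lintegral_volume_tube (U : E k →ₗᵢ[ℝ] E d) (a : E d) {ρ s : ℝ} (hs : 0 < s) :
    ∫⁻ u : E d, volume {v : E k | ‖v‖ < ρ ∧ ‖u - a - U v‖ < s} =
      ENNReal.ofReal s ^ d * unitBallVolume d * volume (Metric.ball (0 : E k) ρ) := by
  let S : Set (E d × E k) := {q | ‖q.2‖ < ρ ∧ ‖q.1 - a - U q.2‖ < s}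
  have hS : MeasurableSet S := by
    have h_norm : Continuous fun q : E d × E k => ‖q.2‖ := by fun_prop
    have h_dist : Continuous fun q : E d × E k => ‖q.1 - a - U q.2‖ := by fun_prop
    exact ((isOpen_lt h_norm continuous_const).inter
      (isOpen_lt h_dist continuous_const)).measurableSet
  have h_fiber (v : E k) : volume ((fun u => (u, v)) ⁻¹' S) =
      (Metric.ball (0 : E k) ρ).indicator (fun _ => ENNReal.ofReal s ^ d * unitBallVolume d) v := by
    by_cases hv : ‖v‖ < ρ
    · rw [indicator_of_mem (by simpa using hv), ← volume_ball_eq_mul (a + U v) hs]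
      congr 1
      ext u
      simp [S, hv, dist_eq_norm, sub_sub]
    · rw [indicator_of_notMem (by simpa using hv)]
      simp [S, hv]
  calc ∫⁻ u : E d, volume {v : E k | ‖v‖ < ρ ∧ ‖u - a - U v‖ < s}
      = (volume.prod volume) S := (Measure.prod_apply hS).symm
    _ = ∫⁻ v : E k, volume ((fun u => (u, v)) ⁻¹' S) := Measure.prod_apply_symm hS
    _ = _ := by
      simp_rw [h_fiber]
      exact lintegral_indicator_const Metric.isOpen_ball.measurableSet _

theorem volume_plate_mul_le {δ : ℝ} (h0 : 0 < δ) (h1 : δ < 1) (L : Gr d k) (a : E d) :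
    unitBallVolume k * (volume (plate δ L a) * ENNReal.ofReal δ ^ k) ≤
      2 ^ d * unitBallVolume d * volume (Metric.ball (0 : E k) 2) * ENNReal.ofReal δ ^ d := by
  obtain ⟨U, hU⟩ := exists_linearIsometry_range_eq L
  have h_tube : volume (plate δ L a) * (ENNReal.ofReal δ ^ k * unitBallVolume k) ≤
      ENNReal.ofReal (2 * δ) ^ d * unitBallVolume d * volume (Metric.ball (0 : E k) 2) := by
    rw [← lintegral_volume_tube U a (ρ := 2) (by positivity : 0 < 2 * δ), mul_comm,
      ← lintegral_indicator_const isOpen_plate.measurableSet]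
    refine lintegral_mono (indicator_le fun u hu => ?_)
    obtain ⟨v₀, hv₀, hu₀⟩ := (mem_plate_iff_of_range_eq hU).1 hu
    rw [← volume_ball_eq_mul v₀ h0]
    refine measure_mono fun v hv => ⟨?_, ?_⟩ <;> rw [mem_ball_iff_norm] at hv
    · calc ‖v‖ = ‖v₀ + (v - v₀)‖ := by rw [add_sub_cancel]
        _ ≤ ‖v₀‖ + ‖v - v₀‖ := norm_add_le _ _
        _ < 2 := by linarith
    · calc ‖u - a - U v‖ = ‖(u - a - U v₀) - U (v - v₀)‖ := by rw [map_sub]; congr 1; abel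
        _ ≤ ‖u - a - U v₀‖ + ‖v - v₀‖ := (norm_sub_le _ _).trans_eq (by rw [U.norm_map])
        _ < 2 * δ := by linarith
  rw [ENNReal.ofReal_mul zero_le_two, mul_pow, ENNReal.ofReal_ofNat] at h_tube
  convert h_tube using 1 <;> ring

theorem exists_volume_plate_le (d k : ℕ) : ∃ C : ℝ≥0∞, C ≠ ∞ ∧ ∀ δ : ℝ, 0 < δ → δ < 1 →
    ∀ (L : Gr d k) (a : E d),
      volume (plate δ L a) * ENNReal.ofReal δ ^ k ≤ C * ENNReal.ofReal δ ^ d := by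
  refine ⟨(unitBallVolume k)⁻¹ * (2 ^ d * unitBallVolume d * volume (Metric.ball (0 : E k) 2)),
    ENNReal.mul_ne_top (ENNReal.inv_ne_top.2 (unitBallVolume_ne_zero k))
      (ENNReal.mul_ne_top (ENNReal.mul_ne_top (by simp) (unitBallVolume_ne_top d))
        measure_ball_lt_top.ne), fun δ h0 h1 L a => ?_⟩
  rw [mul_assoc, ← ENNReal.mul_le_iff_le_inv (unitBallVolume_ne_zero k) (unitBallVolume_ne_top k)]
  exact volume_plate_mul_le h0 h1 L a

theorem mul_le_volume_plate {δ : ℝ} (h0 : 0 < δ) (L : Gr d k) (a : E d) :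
    unitBallVolume d * volume (Metric.ball (0 : E k) (1 / 2)) * ENNReal.ofReal δ ^ d ≤
      2 ^ k * unitBallVolume k * ENNReal.ofReal δ ^ k * volume (plate δ L a) := by
  obtain ⟨U, hU⟩ := exists_linearIsometry_range_eq L
  have h_tube : ENNReal.ofReal δ ^ d * unitBallVolume d * volume (Metric.ball (0 : E k) (1 / 2)) ≤
      (ENNReal.ofReal (2 * δ) ^ k * unitBallVolume k) * volume (plate δ L a) := by
    rw [← lintegral_volume_tube U a (ρ := 1 / 2) h0,
      ← lintegral_indicator_const isOpen_plate.measurableSet]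
    refine lintegral_mono fun u => ?_
    by_cases hu : u ∈ plate δ L a
    · rw [indicator_of_mem hu]
      exact (measure_mono fun v hv => hv.2).trans (volume_setOf_norm_sub_lt_le U (u - a) h0)
    · have h_empty : {v : E k | ‖v‖ < 1 / 2 ∧ ‖u - a - U v‖ < δ} = ∅ :=
        eq_empty_iff_forall_notMem.2 fun v hv => hu ((mem_plate_iff_of_range_eq hU).2 ⟨v, hv⟩)
      rw [h_empty, measure_empty]
      exact zero_le
  rw [ENNReal.ofReal_mul zero_le_two, mul_pow, ENNReal.ofReal_ofNat] at h_tube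
  convert h_tube using 1 <;> ring

theorem exists_le_volume_plate (d k : ℕ) : ∃ C : ℝ≥0∞, C ≠ ∞ ∧ ∀ δ : ℝ, 0 < δ →
    ∀ (L : Gr d k) (a : E d),
      ENNReal.ofReal δ ^ d ≤ C * ENNReal.ofReal δ ^ k * volume (plate δ L a) := by
  have h0 : unitBallVolume d * volume (Metric.ball (0 : E k) (1 / 2)) ≠ 0 :=
    mul_ne_zero (unitBallVolume_ne_zero d) (Metric.measure_ball_pos _ _ one_half_pos).ne'
  have h_top : unitBallVolume d * volume (Metric.ball (0 : E k) (1 / 2)) ≠ ∞ :=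
    ENNReal.mul_ne_top (unitBallVolume_ne_top d) measure_ball_lt_top.ne
  refine ⟨(unitBallVolume d * volume (Metric.ball (0 : E k) (1 / 2)))⁻¹ *
    (2 ^ k * unitBallVolume k), ENNReal.mul_ne_top (ENNReal.inv_ne_top.2 h0)
      (ENNReal.mul_ne_top (by simp) (unitBallVolume_ne_top k)), fun δ hδ L a => ?_⟩
  rw [mul_assoc, mul_assoc, ← ENNReal.mul_le_iff_le_inv h0 h_top, ← mul_assoc]
  exact mul_le_volume_plate hδ L a

end Volume

section BddSupported

variable {d k : ℕ}

/-- Measurable functions bounded by `Λ` that vanish outside the ball of radius `R`. Every integral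
of such a function over a line, a plane or a ball converges. -/
structure BddSupported (Λ R : ℝ) (f : E d → ℝ) : Prop where
  meas : Measurable f
  bound : ∀ x, |f x| ≤ Λ
  supp : ∀ x, R ≤ ‖x‖ → f x = 0

theorem integrable_of_bounded_of_ae_notMem_eq_zero {X : Type*} [MeasurableSpace X] {ν : Measure X}
    {f : X → ℝ} {S : Set X} {Λ : ℝ} (hf : Measurable f) (hb : ∀ x, |f x| ≤ Λ)
    (hS : ν S ≠ ∞) (hs : ∀ᵐ x ∂ν, x ∉ S → f x = 0) : Integrable f ν :=
  (Measure.integrableOn_of_bounded hS hf.aestronglyMeasurable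
    (ae_of_all _ hb)).integrable_of_ae_notMem_eq_zero hs

namespace BddSupported

variable {Λ Λ' R R' : ℝ} {f g : E d → ℝ}

theorem nonneg (hf : BddSupported Λ R f) : 0 ≤ Λ := (abs_nonneg _).trans (hf.bound 0)

theorem integrable_comp_isometry (hf : BddSupported Λ R f) (U : E k →ₗᵢ[ℝ] E d) (x : E d) :
    Integrable fun v => f (x + U v) := by
  refine integrable_of_bounded_of_ae_notMem_eq_zero (S := Metric.ball 0 (R + ‖x‖))
    (hf.meas.comp (by fun_prop)) (fun _ => hf.bound _) measure_ball_lt_top.ne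
    (ae_of_all _ fun v hv => hf.supp _ ?_)
  have hRv : R + ‖x‖ ≤ ‖U v‖ := by simpa using hv
  have h_triangle := norm_le_add_norm_add (U v) x
  rw [add_comm (U v)] at h_triangle
  linarith

theorem sub (hf : BddSupported Λ R f) (hg : BddSupported Λ' R' g) :
    BddSupported (Λ + Λ') (max R R') (fun x => f x - g x) where
  meas := hf.meas.sub hg.meas
  bound x := (abs_sub _ _).trans (add_le_add (hf.bound x) (hg.bound x))
  supp x hx := by
    rw [hf.supp x ((le_max_left _ _).trans hx), hg.supp x ((le_max_right _ _).trans hx), sub_zero]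

theorem mono (hf : BddSupported Λ R f) (h : Λ ≤ Λ') (h' : R ≤ R') : BddSupported Λ' R' f where
  meas := hf.meas
  bound x := (hf.bound x).trans h
  supp x hx := hf.supp x (h'.trans hx)

end BddSupported

end BddSupported

section Average

variable {d : ℕ}

/-- The uniform distribution on the ball of radius `r` around the origin (the zero measure if
`r ≤ 0`). -/
noncomputable def uniformBall (d : ℕ) (r : ℝ) : Measure (E d) :=
  ProbabilityTheory.cond volume (Metric.ball 0 r)

instance (d : ℕ) (r : ℝ) : IsZeroOrProbabilityMeasure (uniformBall d r) :=
  inferInstanceAs (IsZeroOrProbabilityMeasure (ProbabilityTheory.cond _ _))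

theorem isProbabilityMeasure_uniformBall (d : ℕ) {r : ℝ} (hr : 0 < r) :
    IsProbabilityMeasure (uniformBall d r) :=
  ProbabilityTheory.cond_isProbabilityMeasure_of_finite (Metric.measure_ball_pos _ _ hr).ne'
    measure_ball_lt_top.ne

theorem ae_uniformBall_norm_lt (d : ℕ) (r : ℝ) : ∀ᵐ z ∂uniformBall d r, ‖z‖ < r :=
  ProbabilityTheory.ae_cond_of_forall_mem Metric.isOpen_ball.measurableSet fun z hz => by
    simpa using hz

theorem measurePreserving_uniformBall (e : E d ≃ₗᵢ[ℝ] E d) (r : ℝ) :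
    MeasurePreserving e (uniformBall d r) (uniformBall d r) := by
  have h_restrict := e.measurePreserving.restrict_preimage
    (Metric.isOpen_ball (x := (0 : E d)) (ε := r)).measurableSet
  rw [e.preimage_ball, map_zero] at h_restrict
  exact h_restrict.smul_measure _

theorem lintegral_uniformBall (r : ℝ) (F : E d → ℝ≥0∞) :
    ∫⁻ z, F z ∂uniformBall d r =
      (volume (Metric.ball (0 : E d) r))⁻¹ * ∫⁻ z in Metric.ball 0 r, F z := by
  rw [uniformBall, ProbabilityTheory.cond, lintegral_smul_measure, smul_eq_mul]

/-- The average of `f` over the ball of radius `r` around `x`. -/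
noncomputable def ballAvg (r : ℝ) (f : E d → ℝ) (x : E d) : ℝ :=
  ∫ z, f (x + z) ∂uniformBall d r

namespace BddSupported

variable {Λ Λ' R R' : ℝ} {f g : E d → ℝ}

theorem integrable_uniformBall (hf : BddSupported Λ R f) (x : E d) (r : ℝ) :
    Integrable (fun z => f (x + z)) (uniformBall d r) :=
  Integrable.of_bound (hf.meas.comp (measurable_const_add x)).aestronglyMeasurable Λ
    (ae_of_all _ fun _ => hf.bound _)

theorem ballAvg (hf : BddSupported Λ R f) {r : ℝ} (hr : 0 < r) :
    BddSupported Λ (R + r) (ballAvg r f) where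
  meas :=
    have h_shift : Measurable fun q : E d × E d => f (q.1 + q.2) := hf.meas.comp (by fun_prop)
    h_shift.stronglyMeasurable.integral_prod_right'.measurable
  bound x := by
    have := isProbabilityMeasure_uniformBall d hr
    have h_le := norm_integral_le_of_norm_le_const (μ := uniformBall d r)
      (ae_of_all _ fun z => (Real.norm_eq_abs _).trans_le (hf.bound (x + z)))
    rwa [probReal_univ, mul_one] at h_le
  supp x hx := by
    refine integral_eq_zero_of_ae ?_
    filter_upwards [ae_uniformBall_norm_lt d r] with z hz
    exact hf.supp _ (by linarith [norm_le_add_norm_add x z])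

theorem ballAvg_sub (hf : BddSupported Λ R f) (hg : BddSupported Λ' R' g) (r : ℝ) (x : E d) :
    KPlane.ballAvg r (fun x => f x - g x) x = KPlane.ballAvg r f x - KPlane.ballAvg r g x :=
  integral_sub (hf.integrable_uniformBall x r) (hg.integrable_uniformBall x r)

theorem ballAvg_comm (hf : BddSupported Λ R f) (r s : ℝ) (x : E d) :
    KPlane.ballAvg r (KPlane.ballAvg s f) x = KPlane.ballAvg s (KPlane.ballAvg r f) x := by
  unfold KPlane.ballAvg
  rw [integral_integral_swap]
  · simp only [add_right_comm]
  · exact Integrable.of_bound (hf.meas.comp (by fun_prop)).aestronglyMeasurable Λ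
      (ae_of_all _ fun _ => hf.bound _)

end BddSupported

end Average

section XrayTransform

variable {n : ℕ}

/-- The X-ray transform of `g` in the direction `θ e₀`: the integrals of `g` over the lines
`θ (ℝ e₀ + y)`, `y ∈ ℝ^n`. -/
noncomputable def xray (θ : O (n + 1)) (g : E (n + 1) → ℝ) (y : E n) : ℝ :=
  ∫ t : ℝ, g (θ.1 (cons t y))

variable {Λ Λ' R R' : ℝ} {f g : E (n + 1) → ℝ}

theorem measurable_xray (hg : Measurable g) :
    Measurable fun q : O (n + 1) × E n => xray q.1 g q.2 :=
  have h_line : Measurable fun q : (O (n + 1) × E n) × ℝ => g (q.1.1.1 (cons q.2 q.1.2)) := by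
    refine hg.comp (Continuous.measurable ?_)
    fun_prop
  h_line.stronglyMeasurable.integral_prod_right'.measurable

namespace BddSupported

theorem apply_line_eq_zero (hg : BddSupported Λ R g) (θ : O (n + 1)) (y : E n) {t : ℝ}
    (ht : t ∉ Metric.ball 0 R) : g (θ.1 (cons t y)) = 0 := by
  refine hg.supp _ ?_
  rw [Unitary.norm_map]
  exact le_trans (by simpa using ht) (abs_le_norm_cons t y)

theorem integrable_line (hg : BddSupported Λ R g) (θ : O (n + 1)) (y : E n) :
    Integrable fun t : ℝ => g (θ.1 (cons t y)) :=
  integrable_of_bounded_of_ae_notMem_eq_zero (hg.meas.comp (by fun_prop)) (fun _ => hg.bound _)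
    measure_ball_lt_top.ne (ae_of_all _ fun _ => hg.apply_line_eq_zero θ y)

theorem xray (hg : BddSupported Λ R g) (hR : 0 ≤ R) (θ : O (n + 1)) :
    BddSupported (Λ * (2 * R)) R (xray θ g) where
  meas := (measurable_xray hg.meas).comp measurable_prodMk_left
  bound y := by
    have h_ball : KPlane.xray θ g y = ∫ t in Metric.ball (0 : ℝ) R, g (θ.1 (cons t y)) :=
      (setIntegral_eq_integral_of_forall_compl_eq_zero fun _ => hg.apply_line_eq_zero θ y).symm
    rw [h_ball, ← Real.norm_eq_abs, ← Real.volume_real_ball hR]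
    exact norm_setIntegral_le_of_norm_le_const measure_ball_lt_top fun t _ => hg.bound _
  supp y hy := by
    refine integral_eq_zero_of_ae (ae_of_all _ fun t => hg.supp _ ?_)
    rw [Unitary.norm_map]
    exact hy.trans (norm_le_norm_cons t y)

theorem xray_sub (hf : BddSupported Λ R f) (hg : BddSupported Λ' R' g) (θ : O (n + 1)) (y : E n) :
    KPlane.xray θ (fun x => f x - g x) y = KPlane.xray θ f y - KPlane.xray θ g y :=
  integral_sub (hf.integrable_line θ y) (hg.integrable_line θ y)

theorem integrable_line_add (hg : BddSupported Λ R g) (θ : O (n + 1)) (y : E n) (r : ℝ) :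
    Integrable (fun q : ℝ × E (n + 1) => g (θ.1 (cons q.1 y + q.2)))
      (volume.prod (uniformBall (n + 1) r)) := by
  refine integrable_of_bounded_of_ae_notMem_eq_zero (S := Metric.ball (0 : ℝ) (R + r) ×ˢ univ)
    (hg.meas.comp (by fun_prop)) (fun _ => hg.bound _) ?_ ?_
  · rw [Measure.prod_prod]
    exact ENNReal.mul_ne_top measure_ball_lt_top.ne (measure_ne_top _ _)
  · filter_upwards [Measure.quasiMeasurePreserving_snd.ae (ae_uniformBall_norm_lt (n + 1) r)]
      with ⟨t, z⟩ hz ht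
    have hRt : R + r ≤ |t| := by simpa using ht
    refine hg.supp _ ?_
    rw [Unitary.norm_map]
    linarith [abs_le_norm_cons t y, norm_le_add_norm_add (cons t y) z]

theorem xray_ballAvg (hg : BddSupported Λ R g) (r : ℝ) (θ : O (n + 1)) (y : E n) :
    KPlane.xray θ (KPlane.ballAvg r g) y =
      ∫ z, KPlane.xray θ g (y + tail n z) ∂uniformBall (n + 1) r := by
  unfold KPlane.xray KPlane.ballAvg
  have h_rotate (t : ℝ) : ∫ z, g (θ.1 (cons t y) + z) ∂uniformBall (n + 1) r =
      ∫ z, g (θ.1 (cons t y + z)) ∂uniformBall (n + 1) r := by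
    rw [← (measurePreserving_uniformBall (Unitary.linearIsometryEquiv θ) r).integral_comp
      (Unitary.linearIsometryEquiv θ).toHomeomorph.measurableEmbedding]
    simp only [map_add]
    rfl
  simp_rw [h_rotate]
  rw [integral_integral_swap (hg.integrable_line_add θ y r)]
  refine integral_congr_ae (ae_of_all _ fun z => ?_)
  calc ∫ t : ℝ, g (θ.1 (cons t y + z))
      = ∫ t : ℝ, g (θ.1 (cons (t + z 0) (y + tail n z))) := by simp_rw [cons_add, cons_head_tail]
    _ = ∫ t : ℝ, g (θ.1 (cons t (y + tail n z))) :=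
      integral_add_right_eq_self (fun t : ℝ => g (θ.1 (cons t (y + tail n z)))) (z 0)

theorem enorm_xray_ballAvg_le (hg : BddSupported Λ R g) (r : ℝ) (θ : O (n + 1)) (y : E n) :
    ‖KPlane.xray θ (KPlane.ballAvg r g) y‖ₑ ≤
      ∫⁻ z, ‖KPlane.xray θ g (y + tail n z)‖ₑ ∂uniformBall (n + 1) r := by
  rw [hg.xray_ballAvg]
  exact enorm_integral_le_lintegral_enorm _

end BddSupported

end XrayTransform

section Domination

variable {d k n m : ℕ}

theorem ofReal_pow_ne_zero {r : ℝ} (hr : 0 < r) (n : ℕ) : ENNReal.ofReal r ^ n ≠ 0 :=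
  pow_ne_zero _ (by simpa using hr)

theorem ofReal_pow_ne_top (r : ℝ) (n : ℕ) : ENNReal.ofReal r ^ n ≠ ∞ :=
  ENNReal.pow_ne_top ENNReal.ofReal_ne_top

theorem setLIntegral_ball_tail_le (r : ℝ) {H : E n → ℝ≥0∞} (hH : Measurable H) :
    ∫⁻ z in Metric.ball (0 : E (n + 1)) r, H (tail n z) ≤
      ENNReal.ofReal (2 * r) * ∫⁻ w in Metric.ball 0 r, H w := by
  have h_meas : Measurable ((Metric.ball (0 : E (n + 1)) r).indicator fun z => H (tail n z)) :=
    (hH.comp (by fun_prop)).indicator Metric.isOpen_ball.measurableSet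
  rw [← lintegral_indicator Metric.isOpen_ball.measurableSet,
    ← lintegral_indicator Metric.isOpen_ball.measurableSet, ← Real.volume_ball 0,
    ← measurePreserving_cons.lintegral_comp h_meas]
  calc ∫⁻ q : ℝ × E n, (Metric.ball (0 : E (n + 1)) r).indicator (fun z => H (tail n z))
        (cons q.1 q.2) ∂(volume.prod volume)
      ≤ ∫⁻ q : ℝ × E n, (Metric.ball (0 : ℝ) r).indicator (fun _ => 1) q.1 *
          (Metric.ball 0 r).indicator H q.2 ∂(volume.prod volume) := by
        refine lintegral_mono fun q => ?_
        by_cases hq : cons q.1 q.2 ∈ Metric.ball 0 r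
        · have hq' : ‖cons q.1 q.2‖ < r := mem_ball_zero_iff.1 hq
          rw [indicator_of_mem hq, tail_cons, indicator_of_mem, indicator_of_mem, one_mul]
          · exact mem_ball_zero_iff.2 ((norm_le_norm_cons _ _).trans_lt hq')
          · exact mem_ball_zero_iff.2 ((abs_le_norm_cons _ _).trans_lt hq')
        · rw [indicator_of_notMem hq]
          exact zero_le
    _ = _ := by
        rw [lintegral_prod_mul
          ((measurable_const.indicator Metric.isOpen_ball.measurableSet).aemeasurable)
          ((hH.indicator Metric.isOpen_ball.measurableSet).aemeasurable),
          lintegral_indicator_const Metric.isOpen_ball.measurableSet, one_mul]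

theorem lintegral_uniformBall_tail_le (n : ℕ) {r : ℝ} (hr : 0 < r) {H : E n → ℝ≥0∞}
    (hH : Measurable H) :
    ENNReal.ofReal r ^ n * ∫⁻ z, H (tail n z) ∂uniformBall (n + 1) r ≤
      (unitBallVolume (n + 1))⁻¹ * 2 * ∫⁻ w in Metric.ball 0 r, H w := by
  rw [lintegral_uniformBall, volume_ball_eq_mul _ hr]
  have h_tail := setLIntegral_ball_tail_le r hH
  rw [ENNReal.ofReal_mul zero_le_two, ENNReal.ofReal_ofNat] at h_tail
  set ρ := ENNReal.ofReal r
  have hρ0 : ρ ^ (n + 1) ≠ 0 := ofReal_pow_ne_zero hr _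
  have hρt : ρ ^ (n + 1) ≠ ∞ := ofReal_pow_ne_top r _
  calc ρ ^ n * ((ρ ^ (n + 1) * unitBallVolume (n + 1))⁻¹ *
        ∫⁻ z in Metric.ball (0 : E (n + 1)) r, H (tail n z))
      ≤ ρ ^ n * ((ρ ^ (n + 1) * unitBallVolume (n + 1))⁻¹ *
          (2 * ρ * ∫⁻ w in Metric.ball 0 r, H w)) := by gcongr
    _ = ((ρ ^ (n + 1))⁻¹ * ρ ^ (n + 1)) *
          ((unitBallVolume (n + 1))⁻¹ * 2 * ∫⁻ w in Metric.ball 0 r, H w) := by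
        rw [ENNReal.mul_inv (Or.inl hρ0) (Or.inl hρt)]
        ring
    _ = _ := by rw [ENNReal.inv_mul_cancel hρ0 hρt, one_mul]

theorem lintegral_lintegral_ball (U : E k →ₗᵢ[ℝ] E d) (y : E d) (r : ℝ) {h : E d → ℝ≥0∞}
    (hh : Measurable h) :
    ∫⁻ v : E k, ∫⁻ w in Metric.ball (0 : E d) r, h (y + U v + w) =
      ∫⁻ u : E d, h u * volume {v : E k | ‖u - y - U v‖ < r} := by
  let S : Set (E k × E d) := {q | ‖q.2 - y - U q.1‖ < r}
  have hS : MeasurableSet S := by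
    have h_dist : Continuous fun q : E k × E d => ‖q.2 - y - U q.1‖ := by fun_prop
    exact (isOpen_lt h_dist continuous_const).measurableSet
  calc ∫⁻ v : E k, ∫⁻ w in Metric.ball (0 : E d) r, h (y + U v + w)
      = ∫⁻ v : E k, ∫⁻ u : E d, S.indicator (fun q => h q.2) (v, u) := by
        refine lintegral_congr fun v => ?_
        rw [← lintegral_indicator Metric.isOpen_ball.measurableSet,
          ← lintegral_add_left_eq_self _ (-(y + U v))]
        refine lintegral_congr fun u => ?_
        simp only [indicator, S, mem_ofPred_eq, mem_ball_zero_iff, add_sub_cancel,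
          neg_add_eq_sub, sub_sub]
    _ = ∫⁻ u : E d, ∫⁻ v : E k, S.indicator (fun q => h q.2) (v, u) :=
        lintegral_lintegral_swap ((hh.comp measurable_snd).indicator hS).aemeasurable
    _ = ∫⁻ u : E d, h u * volume {v : E k | ‖u - y - U v‖ < r} :=
        lintegral_congr fun u => lintegral_indicator_const (measurable_prodMk_right hS) (h u)

theorem exists_finset_tube_subset_plates (m : ℕ) (R : ℝ) :
    ∃ T : Finset (E m), ∀ {n : ℕ} {L : Gr n m} {U : E m →ₗᵢ[ℝ] E n},
      LinearMap.range U.toLinearMap = L.1 → ∀ (y : E n) {r : ℝ}, r < 1 →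
      ∃ v₀ : E m, ∀ u v, ‖u‖ < R → ‖u - y - U v‖ < r → ∃ s ∈ T, u ∈ plate r L (y + U (v₀ + s)) := by
  obtain ⟨S, -, hS_finite, hS⟩ := (isCompact_closedBall (0 : E m) (2 * (R + 1))).finite_cover_balls
    one_half_pos
  refine ⟨hS_finite.toFinset, fun {n L U} hU y r hr => ?_⟩
  have h_near {u : E n} {v : E m} (hu : ‖u‖ < R) (huv : ‖u - y - U v‖ < r) :
      ‖y + U v‖ < R + 1 := by
    calc ‖y + U v‖ = ‖u - (u - y - U v)‖ := by congr 1; abel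
      _ ≤ ‖u‖ + ‖u - y - U v‖ := norm_sub_le _ _
      _ < R + 1 := by linarith
  by_cases h_nonempty : ∃ v₀ u₀, ‖u₀‖ < R ∧ ‖u₀ - y - U v₀‖ < r
  · obtain ⟨v₀, u₀, hu₀, huv₀⟩ := h_nonempty
    refine ⟨v₀, fun u v hu huv => ?_⟩
    have hv : v - v₀ ∈ Metric.closedBall (0 : E m) (2 * (R + 1)) := by
      rw [mem_closedBall_zero_iff, ← U.norm_map]
      calc ‖U (v - v₀)‖ = ‖(y + U v) - (y + U v₀)‖ := by rw [map_sub, add_sub_add_left_eq_sub]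
        _ ≤ ‖y + U v‖ + ‖y + U v₀‖ := norm_sub_le _ _
        _ ≤ 2 * (R + 1) := by linarith [h_near hu huv, h_near hu₀ huv₀]
    obtain ⟨s, hs, hsv⟩ := mem_iUnion₂.1 (hS hv)
    refine ⟨s, hS_finite.mem_toFinset.2 hs, (mem_plate_iff_of_range_eq hU).2
      ⟨v - v₀ - s, by rwa [mem_ball_iff_norm] at hsv, ?_⟩⟩
    convert huv using 2
    simp only [map_sub, map_add]
    abel
  · push Not at h_nonempty
    exact ⟨0, fun u v hu huv => absurd huv (h_nonempty v u hu).not_gt⟩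

theorem mul_volume_tube_le_sum_indicator {ι : Type*} {r R : ℝ} (hr : 0 < r) (U : E m →ₗᵢ[ℝ] E n)
    {h : E n → ℝ≥0∞} (h_supp : ∀ x, R ≤ ‖x‖ → h x = 0) {y : E n} {T : Finset ι}
    {B : ι → Set (E n)}
    (h_cover : ∀ u v, ‖u‖ < R → ‖u - y - U v‖ < r → ∃ s ∈ T, u ∈ B s) (u : E n) :
    h u * volume {v : E m | ‖u - y - U v‖ < r} ≤
      ∑ s ∈ T, (2 ^ m * unitBallVolume m * ENNReal.ofReal r ^ m) * (B s).indicator h u := by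
  rcases eq_empty_or_nonempty {v : E m | ‖u - y - U v‖ < r} with h_empty | ⟨v, hv⟩
  · simp [h_empty]
  · rcases le_or_gt R ‖u‖ with hu | hu
    · simp [h_supp u hu]
    · obtain ⟨s, hs, hus⟩ := h_cover u v hu hv
      refine le_trans ?_ (Finset.single_le_sum (fun _ _ => zero_le) hs)
      rw [indicator_of_mem hus, mul_comm]
      gcongr
      refine (volume_setOf_norm_sub_lt_le U (u - y) hr).trans_eq ?_
      rw [ENNReal.ofReal_mul zero_le_two, mul_pow, ENNReal.ofReal_ofNat]
      ring

theorem exists_lintegral_mul_volume_tube_le (n m : ℕ) (R : ℝ) :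
    ∃ C : ℝ≥0∞, C ≠ ∞ ∧ ∀ r : ℝ, 0 < r → r < 1 → ∀ (L : Gr n m) (U : E m →ₗᵢ[ℝ] E n),
      LinearMap.range U.toLinearMap = L.1 → ∀ h : E n → ℝ≥0∞, Measurable h →
      (∀ x, R ≤ ‖x‖ → h x = 0) → ∀ y : E n,
      ∫⁻ u : E n, h u * volume {v : E m | ‖u - y - U v‖ < r} ≤
        C * (ENNReal.ofReal r ^ n * plateMax r h L) := by
  obtain ⟨C, hC, h_volume⟩ := exists_volume_plate_le n m
  obtain ⟨T, hT⟩ := exists_finset_tube_subset_plates m R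
  refine ⟨T.card * (2 ^ m * unitBallVolume m * C), by finiteness [unitBallVolume_ne_top m],
    fun r hr hr1 L U hU h hh h_supp y => ?_⟩
  obtain ⟨v₀, hv₀⟩ := hT hU y hr1
  calc ∫⁻ u : E n, h u * volume {v : E m | ‖u - y - U v‖ < r}
      ≤ ∫⁻ u : E n, ∑ s ∈ T, (2 ^ m * unitBallVolume m * ENNReal.ofReal r ^ m) *
          (plate r L (y + U (v₀ + s))).indicator h u :=
        lintegral_mono (mul_volume_tube_le_sum_indicator hr U h_supp hv₀)
    _ = ∑ s ∈ T, (2 ^ m * unitBallVolume m * ENNReal.ofReal r ^ m) *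
          ∫⁻ u in plate r L (y + U (v₀ + s)), h u := by
        have h_meas (s : E m) : Measurable ((plate r L (y + U (v₀ + s))).indicator h) :=
          hh.indicator isOpen_plate.measurableSet
        rw [lintegral_finsetSum _ fun s _ => (h_meas s).const_mul _]
        simp_rw [lintegral_const_mul _ (h_meas _), lintegral_indicator isOpen_plate.measurableSet]
    _ ≤ ∑ _s ∈ T, (2 ^ m * unitBallVolume m * C) * (ENNReal.ofReal r ^ n * plateMax r h L) := by
        refine Finset.sum_le_sum fun s _ => ?_
        calc _ ≤ (2 ^ m * unitBallVolume m * ENNReal.ofReal r ^ m) *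
              (volume (plate r L (y + U (v₀ + s))) * plateMax r h L) := by
              gcongr
              exact setLIntegral_plate_le_mul_plateMax hr h L _
          _ = (2 ^ m * unitBallVolume m) *
              (volume (plate r L (y + U (v₀ + s))) * ENNReal.ofReal r ^ m) * plateMax r h L := by
              ring
          _ ≤ (2 ^ m * unitBallVolume m) * (C * ENNReal.ofReal r ^ n) * plateMax r h L := by
              exact mul_le_mul_left (mul_le_mul_right (h_volume r hr hr1 L _) _) _
          _ = _ := by ring
    _ = _ := by
        rw [Finset.sum_const, nsmul_eq_mul]
        ring

theorem exists_lintegral_uniformBall_le_plateMax (n m : ℕ) (R : ℝ) :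
    ∃ C : ℝ≥0∞, C ≠ ∞ ∧ ∀ r : ℝ, 0 < r → r < 1 → ∀ (L : Gr n m) (U : E m →ₗᵢ[ℝ] E n),
      LinearMap.range U.toLinearMap = L.1 → ∀ h : E n → ℝ≥0∞, Measurable h →
      (∀ x, R ≤ ‖x‖ → h x = 0) → ∀ y : E n,
      ∫⁻ v : E m, ∫⁻ z, h (y + U v + tail n z) ∂uniformBall (n + 1) r ≤ C * plateMax r h L := by
  obtain ⟨C, hC, h_tube⟩ := exists_lintegral_mul_volume_tube_le n m R
  have h_const : (unitBallVolume (n + 1))⁻¹ * 2 ≠ ∞ := by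
    finiteness [unitBallVolume_ne_zero (n + 1)]
  refine ⟨(unitBallVolume (n + 1))⁻¹ * 2 * C, by finiteness,
    fun r hr hr1 L U hU h hh h_supp y => ?_⟩
  refine (ENNReal.mul_le_mul_iff_right (ofReal_pow_ne_zero hr n) (ofReal_pow_ne_top r n)).1 ?_
  rw [← lintegral_const_mul' _ _ (ofReal_pow_ne_top r n)]
  calc ∫⁻ v : E m, ENNReal.ofReal r ^ n * ∫⁻ z, h (y + U v + tail n z) ∂uniformBall (n + 1) r
      ≤ ∫⁻ v : E m, (unitBallVolume (n + 1))⁻¹ * 2 * ∫⁻ w in Metric.ball 0 r, h (y + U v + w) :=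
        lintegral_mono fun v => lintegral_uniformBall_tail_le n hr (H := fun w => h (y + U v + w))
          (hh.comp (measurable_const_add _))
    _ = (unitBallVolume (n + 1))⁻¹ * 2 *
          ∫⁻ u : E n, h u * volume {v : E m | ‖u - y - U v‖ < r} := by
        rw [lintegral_const_mul' _ _ h_const, lintegral_lintegral_ball U y r hh]
    _ ≤ (unitBallVolume (n + 1))⁻¹ * 2 * (C * (ENNReal.ofReal r ^ n * plateMax r h L)) := by
        gcongr
        exact h_tube r hr hr1 L U hU h hh h_supp y
    _ = _ := by ring

/-- The isometry `(t, v) ↦ (t, U v)`. If `U` parametrizes `L`, it parametrizes `ℝ e₀ ⊕ L`. -/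
noncomputable def consIsometry (U : E m →ₗᵢ[ℝ] E n) : E (m + 1) →ₗᵢ[ℝ] E (n + 1) where
  toFun w := cons (w 0) (U (tail m w))
  map_add' x y := by
    simp only [map_add, ← cons_add]
    rfl
  map_smul' c x := by
    simp only [map_smul, RingHom.id_apply, ← cons_smul]
    rfl
  norm_map' w := by
    change ‖cons (w 0) (U (tail m w))‖ = ‖w‖
    rw [← sq_eq_sq₀ (norm_nonneg _) (norm_nonneg _), norm_cons_sq, U.norm_map, ← norm_cons_sq,
      cons_head_tail]

@[simp] theorem consIsometry_cons (U : E m →ₗᵢ[ℝ] E n) (t : ℝ) (v : E m) :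
    consIsometry U (cons t v) = cons t (U v) := by
  change cons _ _ = _
  simp

theorem range_consIsometry {L : Gr n m} {U : E m →ₗᵢ[ℝ] E n}
    (hU : LinearMap.range U.toLinearMap = L.1) :
    LinearMap.range (consIsometry U).toLinearMap = L.cons.1 := by
  ext x
  rw [Gr.mem_cons, ← hU]
  constructor
  · rintro ⟨w, rfl⟩
    exact ⟨tail m w, (tail_cons _ _).symm⟩
  · rintro ⟨v, hv : U v = tail n x⟩
    refine ⟨cons (x 0) v, ?_⟩
    change consIsometry U _ = _
    rw [consIsometry_cons, hv, cons_head_tail]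

theorem integral_plane_eq_integral_xray {Λ R : ℝ} {g : E (n + 1) → ℝ} (hg : BddSupported Λ R g)
    (θ : O (n + 1)) (U : E m →ₗᵢ[ℝ] E n) (s : ℝ) (y : E n) :
    ∫ w, g (θ.1 (cons s y) + rotateIsometry θ (consIsometry U) w) = ∫ v, xray θ g (y + U v) := by
  have h_int := hg.integrable_comp_isometry (rotateIsometry θ (consIsometry U)) (θ.1 (cons s y))
  rw [← measurePreserving_cons.map_eq] at h_int ⊢
  have h_int_prod : Integrable (fun q : ℝ × E m =>
      g (θ.1 (cons s y) + rotateIsometry θ (consIsometry U) (cons q.1 q.2)))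
      (volume.prod volume) :=
    (integrable_map_measure h_int.aestronglyMeasurable measurable_cons.aemeasurable).1 h_int
  rw [integral_map measurable_cons.aemeasurable h_int.aestronglyMeasurable,
    integral_prod_symm _ h_int_prod]
  refine integral_congr_ae (ae_of_all _ fun v => ?_)
  simp only [rotateIsometry_apply, consIsometry_cons, ← map_add, ← cons_add, xray]
  exact integral_add_left_eq_self (fun t => g (θ.1 (cons t (y + U v)))) s

theorem exists_enorm_integral_ballAvg_le_plateMax (n m : ℕ) {R : ℝ} (hR : 0 ≤ R) :
    ∃ C : ℝ≥0∞, C ≠ ∞ ∧ ∀ r : ℝ, 0 < r → r < 1 → ∀ (L : Gr n m) (U : E m →ₗᵢ[ℝ] E n),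
      LinearMap.range U.toLinearMap = L.1 → ∀ (Λ : ℝ) (g : E (n + 1) → ℝ), BddSupported Λ R g →
      ∀ (θ : O (n + 1)) (x : E (n + 1)),
      ‖∫ w, ballAvg r g (x + rotateIsometry θ (consIsometry U) w)‖ₑ ≤
        C * plateMax r (fun y => ‖xray θ g y‖ₑ) L := by
  obtain ⟨C, hC, h_plate⟩ := exists_lintegral_uniformBall_le_plateMax n m R
  refine ⟨C, hC, fun r hr hr1 L U hU Λ g hg θ x => ?_⟩
  have hx : x = θ.1 (cons (((star θ).1 x) 0) (tail n ((star θ).1 x))) := by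
    rw [cons_head_tail, unitary_apply_star_apply]
  have h_xray := hg.xray hR θ
  rw [hx, integral_plane_eq_integral_xray (hg.ballAvg hr)]
  refine (enorm_integral_le_lintegral_enorm _).trans
    ((lintegral_mono fun v => hg.enorm_xray_ballAvg_le r θ _).trans ?_)
  exact h_plate r hr hr1 L U hU (fun y => ‖xray θ g y‖ₑ) h_xray.meas.enorm
    (fun y hy => by rw [h_xray.supp y hy, enorm_zero]) _

end Domination

section Polar

variable {n : ℕ}

theorem lintegral_fun_norm_addHaar {F : Type*} [NormedAddCommGroup F] [NormedSpace ℝ F]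
    [FiniteDimensional ℝ F] [Nontrivial F] [MeasurableSpace F] [BorelSpace F] (μ : Measure F)
    [μ.IsAddHaarMeasure] {φ : ℝ → ℝ≥0∞} (hφ : Measurable φ) :
    ∫⁻ z, φ ‖z‖ ∂μ = Module.finrank ℝ F * μ (Metric.ball 0 1) *
      ∫⁻ s in Ioi (0 : ℝ), ENNReal.ofReal (s ^ (Module.finrank ℝ F - 1)) * φ s := by
  calc ∫⁻ z, φ ‖z‖ ∂μ
      = ∫⁻ z in ({0}ᶜ : Set F), φ ‖z‖ ∂μ := by rw [restrict_compl_singleton]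
    _ = ∫⁻ z : ({0}ᶜ : Set F), φ ‖(z : F)‖ ∂(μ.comap Subtype.val) :=
        (lintegral_subtype_comap (measurableSet_singleton 0).compl _).symm
    _ = ∫⁻ q : Metric.sphere (0 : F) 1 × Ioi (0 : ℝ), φ q.2
          ∂(μ.toSphere.prod (Measure.volumeIoiPow (Module.finrank ℝ F - 1))) := by
        simpa only [homeomorphUnitSphereProd_apply_snd_coe] using
          μ.measurePreserving_homeomorphUnitSphereProd.lintegral_comp_emb
            (Homeomorph.measurableEmbedding _) (fun q => φ q.2)
    _ = μ.toSphere univ *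
          ∫⁻ s : Ioi (0 : ℝ), φ s ∂(Measure.volumeIoiPow (Module.finrank ℝ F - 1)) := by
        simpa using lintegral_prod_mul (μ := μ.toSphere)
          (ν := Measure.volumeIoiPow (Module.finrank ℝ F - 1)) (f := fun _ => 1)
          (by fun_prop) (hφ.comp measurable_subtype_coe).aemeasurable
    _ = _ := by
        rw [Measure.toSphere_apply_univ, Measure.volumeIoiPow,
          lintegral_withDensity_eq_lintegral_mul _ (by fun_prop) (by fun_prop)]
        congr 1
        exact lintegral_subtype_comap measurableSet_Ioi
          (fun s => ENNReal.ofReal (s ^ (Module.finrank ℝ F - 1)) * φ s)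

theorem lintegral_norm (n : ℕ) {φ : ℝ → ℝ≥0∞} (hφ : Measurable φ) :
    ∫⁻ z : E (n + 1), φ ‖z‖ = (n + 1 : ℕ) * unitBallVolume (n + 1) *
      ∫⁻ s in Ioi (0 : ℝ), ENNReal.ofReal (s ^ n) * φ s := by
  rw [lintegral_fun_norm_addHaar volume hφ, finrank_euclideanSpace_fin, Nat.add_sub_cancel]
  rfl

theorem lintegral_eq_two_mul_lintegral_Ioi_of_even {φ : ℝ → ℝ≥0∞} (hφ : ∀ s, φ (-s) = φ s) :
    ∫⁻ s, φ s = 2 * ∫⁻ s in Ioi (0 : ℝ), φ s := by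
  have h_Iio : ∫⁻ s in Iio (0 : ℝ), φ s = ∫⁻ s in Ioi (0 : ℝ), φ s := by
    rw [← (Measure.measurePreserving_neg volume).setLIntegral_comp_preimage_emb
      (MeasurableEquiv.neg ℝ).measurableEmbedding]
    simp only [neg_preimage, neg_Iio, neg_zero, hφ]
  rw [← lintegral_add_compl _ (measurableSet_Ioi (a := (0 : ℝ))), compl_Ioi,
    setLIntegral_congr Iio_ae_eq_Iic.symm, h_Iio, two_mul]

/-- The density `‖z‖^(-n)` on `ℝ^(n+1)`. -/
noncomputable def riesz (n : ℕ) (z : E (n + 1)) : ℝ := (‖z‖ ^ n)⁻¹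

theorem riesz_nonneg (z : E (n + 1)) : 0 ≤ riesz n z := by
  unfold riesz
  positivity

@[fun_prop]
theorem measurable_riesz : Measurable (riesz n) := by
  unfold riesz
  fun_prop

theorem lintegral_orbit_eq (F : E (n + 1) → ℝ≥0∞) (z : E (n + 1)) :
    ∫⁻ θ, F (θ.1 z) ∂haarO (n + 1) = ∫⁻ θ, F (θ.1 (‖z‖ • e0 n)) ∂haarO (n + 1) := by
  obtain ⟨ρ, hρ⟩ := exists_unitary_apply_eq (x := z) (y := ‖z‖ • e0 n)
    (by rw [norm_smul, norm_e0, norm_norm, mul_one])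
  rw [← hρ, ← lintegral_mul_right_eq_self (fun θ : O (n + 1) => F (θ.1 z)) ρ]
  rfl

theorem lintegral_norm_mul {φ : ℝ → ℝ≥0∞} (hφ : Measurable φ) {F : E (n + 1) → ℝ≥0∞}
    (hF : Measurable F) :
    ∫⁻ z, φ ‖z‖ * F z =
      ∫⁻ z : E (n + 1), φ ‖z‖ * ∫⁻ θ, F (θ.1 (‖z‖ • e0 n)) ∂haarO (n + 1) := by
  have h_rotate (θ : O (n + 1)) : ∫⁻ z, φ ‖z‖ * F (θ.1 z) = ∫⁻ z, φ ‖z‖ * F z := by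
    rw [← (Unitary.linearIsometryEquiv θ).measurePreserving.lintegral_comp_emb
      (Unitary.linearIsometryEquiv θ).toHomeomorph.measurableEmbedding (fun z => φ ‖z‖ * F z)]
    simp only [LinearIsometryEquiv.norm_map]
    rfl
  calc ∫⁻ z, φ ‖z‖ * F z
      = ∫⁻ θ, (∫⁻ z, φ ‖z‖ * F (θ.1 z)) ∂haarO (n + 1) := by simp [h_rotate]
    _ = ∫⁻ z : E (n + 1), (∫⁻ θ, φ ‖z‖ * F (θ.1 z) ∂haarO (n + 1)) :=
        lintegral_lintegral_swap (by fun_prop)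
    _ = _ := by
        refine lintegral_congr fun z => ?_
        rw [lintegral_const_mul _ (by fun_prop), lintegral_orbit_eq]

theorem lintegral_riesz_mul {F : E (n + 1) → ℝ≥0∞} (hF : Measurable F) :
    2 * ∫⁻ z, ENNReal.ofReal (riesz n z) * F z = (n + 1 : ℕ) * unitBallVolume (n + 1) *
      ∫⁻ q : O (n + 1) × ℝ, F (q.2 • q.1.1 (e0 n)) ∂((haarO (n + 1)).prod volume) := by
  let Φ (s : ℝ) : ℝ≥0∞ := ∫⁻ θ, F (θ.1 (s • e0 n)) ∂haarO (n + 1)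
  have h_meas : Measurable fun q : O (n + 1) × ℝ => F (q.1.1 (q.2 • e0 n)) := by fun_prop
  have hΦ : Measurable Φ := h_meas.lintegral_prod_left'
  have hΦ_even (s : ℝ) : Φ (-s) = Φ s := by
    simp only [Φ]
    rw [lintegral_orbit_eq F (-s • e0 n), lintegral_orbit_eq F (s • e0 n), neg_smul, norm_neg]
  have h_cancel : ∫⁻ s in Ioi (0 : ℝ), ENNReal.ofReal (s ^ n) *
      (ENNReal.ofReal ((s ^ n)⁻¹) * Φ s) = ∫⁻ s in Ioi (0 : ℝ), Φ s := by
    refine setLIntegral_congr_fun measurableSet_Ioi fun s hs => ?_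
    have hs' : 0 < s ^ n := pow_pos hs n
    rw [← mul_assoc, ← ENNReal.ofReal_mul hs'.le, mul_inv_cancel₀ hs'.ne', ENNReal.ofReal_one,
      one_mul]
  calc 2 * ∫⁻ z, ENNReal.ofReal (riesz n z) * F z
      = 2 * ∫⁻ z : E (n + 1), ENNReal.ofReal ((‖z‖ ^ n)⁻¹) * Φ ‖z‖ := by
        rw [← lintegral_norm_mul (φ := fun s => ENNReal.ofReal ((s ^ n)⁻¹)) (by fun_prop) hF]
        rfl
    _ = 2 * ((n + 1 : ℕ) * unitBallVolume (n + 1) * ∫⁻ s in Ioi (0 : ℝ), Φ s) := by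
        rw [lintegral_norm n (φ := fun s => ENNReal.ofReal ((s ^ n)⁻¹) * Φ s) (by fun_prop),
          h_cancel]
    _ = (n + 1 : ℕ) * unitBallVolume (n + 1) * ∫⁻ s, Φ s := by
        rw [lintegral_eq_two_mul_lintegral_Ioi_of_even hΦ_even, mul_left_comm]
    _ = _ := by
        simp_rw [← map_smul]
        rw [lintegral_prod_symm _ h_meas.aemeasurable]

/-- The distribution of `s θ e₀` under Haar measure in `θ` and Lebesgue measure in `s`. -/
noncomputable def lineMeasure (n : ℕ) : Measure (E (n + 1)) :=
  ((haarO (n + 1)).prod volume).map fun q : O (n + 1) × ℝ => q.2 • q.1.1 (e0 n)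

theorem lineMeasure_ball (n : ℕ) (R : ℝ) :
    lineMeasure n (Metric.ball 0 R) = ENNReal.ofReal (2 * R) := by
  rw [lineMeasure, Measure.map_apply (by fun_prop) Metric.isOpen_ball.measurableSet]
  have h_preimage : (fun q : O (n + 1) × ℝ => q.2 • q.1.1 (e0 n)) ⁻¹' Metric.ball 0 R =
      univ ×ˢ Metric.ball (0 : ℝ) R := by
    ext q
    simp [norm_smul, Unitary.norm_map, norm_e0]
  rw [h_preimage, Measure.prod_prod, measure_univ, one_mul, Real.volume_ball]

/-- The constant of proportionality between `lineMeasure` and the Riesz kernel. -/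
noncomputable def rieszConst (n : ℕ) : ℝ := 2 / ((n + 1 : ℕ) * (unitBallVolume (n + 1)).toReal)

theorem toReal_unitBallVolume_pos (n : ℕ) : 0 < (unitBallVolume n).toReal :=
  ENNReal.toReal_pos (unitBallVolume_ne_zero n) (unitBallVolume_ne_top n)

theorem rieszConst_pos (n : ℕ) : 0 < rieszConst n := by
  have h_volume := toReal_unitBallVolume_pos (n + 1)
  unfold rieszConst
  positivity

theorem ofReal_rieszConst_mul (n : ℕ) :
    ENNReal.ofReal (rieszConst n) * ((n + 1 : ℕ) * unitBallVolume (n + 1)) = 2 := by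
  have h_volume := toReal_unitBallVolume_pos (n + 1)
  rw [← ENNReal.ofReal_toReal (unitBallVolume_ne_top (n + 1)), ← ENNReal.ofReal_natCast,
    ← ENNReal.ofReal_mul (by positivity), ← ENNReal.ofReal_mul (rieszConst_pos n).le, rieszConst,
    div_mul_cancel₀ _ (by positivity), ENNReal.ofReal_ofNat]

theorem lineMeasure_eq (n : ℕ) : lineMeasure n =
    volume.withDensity fun z => ENNReal.ofReal (rieszConst n * riesz n z) := by
  refine Measure.ext_of_lintegral _ fun F hF => ?_
  rw [lineMeasure, lintegral_map hF (by fun_prop),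
    lintegral_withDensity_eq_lintegral_mul _ (by fun_prop) hF]
  simp only [Pi.mul_apply, ENNReal.ofReal_mul (rieszConst_pos n).le, mul_assoc]
  rw [lintegral_const_mul _ (by fun_prop),
    ← ENNReal.mul_right_inj two_ne_zero ENNReal.ofNat_ne_top, mul_left_comm, lintegral_riesz_mul hF,
    ← mul_assoc, ofReal_rieszConst_mul]

end Polar

section RieszKernel

variable {n : ℕ}

theorem abs_pow_sub_one_sub_le (n : ℕ) {x : ℝ} (h0 : 0 ≤ x) (h2 : x ≤ 2) :
    |x ^ n - 1 - n * (x - 1)| ≤ n ^ 2 * 2 ^ n * (x - 1) ^ 2 := by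
  induction n with
  | zero => simp
  | succ n ih =>
    have h_pow : (1 : ℝ) ≤ 2 ^ n := one_le_pow₀ one_le_two
    calc |x ^ (n + 1) - 1 - (n + 1 : ℕ) * (x - 1)|
        = |x * (x ^ n - 1 - n * (x - 1)) + n * (x - 1) ^ 2| := by
          congr 1
          push_cast
          ring
      _ ≤ x * |x ^ n - 1 - n * (x - 1)| + n * (x - 1) ^ 2 := by
          refine (abs_add_le _ _).trans_eq ?_
          rw [abs_mul, abs_of_nonneg h0, abs_of_nonneg (a := (n : ℝ) * (x - 1) ^ 2) (by positivity)]
      _ ≤ 2 * (n ^ 2 * 2 ^ n * (x - 1) ^ 2) + n * 2 ^ n * (x - 1) ^ 2 := by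
          gcongr
          exact le_mul_of_one_le_right n.cast_nonneg h_pow
      _ ≤ 2 * (n ^ 2 * 2 ^ n * (x - 1) ^ 2) + n * 2 ^ n * (x - 1) ^ 2 +
            (3 * n + 2) * (2 ^ n * (x - 1) ^ 2) := le_add_of_nonneg_right (by positivity)
      _ = _ := by
          push_cast
          ring

theorem inv_le_and_inv_sub_one_sq_le {p τ : ℝ} (hτ : τ ≤ 1 / 4) (hp : |p - 1| ≤ τ) :
    0 < p ∧ p⁻¹ ≤ 4 / 3 ∧ (p⁻¹ - 1) ^ 2 ≤ 2 * τ ^ 2 := by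
  rw [abs_le] at hp
  have hp0 : 0 < p := by linarith
  have hp_inv : p⁻¹ ≤ 4 / 3 := by
    rw [inv_le_comm₀ hp0 (by norm_num)]
    linarith
  refine ⟨hp0, hp_inv, ?_⟩
  calc (p⁻¹ - 1) ^ 2 = (p - 1) ^ 2 * p⁻¹ ^ 2 := by
        field_simp
        ring
    _ ≤ τ ^ 2 * (4 / 3) ^ 2 := by
        gcongr ?_ * ?_ ^ 2
        exact sq_le_sq' hp.1 hp.2
    _ ≤ 2 * τ ^ 2 := by linarith [sq_nonneg τ]

theorem abs_inv_add_inv_sub_two_le {p q τ : ℝ} (hτ : τ ≤ 1 / 4) (hp : |p - 1| ≤ τ)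
    (hq : |q - 1| ≤ τ) (h : p ^ 2 + q ^ 2 = 2 + 2 * τ ^ 2) : |p⁻¹ + q⁻¹ - 2| ≤ 4 * τ ^ 2 := by
  have h_remainder {x : ℝ} (hx : |x - 1| ≤ τ) : x⁻¹ = 1 - (x - 1) + (x - 1) ^ 2 * x⁻¹ ∧
      0 ≤ (x - 1) ^ 2 * x⁻¹ ∧ (x - 1) ^ 2 * x⁻¹ ≤ τ ^ 2 * (4 / 3) := by
    obtain ⟨hx0, hx_inv, -⟩ := inv_le_and_inv_sub_one_sq_le hτ hx
    refine ⟨by field_simp; ring, by positivity, ?_⟩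
    gcongr ?_ * ?_
    exact sq_le_sq' (abs_le.1 hx).1 (abs_le.1 hx).2
  obtain ⟨hp_eq, hp_nonneg, hp_le⟩ := h_remainder hp
  obtain ⟨hq_eq, hq_nonneg, hq_le⟩ := h_remainder hq
  have hp_sq : (p - 1) ^ 2 ≤ τ ^ 2 := sq_le_sq' (abs_le.1 hp).1 (abs_le.1 hp).2
  have hq_sq : (q - 1) ^ 2 ≤ τ ^ 2 := sq_le_sq' (abs_le.1 hq).1 (abs_le.1 hq).2
  have h_sum : 2 * ((p - 1) + (q - 1)) = 2 * τ ^ 2 - (p - 1) ^ 2 - (q - 1) ^ 2 := by linarith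
  rw [abs_le]
  constructor <;> linarith [h_sum, sq_nonneg (p - 1), sq_nonneg (q - 1)]

theorem abs_inv_pow_add_inv_pow_sub_two_le (n : ℕ) {p q τ : ℝ} (hτ : τ ≤ 1 / 4)
    (hp : |p - 1| ≤ τ) (hq : |q - 1| ≤ τ) (h : p ^ 2 + q ^ 2 = 2 + 2 * τ ^ 2) :
    |p⁻¹ ^ n + q⁻¹ ^ n - 2| ≤ (4 * n + 4 * n ^ 2 * 2 ^ n) * τ ^ 2 := by
  have h_linearize {x : ℝ} (hx : |x - 1| ≤ τ) :
      |x⁻¹ ^ n - 1 - n * (x⁻¹ - 1)| ≤ n ^ 2 * 2 ^ n * (2 * τ ^ 2) := by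
    obtain ⟨hx0, hx_inv, hx_sq⟩ := inv_le_and_inv_sub_one_sq_le hτ hx
    refine (abs_pow_sub_one_sub_le n (inv_pos.2 hx0).le (by linarith)).trans ?_
    gcongr
  have h_linear : |(n : ℝ) * (p⁻¹ + q⁻¹ - 2)| ≤ n * (4 * τ ^ 2) := by
    rw [abs_mul, Nat.abs_cast]
    gcongr
    exact abs_inv_add_inv_sub_two_le hτ hp hq h
  have hp_pow := h_linearize hp
  have hq_pow := h_linearize hq
  rw [abs_le] at h_linear hp_pow hq_pow ⊢
  constructor <;> linarith

theorem abs_riesz_second_difference_le {u w : E (n + 1)} (hu : u ≠ 0) (hw : 4 * ‖w‖ ≤ ‖u‖) :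
    |riesz n (u - w) + riesz n (u + w) - 2 * riesz n u| ≤
      (4 * n + 4 * n ^ 2 * 2 ^ n) * ‖w‖ ^ 2 * (‖u‖ ^ (n + 2))⁻¹ := by
  have hu' : 0 < ‖u‖ := norm_pos_iff.2 hu
  have h_ratio {v : E (n + 1)} (hv : ‖v - u‖ = ‖w‖) : |‖v‖ / ‖u‖ - 1| ≤ ‖w‖ / ‖u‖ := by
    rw [div_sub_one hu'.ne', abs_div, abs_of_pos hu', ← hv]
    gcongr
    exact abs_norm_sub_norm_le v u
  have h_parallelogram :
      (‖u - w‖ / ‖u‖) ^ 2 + (‖u + w‖ / ‖u‖) ^ 2 = 2 + 2 * (‖w‖ / ‖u‖) ^ 2 := by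
    field_simp
    linarith [parallelogram_law_with_norm ℝ u w]
  have h_riesz (v : E (n + 1)) : riesz n v = (‖v‖ / ‖u‖)⁻¹ ^ n * (‖u‖ ^ n)⁻¹ := by
    rw [riesz, inv_div, div_pow, div_mul_eq_mul_div, mul_inv_cancel₀ (by positivity), one_div]
  calc |riesz n (u - w) + riesz n (u + w) - 2 * riesz n u|
      = |(‖u - w‖ / ‖u‖)⁻¹ ^ n + (‖u + w‖ / ‖u‖)⁻¹ ^ n - 2| * (‖u‖ ^ n)⁻¹ := by
        rw [h_riesz (u - w), h_riesz (u + w), riesz, ← add_mul, ← sub_mul, abs_mul,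
          abs_of_pos (a := (‖u‖ ^ n)⁻¹) (by positivity)]
    _ ≤ (4 * n + 4 * n ^ 2 * 2 ^ n) * (‖w‖ / ‖u‖) ^ 2 * (‖u‖ ^ n)⁻¹ := by
        gcongr
        refine abs_inv_pow_add_inv_pow_sub_two_le n ?_ (h_ratio ?_) (h_ratio ?_) h_parallelogram
        · rw [div_le_iff₀ hu']
          linarith
        · rw [sub_sub_cancel_left, norm_neg]
        · rw [add_sub_cancel_left]
    _ = _ := by
        field_simp
        ring

end RieszKernel

section RieszAverage

variable {n : ℕ}

/-- The average of the Riesz kernel over the ball of radius `r` about `u`. -/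
noncomputable def rieszAvg (n : ℕ) (r : ℝ) (u : E (n + 1)) : ℝ :=
  ∫ w, riesz n (u - w) ∂uniformBall (n + 1) r

theorem measurable_rieszAvg (n : ℕ) (r : ℝ) : Measurable (rieszAvg n r) := by
  have h_meas : Measurable fun q : E (n + 1) × E (n + 1) => riesz n (q.1 - q.2) := by fun_prop
  exact h_meas.stronglyMeasurable.integral_prod_right'.measurable

theorem setLIntegral_riesz_ball (n : ℕ) (R : ℝ) :
    ∫⁻ z in Metric.ball (0 : E (n + 1)) R, ENNReal.ofReal (riesz n z) =
      (ENNReal.ofReal (rieszConst n))⁻¹ * ENNReal.ofReal (2 * R) := by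
  rw [← lineMeasure_ball n, lineMeasure_eq, withDensity_apply _ Metric.isOpen_ball.measurableSet]
  simp_rw [ENNReal.ofReal_mul (rieszConst_pos n).le]
  rw [lintegral_const_mul _ (by fun_prop), ← mul_assoc, ENNReal.inv_mul_cancel, one_mul]
  · simpa using rieszConst_pos n
  · exact ENNReal.ofReal_ne_top

theorem setLIntegral_ball_riesz_sub_le {w : E (n + 1)} {s : ℝ} (hw : ‖w‖ < s) (R : ℝ) :
    ∫⁻ u in Metric.ball (0 : E (n + 1)) R, ENNReal.ofReal (riesz n (u - w)) ≤
      (ENNReal.ofReal (rieszConst n))⁻¹ * ENNReal.ofReal (2 * (R + s)) := by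
  rw [← setLIntegral_riesz_ball, ← lintegral_indicator Metric.isOpen_ball.measurableSet,
    ← lintegral_indicator Metric.isOpen_ball.measurableSet,
    ← lintegral_sub_right_eq_self ((Metric.ball (0 : E (n + 1)) (R + s)).indicator _) w]
  refine lintegral_mono fun u => ?_
  by_cases hu : u ∈ Metric.ball (0 : E (n + 1)) R
  · have huw : u - w ∈ Metric.ball (0 : E (n + 1)) (R + s) := by
      rw [mem_ball_zero_iff] at hu ⊢
      exact (norm_sub_le _ _).trans_lt (add_lt_add hu hw)
    rw [indicator_of_mem hu, indicator_of_mem huw]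
  · rw [indicator_of_notMem hu]
    exact zero_le

theorem setLIntegral_ball_rieszAvg_le (n : ℕ) (s R : ℝ) :
    ∫⁻ u in Metric.ball (0 : E (n + 1)) R, ‖rieszAvg n s u‖ₑ ≤
      (ENNReal.ofReal (rieszConst n))⁻¹ * ENNReal.ofReal (2 * (R + s)) := by
  calc ∫⁻ u in Metric.ball (0 : E (n + 1)) R, ‖rieszAvg n s u‖ₑ
      ≤ ∫⁻ u in Metric.ball (0 : E (n + 1)) R, ∫⁻ w, ENNReal.ofReal (riesz n (u - w))
          ∂uniformBall (n + 1) s := by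
        refine lintegral_mono fun u => (enorm_integral_le_lintegral_enorm _).trans_eq ?_
        simp_rw [Real.enorm_eq_ofReal (riesz_nonneg _)]
    _ = ∫⁻ w, (∫⁻ u in Metric.ball (0 : E (n + 1)) R, ENNReal.ofReal (riesz n (u - w)))
          ∂uniformBall (n + 1) s := lintegral_lintegral_swap (by fun_prop)
    _ ≤ ∫⁻ _, (ENNReal.ofReal (rieszConst n))⁻¹ * ENNReal.ofReal (2 * (R + s))
          ∂uniformBall (n + 1) s := by
        refine lintegral_mono_ae ?_
        filter_upwards [ae_uniformBall_norm_lt (n + 1) s] with w hw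
        exact setLIntegral_ball_riesz_sub_le hw R
    _ ≤ _ := by
        rw [lintegral_const]
        exact mul_le_of_le_one_right' prob_le_one

theorem integrable_riesz_sub {s : ℝ} {u : E (n + 1)} (hu0 : u ≠ 0) (hu : 4 * s ≤ ‖u‖) :
    Integrable (fun w => riesz n (u - w)) (uniformBall (n + 1) s) := by
  have hu_pow : 0 < (3 / 4 * ‖u‖) ^ n := pow_pos (by linarith [norm_pos_iff.2 hu0]) n
  refine Integrable.of_bound (measurable_riesz.comp (by fun_prop)).aestronglyMeasurable
    (((3 / 4 * ‖u‖) ^ n)⁻¹) ?_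
  filter_upwards [ae_uniformBall_norm_lt (n + 1) s] with w hw
  rw [Real.norm_of_nonneg (riesz_nonneg _), riesz]
  refine inv_anti₀ hu_pow ?_
  gcongr
  linarith [norm_sub_norm_le u w]

theorem rieszAvg_sub_riesz_eq {s : ℝ} (hs : 0 < s) {u : E (n + 1)} (hu : 4 * s ≤ ‖u‖) :
    rieszAvg n s u - riesz n u = 2⁻¹ * ∫ w, (riesz n (u - w) + riesz n (u + w) - 2 * riesz n u)
      ∂uniformBall (n + 1) s := by
  have h_prob := isProbabilityMeasure_uniformBall (n + 1) hs
  have h_neg := measurePreserving_uniformBall (LinearIsometryEquiv.neg ℝ (E := E (n + 1))) s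
  have h_emb := (LinearIsometryEquiv.neg ℝ (E := E (n + 1))).toHomeomorph.measurableEmbedding
  have h_sub : Integrable (fun w => riesz n (u - w)) (uniformBall (n + 1) s) :=
    integrable_riesz_sub (norm_pos_iff.1 (by linarith)) hu
  have h_add : Integrable (fun w => riesz n (u + w)) (uniformBall (n + 1) s) := by
    simpa [Function.comp_def] using (h_neg.integrable_comp_emb h_emb).2 h_sub
  have h_avg : rieszAvg n s u = ∫ w, riesz n (u + w) ∂uniformBall (n + 1) s := by
    rw [rieszAvg, ← h_neg.integral_comp h_emb]
    simp
  rw [integral_sub (f := fun w => riesz n (u - w) + riesz n (u + w)) (h_sub.add h_add)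
      (integrable_const _), integral_add h_sub h_add, ← h_avg,
    ← rieszAvg, integral_const, probReal_univ, one_smul]
  ring

theorem abs_rieszAvg_sub_le {s : ℝ} (hs : 0 < s) {u : E (n + 1)} (hu : 4 * s ≤ ‖u‖) :
    |rieszAvg n s u - riesz n u| ≤
      (4 * n + 4 * n ^ 2 * 2 ^ n) * s ^ 2 * (‖u‖ ^ (n + 2))⁻¹ := by
  have h_prob := isProbabilityMeasure_uniformBall (n + 1) hs
  have h_integral : |∫ w, (riesz n (u - w) + riesz n (u + w) - 2 * riesz n u)
      ∂uniformBall (n + 1) s| ≤ (4 * n + 4 * n ^ 2 * 2 ^ n) * s ^ 2 * (‖u‖ ^ (n + 2))⁻¹ := by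
    rw [← Real.norm_eq_abs]
    refine (norm_integral_le_of_norm_le_const (C := (4 * n + 4 * n ^ 2 * 2 ^ n) * s ^ 2 *
      (‖u‖ ^ (n + 2))⁻¹) ?_).trans_eq (by rw [probReal_univ, mul_one])
    filter_upwards [ae_uniformBall_norm_lt (n + 1) s] with w hw
    refine (abs_riesz_second_difference_le (norm_pos_iff.1 (by linarith)) (by linarith)).trans ?_
    gcongr
  rw [rieszAvg_sub_riesz_eq hs hu, abs_mul, abs_of_pos (a := (2⁻¹ : ℝ)) (by norm_num)]
  linarith [abs_nonneg (∫ w, (riesz n (u - w) + riesz n (u + w) - 2 * riesz n u)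
    ∂uniformBall (n + 1) s)]

theorem lintegral_Ioi_inv_sq {c : ℝ} (hc : 0 < c) :
    ∫⁻ s in Ioi c, ENNReal.ofReal ((s ^ 2)⁻¹) = ENNReal.ofReal c⁻¹ := by
  have h_rpow (s : ℝ) (hs : s ∈ Ioi c) : s ^ (-2 : ℝ) = (s ^ 2)⁻¹ := by
    rw [Real.rpow_neg (hc.trans hs).le, Real.rpow_ofNat]
  have h_int : IntegrableOn (fun s : ℝ => (s ^ 2)⁻¹) (Ioi c) :=
    (integrableOn_Ioi_rpow_of_lt (by norm_num) hc).congr_fun h_rpow measurableSet_Ioi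
  rw [← ofReal_integral_eq_lintegral_ofReal h_int (ae_of_all _ fun s => by positivity),
    ← setIntegral_congr_fun measurableSet_Ioi h_rpow, integral_Ioi_rpow_of_lt (by norm_num) hc]
  norm_num [Real.rpow_neg_one]

theorem setLIntegral_lt_norm_inv_pow (n : ℕ) {c : ℝ} (hc : 0 < c) :
    ∫⁻ u in {u : E (n + 1) | c < ‖u‖}, ENNReal.ofReal ((‖u‖ ^ (n + 2))⁻¹) =
      (n + 1 : ℕ) * unitBallVolume (n + 1) * ENNReal.ofReal c⁻¹ := by
  let φ : ℝ → ℝ≥0∞ := (Ioi c).indicator fun s => ENNReal.ofReal ((s ^ (n + 2))⁻¹)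
  have hφ : Measurable φ := Measurable.indicator (by fun_prop) measurableSet_Ioi
  have h_weight (s : ℝ) : ENNReal.ofReal (s ^ n) * φ s =
      (Ioi c).indicator (fun s => ENNReal.ofReal ((s ^ 2)⁻¹)) s := by
    by_cases hs : s ∈ Ioi c
    · have hs0 : 0 < s := hc.trans hs
      simp only [φ, indicator_of_mem hs]
      rw [← ENNReal.ofReal_mul (by positivity)]
      congr 1
      field_simp
      ring
    · simp only [φ, indicator_of_notMem hs, mul_zero]
  calc ∫⁻ u in {u : E (n + 1) | c < ‖u‖}, ENNReal.ofReal ((‖u‖ ^ (n + 2))⁻¹)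
      = ∫⁻ u : E (n + 1), φ ‖u‖ := by
        rw [← lintegral_indicator (measurableSet_lt measurable_const measurable_norm)]
        rfl
    _ = (n + 1 : ℕ) * unitBallVolume (n + 1) * ∫⁻ s in Ioi c, ENNReal.ofReal ((s ^ 2)⁻¹) := by
        rw [lintegral_norm n hφ]
        simp_rw [h_weight]
        rw [setLIntegral_indicator measurableSet_Ioi,
          inter_eq_self_of_subset_left (Ioi_subset_Ioi hc.le)]
    _ = _ := by rw [lintegral_Ioi_inv_sq hc]

theorem setLIntegral_ball_rieszAvg_sub_le (n : ℕ) {r : ℝ} (hr : 0 < r) :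
    ∫⁻ u in Metric.ball (0 : E (n + 1)) (9 * r), ‖rieszAvg n r u - rieszAvg n (2 * r) u‖ₑ ≤
      (ENNReal.ofReal (rieszConst n))⁻¹ * 42 * ENNReal.ofReal r := by
  calc _ ≤ ∫⁻ u in Metric.ball (0 : E (n + 1)) (9 * r),
        (‖rieszAvg n r u‖ₑ + ‖rieszAvg n (2 * r) u‖ₑ) := lintegral_mono fun u => enorm_sub_le
    _ = _ := lintegral_add_left (measurable_rieszAvg n r).enorm _
    _ ≤ _ := add_le_add (setLIntegral_ball_rieszAvg_le n _ _) (setLIntegral_ball_rieszAvg_le n _ _)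
    _ = (ENNReal.ofReal (rieszConst n))⁻¹ * ENNReal.ofReal (42 * r) := by
        rw [← mul_add, ← ENNReal.ofReal_add (by positivity) (by positivity)]
        congr 2
        ring
    _ = _ := by rw [ENNReal.ofReal_mul (by norm_num), ENNReal.ofReal_ofNat, mul_assoc]

theorem abs_rieszAvg_sub_rieszAvg_two_mul_le {r : ℝ} (hr : 0 < r) {u : E (n + 1)}
    (hu : 8 * r ≤ ‖u‖) :
    |rieszAvg n r u - rieszAvg n (2 * r) u| ≤
      5 * (4 * n + 4 * n ^ 2 * 2 ^ n) * r ^ 2 * (‖u‖ ^ (n + 2))⁻¹ := by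
  have h_r := abs_rieszAvg_sub_le hr (u := u) (by linarith)
  have h_2r := abs_rieszAvg_sub_le (mul_pos two_pos hr) (u := u) (by linarith)
  calc |rieszAvg n r u - rieszAvg n (2 * r) u|
      = |(rieszAvg n r u - riesz n u) - (rieszAvg n (2 * r) u - riesz n u)| := by
        rw [sub_sub_sub_cancel_right]
    _ ≤ _ := abs_sub _ _
    _ ≤ _ := add_le_add h_r h_2r
    _ = _ := by ring

theorem setLIntegral_lt_norm_rieszAvg_sub_le (n : ℕ) {r : ℝ} (hr : 0 < r) :
    ∫⁻ u in {u : E (n + 1) | 8 * r < ‖u‖}, ‖rieszAvg n r u - rieszAvg n (2 * r) u‖ₑ ≤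
      (n + 1 : ℕ) * unitBallVolume (n + 1) * ENNReal.ofReal (4 * n + 4 * n ^ 2 * 2 ^ n) *
        ENNReal.ofReal r := by
  set A : ℝ := 4 * n + 4 * n ^ 2 * 2 ^ n
  have hA0 : 0 ≤ A := by positivity
  calc _ ≤ ∫⁻ u in {u : E (n + 1) | 8 * r < ‖u‖},
        ENNReal.ofReal (5 * A * r ^ 2) * ENNReal.ofReal ((‖u‖ ^ (n + 2))⁻¹) := by
        refine setLIntegral_mono' (measurableSet_lt measurable_const measurable_norm) fun u hu => ?_
        rw [Real.enorm_eq_ofReal_abs, ← ENNReal.ofReal_mul (by positivity)]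
        exact ENNReal.ofReal_le_ofReal (abs_rieszAvg_sub_rieszAvg_two_mul_le hr (le_of_lt hu))
    _ = (n + 1 : ℕ) * unitBallVolume (n + 1) * ENNReal.ofReal (5 * A * r ^ 2 * (8 * r)⁻¹) := by
        rw [lintegral_const_mul' _ _ ENNReal.ofReal_ne_top,
          setLIntegral_lt_norm_inv_pow n (by positivity), mul_left_comm,
          ← ENNReal.ofReal_mul (by positivity)]
    _ ≤ _ := by
        rw [mul_assoc (((n + 1 : ℕ) : ℝ≥0∞) * unitBallVolume (n + 1)), ← ENNReal.ofReal_mul hA0]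
        refine mul_le_mul_right (ENNReal.ofReal_le_ofReal ?_) _
        calc 5 * A * r ^ 2 * (8 * r)⁻¹ = 5 / 8 * (A * r) := by field_simp
          _ ≤ A * r := mul_le_of_le_one_left (mul_nonneg hA0 hr.le) (by norm_num)

theorem exists_lintegral_rieszAvg_sub_le (n : ℕ) : ∃ C : ℝ≥0∞, C ≠ ∞ ∧ ∀ r : ℝ, 0 < r →
    ∫⁻ u, ‖rieszAvg n r u - rieszAvg n (2 * r) u‖ₑ ≤ C * ENNReal.ofReal r := by
  have h_const : ENNReal.ofReal (rieszConst n) ≠ 0 := by simpa using rieszConst_pos n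
  refine ⟨(n + 1 : ℕ) * unitBallVolume (n + 1) * ENNReal.ofReal (4 * n + 4 * n ^ 2 * 2 ^ n) +
    (ENNReal.ofReal (rieszConst n))⁻¹ * 42, by finiteness [unitBallVolume_ne_top (n + 1)],
    fun r hr => ?_⟩
  have h_compl : {u : E (n + 1) | 8 * r < ‖u‖}ᶜ ⊆ Metric.ball 0 (9 * r) := by
    intro u hu
    have hu_le : ‖u‖ ≤ 8 * r := not_lt.1 hu
    rw [mem_ball_zero_iff]
    linarith
  rw [← lintegral_add_compl _ (measurableSet_lt measurable_const measurable_norm), add_mul]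
  exact add_le_add (setLIntegral_lt_norm_rieszAvg_sub_le n hr)
    ((lintegral_mono_set h_compl).trans (setLIntegral_ball_rieszAvg_sub_le n hr))

end RieszAverage

section XraySquare

variable {n : ℕ} {Λ R : ℝ} {f g : E (n + 1) → ℝ}

theorem integral_add_smul_eq_xray (g : E (n + 1) → ℝ) (θ : O (n + 1)) (t : ℝ) (y : E n) :
    ∫ s : ℝ, g (θ.1 (cons t y) + s • θ.1 (e0 n)) = xray θ g y := by
  rw [xray, ← integral_add_left_eq_self (fun s => g (θ.1 (cons s y))) t]
  simp_rw [← map_smul, ← map_add, ← cons_zero_right, ← cons_add, add_zero]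

namespace BddSupported

theorem integrable_mul_xray (hg : BddSupported Λ R g) (hR : 0 ≤ R) (θ : O (n + 1)) :
    Integrable (fun q : ℝ × E n => g (θ.1 (cons q.1 q.2)) * KPlane.xray θ g q.2)
      (volume.prod volume) := by
  have h_xray := hg.xray hR θ
  refine integrable_of_bounded_of_ae_notMem_eq_zero (S := Metric.ball 0 R ×ˢ Metric.ball 0 R)
    (Λ := Λ * (Λ * (2 * R)))
    ((hg.meas.comp (by fun_prop)).mul (h_xray.meas.comp measurable_snd)) (fun q => ?_) ?_
    (ae_of_all _ fun ⟨t, y⟩ hq => ?_)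
  · rw [abs_mul]
    exact mul_le_mul (hg.bound _) (h_xray.bound _) (abs_nonneg _) hg.nonneg
  · rw [Measure.prod_prod]
    exact ENNReal.mul_ne_top measure_ball_lt_top.ne measure_ball_lt_top.ne
  · rcases not_and_or.1 hq with ht | hy
    · rw [hg.apply_line_eq_zero θ y ht, zero_mul]
    · rw [h_xray.supp y (by simpa using hy), mul_zero]

theorem integral_xray_sq (hg : BddSupported Λ R g) (hR : 0 ≤ R) (θ : O (n + 1)) :
    ∫ y, KPlane.xray θ g y ^ 2 = ∫ x, g x * ∫ s : ℝ, g (x + s • θ.1 (e0 n)) := by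
  have h_shift : Measurable fun q : E (n + 1) × ℝ => g (q.1 + q.2 • θ.1 (e0 n)) :=
    hg.meas.comp (by fun_prop)
  have h_meas : Measurable fun x => g (θ.1 x) * ∫ s : ℝ, g (θ.1 x + s • θ.1 (e0 n)) :=
    (hg.meas.mul h_shift.stronglyMeasurable.integral_prod_right'.measurable).comp
      θ.1.continuous.measurable
  symm
  calc ∫ x, g x * ∫ s : ℝ, g (x + s • θ.1 (e0 n))
      = ∫ x, g (θ.1 x) * ∫ s : ℝ, g (θ.1 x + s • θ.1 (e0 n)) :=
        ((Unitary.linearIsometryEquiv θ).measurePreserving.integral_comp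
          (Unitary.linearIsometryEquiv θ).toHomeomorph.measurableEmbedding _).symm
    _ = ∫ q : ℝ × E n, g (θ.1 (cons q.1 q.2)) * KPlane.xray θ g q.2 := by
        rw [← measurePreserving_cons.map_eq,
          integral_map measurable_cons.aemeasurable h_meas.aestronglyMeasurable]
        simp_rw [integral_add_smul_eq_xray]
        rfl
    _ = ∫ y, KPlane.xray θ g y ^ 2 := by
        rw [Measure.volume_eq_prod, integral_prod_symm _ (hg.integrable_mul_xray hR θ)]
        simp_rw [integral_mul_const, sq]
        rfl

theorem integrable_mul_add (hg : BddSupported Λ R g) {Y : Type*} [MeasurableSpace Y]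
    {ν : Measure Y} [SFinite ν] {σ : Y → E (n + 1)} (hσ : Measurable σ)
    (hν : ν {y | ‖σ y‖ < 2 * R} ≠ ∞) :
    Integrable (fun q : Y × E (n + 1) => g q.2 * g (q.2 + σ q.1)) (ν.prod volume) := by
  refine integrable_of_bounded_of_ae_notMem_eq_zero
    (S := {y | ‖σ y‖ < 2 * R} ×ˢ Metric.ball 0 R) (Λ := Λ * Λ)
    ((hg.meas.comp measurable_snd).mul (hg.meas.comp (by fun_prop))) (fun q => ?_) ?_
    (ae_of_all _ fun ⟨y, x⟩ hq => ?_)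
  · rw [abs_mul]
    exact mul_le_mul (hg.bound _) (hg.bound _) (abs_nonneg _) hg.nonneg
  · rw [Measure.prod_prod]
    exact ENNReal.mul_ne_top hν measure_ball_lt_top.ne
  · by_cases hx : ‖x‖ < R
    · have hy : 2 * R ≤ ‖σ y‖ := not_lt.1 fun hy => hq ⟨hy, by simpa using hx⟩
      have h_triangle := norm_le_add_norm_add (σ y) x
      rw [add_comm (σ y)] at h_triangle
      rw [hg.supp (x + σ y) (by linarith), mul_zero]
    · rw [hg.supp x (not_lt.1 hx), zero_mul]

theorem integrable_mul_add_smul (hg : BddSupported Λ R g) :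
    Integrable (fun q : (O (n + 1) × ℝ) × E (n + 1) => g q.2 * g (q.2 + q.1.2 • q.1.1.1 (e0 n)))
      (((haarO (n + 1)).prod volume).prod volume) := by
  refine hg.integrable_mul_add (σ := fun q : O (n + 1) × ℝ => q.2 • q.1.1 (e0 n))
    (by fun_prop) ?_
  have h_ball := lineMeasure_ball n (2 * R)
  rw [lineMeasure, Measure.map_apply (by fun_prop) Metric.isOpen_ball.measurableSet] at h_ball
  simp only [preimage, mem_ball_zero_iff] at h_ball
  rw [h_ball]
  exact ENNReal.ofReal_ne_top

theorem integral_integral_mul_add_smul (hg : BddSupported Λ R g) (hR : 0 ≤ R) (θ : O (n + 1)) :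
    ∫ s : ℝ, ∫ x, g x * g (x + s • θ.1 (e0 n)) = ∫ y, KPlane.xray θ g y ^ 2 := by
  rw [hg.integral_xray_sq hR, integral_integral_swap]
  · simp_rw [integral_const_mul]
  · refine hg.integrable_mul_add (σ := fun s : ℝ => s • θ.1 (e0 n)) (by fun_prop) ?_
    simp only [norm_smul, Unitary.norm_map, norm_e0, mul_one, ← mem_ball_zero_iff, ofPred_mem_eq]
    exact measure_ball_lt_top.ne

theorem integrable_integral_xray_sq (hg : BddSupported Λ R g) (hR : 0 ≤ R) :
    Integrable (fun θ => ∫ y, KPlane.xray θ g y ^ 2) (haarO (n + 1)) :=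
  hg.integrable_mul_add_smul.integral_prod_left.integral_prod_left.congr
    (ae_of_all _ (hg.integral_integral_mul_add_smul hR))

theorem integral_integral_xray_sq (hg : BddSupported Λ R g) (hR : 0 ≤ R) :
    ∫ θ, (∫ y, KPlane.xray θ g y ^ 2) ∂haarO (n + 1) =
      ∫ x, g x * ∫ z, g (x + z) ∂lineMeasure n := by
  have h_swap := hg.integrable_mul_add_smul
  simp_rw [← hg.integral_integral_mul_add_smul hR]
  rw [← integral_prod _ h_swap.integral_prod_left, integral_integral_swap h_swap]
  refine integral_congr_ae (ae_of_all _ fun x => ?_)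
  simp only
  rw [integral_const_mul, lineMeasure, integral_map (by fun_prop)]
  exact (hg.meas.comp (measurable_const_add x)).aestronglyMeasurable

theorem lintegral_enorm_xray_sq (hg : BddSupported Λ R g) (hR : 0 ≤ R) (θ : O (n + 1)) :
    ∫⁻ y, ‖KPlane.xray θ g y‖ₑ ^ 2 = ENNReal.ofReal (∫ y, KPlane.xray θ g y ^ 2) := by
  have h_xray := hg.xray hR θ
  have h_sq : Integrable fun y => KPlane.xray θ g y ^ 2 := by
    refine integrable_of_bounded_of_ae_notMem_eq_zero (S := Metric.ball 0 R)
      (Λ := (Λ * (2 * R)) ^ 2) (h_xray.meas.pow_const 2) (fun y => ?_) measure_ball_lt_top.ne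
      (ae_of_all _ fun y hy => ?_)
    · rw [abs_pow]
      exact pow_le_pow_left₀ (abs_nonneg _) (h_xray.bound y) 2
    · rw [h_xray.supp y (by simpa using hy), zero_pow two_ne_zero]
  rw [ofReal_integral_eq_lintegral_ofReal h_sq (ae_of_all _ fun y => sq_nonneg _)]
  simp_rw [← enorm_pow, Real.enorm_eq_ofReal (sq_nonneg _)]

theorem lintegral_xray_sq_le (hg : BddSupported Λ R g) (hR : 0 ≤ R) :
    ∫⁻ θ, (∫⁻ y, ‖KPlane.xray θ g y‖ₑ ^ 2) ∂haarO (n + 1) ≤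
      ∫⁻ x, ‖g x‖ₑ * ‖∫ z, g (x + z) ∂lineMeasure n‖ₑ := by
  simp_rw [hg.lintegral_enorm_xray_sq hR, ← enorm_mul]
  rw [← ofReal_integral_eq_lintegral_ofReal (hg.integrable_integral_xray_sq hR)
    (ae_of_all _ fun θ => integral_nonneg fun y => sq_nonneg _), hg.integral_integral_xray_sq hR]
  exact (Real.ofReal_le_enorm _).trans (enorm_integral_le_lintegral_enorm _)

end BddSupported

theorem integrableOn_riesz_ball (n : ℕ) (R : ℝ) :
    IntegrableOn (riesz n) (Metric.ball 0 R) := by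
  refine ⟨measurable_riesz.aestronglyMeasurable, ?_⟩
  rw [HasFiniteIntegral]
  simp_rw [Real.enorm_eq_ofReal (riesz_nonneg _)]
  rw [setLIntegral_riesz_ball]
  exact ENNReal.mul_lt_top (ENNReal.inv_lt_top.2 (by simpa using rieszConst_pos n))
    ENNReal.ofReal_lt_top

namespace BddSupported

theorem integrable_mul_riesz (hf : BddSupported Λ R f) (r : ℝ) (x : E (n + 1)) :
    Integrable (fun q : E (n + 1) × E (n + 1) => f (x + q.2 + q.1) * riesz n q.2)
      ((uniformBall (n + 1) r).prod volume) := by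
  have h_dom : Integrable (fun q : E (n + 1) × E (n + 1) =>
      Λ * (Metric.ball (0 : E (n + 1)) (R + ‖x‖ + r)).indicator (riesz n) q.2)
      ((uniformBall (n + 1) r).prod volume) :=
    Integrable.mul_prod (f := fun _ => Λ) (integrable_const Λ)
      ((integrableOn_riesz_ball n _).integrable_indicator Metric.isOpen_ball.measurableSet)
  refine h_dom.mono' ((hf.meas.comp (by fun_prop)).mul (by fun_prop)).aestronglyMeasurable ?_
  filter_upwards [Measure.quasiMeasurePreserving_fst.ae (ae_uniformBall_norm_lt (n + 1) r)]
    with ⟨w, z⟩ hw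
  by_cases hz : z ∈ Metric.ball (0 : E (n + 1)) (R + ‖x‖ + r)
  · rw [indicator_of_mem hz, norm_mul, Real.norm_of_nonneg (riesz_nonneg _)]
    exact mul_le_mul_of_nonneg_right (hf.bound _) (riesz_nonneg _)
  · rw [indicator_of_notMem hz, hf.supp, zero_mul, norm_zero, mul_zero]
    have h_triangle : ‖z‖ ≤ ‖x + z + w‖ + (‖x‖ + ‖w‖) := by
      have h_add := norm_le_add_norm_add z (x + w)
      rw [add_left_comm, ← add_assoc] at h_add
      linarith [norm_add_le x w]
    have hz_le : R + ‖x‖ + r ≤ ‖z‖ := by simpa using hz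
    linarith

theorem integrable_mul_riesz_sub (hf : BddSupported Λ R f) (r : ℝ) (x : E (n + 1)) :
    Integrable (fun q : E (n + 1) × E (n + 1) => f (x + q.2) * riesz n (q.2 - q.1))
      ((uniformBall (n + 1) r).prod volume) := by
  have h_shear : MeasurePreserving (fun q : E (n + 1) × E (n + 1) => (q.1, q.2 - q.1))
      ((uniformBall (n + 1) r).prod volume) ((uniformBall (n + 1) r).prod volume) :=
    (MeasurePreserving.id _).skew_product (g := fun w u => u - w) (by fun_prop)
      (ae_of_all _ fun w => (measurePreserving_sub_right volume w).map_eq)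
  simpa only [Function.comp_def, add_assoc, sub_add_cancel] using
    h_shear.integrable_comp_of_integrable (hf.integrable_mul_riesz r x)

theorem integrable_mul_rieszAvg (hf : BddSupported Λ R f) (r : ℝ) (x : E (n + 1)) :
    Integrable fun u => f (x + u) * rieszAvg n r u := by
  have h_fubini := (hf.integrable_mul_riesz_sub r x).integral_prod_right
  simp only [integral_const_mul] at h_fubini
  exact h_fubini

theorem integral_ballAvg_lineMeasure (hf : BddSupported Λ R f) (r : ℝ) (x : E (n + 1)) :
    ∫ z, KPlane.ballAvg r f (x + z) ∂lineMeasure n =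
      rieszConst n * ∫ u, f (x + u) * rieszAvg n r u := by
  have h_shift (w : E (n + 1)) :
      ∫ z, f (x + z + w) * riesz n z = ∫ u, f (x + u) * riesz n (u - w) := by
    rw [← integral_sub_right_eq_self _ w]
    simp only [add_assoc, sub_add_cancel]
  calc ∫ z, KPlane.ballAvg r f (x + z) ∂lineMeasure n
      = ∫ z, rieszConst n * ∫ w, f (x + z + w) * riesz n z ∂uniformBall (n + 1) r := by
        rw [lineMeasure_eq, integral_withDensity_eq_integral_toReal_smul (by fun_prop)
          (ae_of_all _ fun _ => ENNReal.ofReal_lt_top)]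
        refine integral_congr_ae (ae_of_all _ fun z => ?_)
        simp only
        rw [ENNReal.toReal_ofReal (mul_nonneg (rieszConst_pos n).le (riesz_nonneg _)),
          integral_mul_const, smul_eq_mul, KPlane.ballAvg]
        ring
    _ = rieszConst n * ∫ w, (∫ z, f (x + z + w) * riesz n z) ∂uniformBall (n + 1) r := by
        rw [integral_const_mul, ← integral_integral_swap
          (f := fun w z => f (x + z + w) * riesz n z) (hf.integrable_mul_riesz r x)]
    _ = rieszConst n * ∫ u, f (x + u) * rieszAvg n r u := by
        simp_rw [h_shift]
        rw [integral_integral_swap (hf.integrable_mul_riesz_sub r x)]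
        simp_rw [integral_const_mul]
        rfl

theorem integrable_lineMeasure (hf : BddSupported Λ R f) (x : E (n + 1)) :
    Integrable (fun z => f (x + z)) (lineMeasure n) := by
  refine integrable_of_bounded_of_ae_notMem_eq_zero (S := Metric.ball 0 (R + ‖x‖))
    (hf.meas.comp (measurable_const_add x)) (fun z => hf.bound _) ?_
    (ae_of_all _ fun z hz => hf.supp _ ?_)
  · rw [lineMeasure_ball]
    exact ENNReal.ofReal_ne_top
  · have hRz : R + ‖x‖ ≤ ‖z‖ := by simpa using hz
    have h_triangle := norm_le_add_norm_add z x
    rw [add_comm z] at h_triangle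
    linarith

theorem enorm_integral_ballAvg_sub_lineMeasure_le (hf : BddSupported Λ R f) {r : ℝ} (hr : 0 < r)
    (x : E (n + 1)) :
    ‖∫ z, (KPlane.ballAvg r f (x + z) - KPlane.ballAvg (2 * r) f (x + z)) ∂lineMeasure n‖ₑ ≤
      ENNReal.ofReal (rieszConst n) *
        ∫⁻ u, ‖f (x + u)‖ₑ * ‖rieszAvg n r u - rieszAvg n (2 * r) u‖ₑ := by
  rw [integral_sub ((hf.ballAvg hr).integrable_lineMeasure x)
      ((hf.ballAvg (by positivity)).integrable_lineMeasure x),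
    hf.integral_ballAvg_lineMeasure, hf.integral_ballAvg_lineMeasure, ← mul_sub,
    ← integral_sub (hf.integrable_mul_rieszAvg r x) (hf.integrable_mul_rieszAvg (2 * r) x),
    enorm_mul, Real.enorm_eq_ofReal (rieszConst_pos n).le]
  simp_rw [← enorm_mul, mul_sub]
  gcongr
  exact enorm_integral_le_lintegral_enorm _

end BddSupported

theorem ennreal_mul_le_sq_add_sq (a b : ℝ≥0∞) : a * b ≤ a ^ 2 + b ^ 2 := by
  rcases le_total a b with h | h
  · calc a * b ≤ b * b := by gcongr
      _ ≤ _ := by rw [← sq]; exact le_add_self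
  · calc a * b ≤ a * a := by gcongr
      _ ≤ _ := by rw [← sq]; exact le_self_add

theorem lintegral_ballAvg_mul_le {d : ℕ} {f : E d → ℝ} (hf : Measurable f) {r : ℝ} (hr : 0 < r)
    (u : E d) : ∫⁻ x, ‖ballAvg r f x‖ₑ * ‖f (x + u)‖ₑ ≤ 2 * ∫⁻ x, ‖f x‖ₑ ^ 2 := by
  have h_prob := isProbabilityMeasure_uniformBall d hr
  calc ∫⁻ x, ‖ballAvg r f x‖ₑ * ‖f (x + u)‖ₑ
      ≤ ∫⁻ x, ∫⁻ w, (‖f (x + w)‖ₑ ^ 2 + ‖f (x + u)‖ₑ ^ 2) ∂uniformBall d r := by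
        refine lintegral_mono fun x => ?_
        calc ‖ballAvg r f x‖ₑ * ‖f (x + u)‖ₑ
            ≤ (∫⁻ w, ‖f (x + w)‖ₑ ∂uniformBall d r) * ‖f (x + u)‖ₑ := by
              gcongr; exact enorm_integral_le_lintegral_enorm _
          _ = ∫⁻ w, ‖f (x + w)‖ₑ * ‖f (x + u)‖ₑ ∂uniformBall d r := by
              rw [lintegral_mul_const _ (by fun_prop)]
          _ ≤ _ := lintegral_mono fun w => ennreal_mul_le_sq_add_sq _ _
    _ = ∫⁻ w, (∫⁻ x, (‖f (x + w)‖ₑ ^ 2 + ‖f (x + u)‖ₑ ^ 2)) ∂uniformBall d r :=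
        lintegral_lintegral_swap (by fun_prop)
    _ = ∫⁻ w, (2 * ∫⁻ x, ‖f x‖ₑ ^ 2) ∂uniformBall d r := by
        refine lintegral_congr fun w => ?_
        rw [lintegral_add_left (by fun_prop), lintegral_add_right_eq_self (fun x => ‖f x‖ₑ ^ 2),
          lintegral_add_right_eq_self (fun x => ‖f x‖ₑ ^ 2), two_mul]
    _ = _ := by rw [lintegral_const, measure_univ, mul_one]

theorem lintegral_mul_lintegral_add_mul_le {G : Type*} [MeasurableSpace G] [AddGroup G]
    [MeasurableAdd₂ G] {μ : Measure G} [SFinite μ] {A : ℝ≥0∞} {F H K : G → ℝ≥0∞}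
    (hF : Measurable F) (hH : Measurable H) (hK : Measurable K)
    (hA : ∀ u, ∫⁻ x, F x * H (x + u) ∂μ ≤ A) :
    ∫⁻ x, F x * ∫⁻ u, H (x + u) * K u ∂μ ∂μ ≤ A * ∫⁻ u, K u ∂μ := by
  calc ∫⁻ x, F x * ∫⁻ u, H (x + u) * K u ∂μ ∂μ
      = ∫⁻ x, ∫⁻ u, F x * H (x + u) * K u ∂μ ∂μ := by
        refine lintegral_congr fun x => ?_
        simp_rw [mul_assoc]
        exact (lintegral_const_mul _ (by fun_prop)).symm
    _ = ∫⁻ u, ∫⁻ x, F x * H (x + u) * K u ∂μ ∂μ := lintegral_lintegral_swap (by fun_prop)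
    _ ≤ ∫⁻ u, A * K u ∂μ := by
        refine lintegral_mono fun u => ?_
        rw [lintegral_mul_const _ (by fun_prop)]
        exact mul_le_mul_left (hA u) _
    _ = A * ∫⁻ u, K u ∂μ := lintegral_const_mul _ hK

namespace BddSupported

theorem lintegral_ballAvg_sub_mul_le (hf : BddSupported Λ R f) {r : ℝ} (hr : 0 < r)
    (u : E (n + 1)) :
    ∫⁻ x, ‖KPlane.ballAvg r f x - KPlane.ballAvg (2 * r) f x‖ₑ * ‖f (x + u)‖ₑ ≤
      4 * ∫⁻ x, ‖f x‖ₑ ^ 2 := by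
  have h_two_r : 0 < 2 * r := by positivity
  have h_meas : Measurable fun x => ‖KPlane.ballAvg r f x‖ₑ * ‖f (x + u)‖ₑ :=
    (hf.ballAvg hr).meas.enorm.mul (hf.meas.comp (measurable_add_const u)).enorm
  calc ∫⁻ x, ‖KPlane.ballAvg r f x - KPlane.ballAvg (2 * r) f x‖ₑ * ‖f (x + u)‖ₑ
      ≤ ∫⁻ x, (‖KPlane.ballAvg r f x‖ₑ * ‖f (x + u)‖ₑ +
          ‖KPlane.ballAvg (2 * r) f x‖ₑ * ‖f (x + u)‖ₑ) := by
        simp_rw [← add_mul]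
        gcongr
        exact enorm_sub_le
    _ = (∫⁻ x, ‖KPlane.ballAvg r f x‖ₑ * ‖f (x + u)‖ₑ) +
          ∫⁻ x, ‖KPlane.ballAvg (2 * r) f x‖ₑ * ‖f (x + u)‖ₑ := lintegral_add_left h_meas _
    _ ≤ (2 * ∫⁻ x, ‖f x‖ₑ ^ 2) + 2 * ∫⁻ x, ‖f x‖ₑ ^ 2 := add_le_add
        (lintegral_ballAvg_mul_le hf.meas hr u) (lintegral_ballAvg_mul_le hf.meas h_two_r u)
    _ = 4 * ∫⁻ x, ‖f x‖ₑ ^ 2 := by ring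

theorem lintegral_xray_ballAvg_sub_sq_le (hf : BddSupported Λ R f) (hR : 0 ≤ R) {r : ℝ}
    (hr : 0 < r) :
    ∫⁻ θ, (∫⁻ y, ‖KPlane.xray θ
      (fun x => KPlane.ballAvg r f x - KPlane.ballAvg (2 * r) f x) y‖ₑ ^ 2) ∂haarO (n + 1) ≤
      4 * ENNReal.ofReal (rieszConst n) *
        (∫⁻ u, ‖rieszAvg n r u - rieszAvg n (2 * r) u‖ₑ) * ∫⁻ x, ‖f x‖ₑ ^ 2 := by
  have h_kernel_meas : Measurable fun u => ‖rieszAvg n r u - rieszAvg n (2 * r) u‖ₑ :=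
    ((measurable_rieszAvg n r).sub (measurable_rieszAvg n (2 * r))).enorm
  have h_diff := (hf.ballAvg hr).sub (hf.ballAvg (show 0 < 2 * r by positivity))
  calc _ ≤ ∫⁻ x, ‖KPlane.ballAvg r f x - KPlane.ballAvg (2 * r) f x‖ₑ *
        ‖∫ z, (KPlane.ballAvg r f (x + z) - KPlane.ballAvg (2 * r) f (x + z)) ∂lineMeasure n‖ₑ :=
        h_diff.lintegral_xray_sq_le (le_max_of_le_left (by positivity))
    _ ≤ ∫⁻ x, ENNReal.ofReal (rieszConst n) *
          (‖KPlane.ballAvg r f x - KPlane.ballAvg (2 * r) f x‖ₑ *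
            ∫⁻ u, ‖f (x + u)‖ₑ * ‖rieszAvg n r u - rieszAvg n (2 * r) u‖ₑ) := by
        refine lintegral_mono fun x => ?_
        rw [mul_left_comm]
        exact mul_le_mul_right (hf.enorm_integral_ballAvg_sub_lineMeasure_le hr x) _
    _ ≤ ENNReal.ofReal (rieszConst n) * ((4 * ∫⁻ x, ‖f x‖ₑ ^ 2) *
          ∫⁻ u, ‖rieszAvg n r u - rieszAvg n (2 * r) u‖ₑ) := by
        rw [lintegral_const_mul' _ _ ENNReal.ofReal_ne_top]
        exact mul_le_mul_right (lintegral_mul_lintegral_add_mul_le h_diff.meas.enorm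
          hf.meas.enorm h_kernel_meas (hf.lintegral_ballAvg_sub_mul_le hr)) _
    _ = _ := by ring

end BddSupported

theorem exists_lintegral_xray_ballAvg_sub_sq_le (n : ℕ) : ∃ C : ℝ≥0∞, C ≠ ∞ ∧
    ∀ {Λ R : ℝ}, 0 ≤ R → ∀ {f : E (n + 1) → ℝ}, BddSupported Λ R f → ∀ {r : ℝ}, 0 < r →
    ∫⁻ θ, (∫⁻ y, ‖xray θ (fun x => ballAvg r f x - ballAvg (2 * r) f x) y‖ₑ ^ 2) ∂haarO (n + 1) ≤
      C * ENNReal.ofReal r * ∫⁻ x, ‖f x‖ₑ ^ 2 := by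
  obtain ⟨C, hC, h_kernel⟩ := exists_lintegral_rieszAvg_sub_le n
  refine ⟨4 * ENNReal.ofReal (rieszConst n) * C, by finiteness, fun hR f hf r hr => ?_⟩
  rw [mul_assoc _ C]
  exact (hf.lintegral_xray_ballAvg_sub_sq_le hR hr).trans (by gcongr; exact h_kernel r hr)

end XraySquare

section Interpolation

theorem lintegral_enorm_rpow_eq_lintegral_meas_lt_mul {X : Type*} [MeasurableSpace X]
    {μ : Measure X} {F : X → ℝ} (hF : Measurable F) {p : ℝ} (hp : 0 < p) :
    ∫⁻ x, ‖F x‖ₑ ^ p ∂μ = ENNReal.ofReal p *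
      ∫⁻ t in Ioi (0 : ℝ), μ {x | t < |F x|} * ENNReal.ofReal (t ^ (p - 1)) := by
  simp_rw [Real.enorm_eq_ofReal_abs, ENNReal.ofReal_rpow_of_nonneg (abs_nonneg _) hp.le]
  exact lintegral_rpow_eq_lintegral_meas_lt_mul μ (ae_of_all _ fun _ => abs_nonneg _)
    hF.abs.aemeasurable hp

theorem lintegral_setLIntegral_enorm_sq_mul_rpow {X : Type*} [MeasurableSpace X] {μ : Measure X}
    {f : X → ℝ} (hf : Measurable f) {p c : ℝ} (hp : 2 < p) (hc : 0 < c) :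
    ∫⁻ t in Ioi (0 : ℝ),
        (∫⁻ x in {x | t < c * |f x|}, ‖f x‖ₑ ^ 2 ∂μ) * ENNReal.ofReal (t ^ (p - 3)) =
      (ENNReal.ofReal (p - 2))⁻¹ * (ENNReal.ofReal (c ^ (p - 2)) * ∫⁻ x, ‖f x‖ₑ ^ p ∂μ) := by
  have hp_sub : 0 < p - 2 := sub_pos.2 hp
  have h_density (t : ℝ) : ∫⁻ x in {x | t < c * |f x|}, ‖f x‖ₑ ^ 2 ∂μ =
      μ.withDensity (fun x => ‖f x‖ₑ ^ 2) {x | t < |c * f x|} := by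
    simp_rw [abs_mul, abs_of_pos hc]
    exact (withDensity_apply _ (measurableSet_lt measurable_const (hf.abs.const_mul c))).symm
  have h_pow (a : ℝ) : ‖a‖ₑ ^ 2 * ‖c * a‖ₑ ^ (p - 2) = ENNReal.ofReal (c ^ (p - 2)) * ‖a‖ₑ ^ p := by
    rw [enorm_mul, ENNReal.mul_rpow_of_nonneg _ _ hp_sub.le, Real.enorm_eq_ofReal hc.le,
      ENNReal.ofReal_rpow_of_pos hc, mul_left_comm, ← ENNReal.rpow_natCast,
      ← ENNReal.rpow_add_of_nonneg _ _ (by positivity) hp_sub.le]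
    norm_num
  have h_layer := lintegral_enorm_rpow_eq_lintegral_meas_lt_mul
    (μ := μ.withDensity fun x => ‖f x‖ₑ ^ 2) (hf.const_mul c) hp_sub
  rw [lintegral_withDensity_eq_lintegral_mul _ (by fun_prop) (by fun_prop)] at h_layer
  simp_rw [Pi.mul_apply, h_pow, show p - 2 - 1 = p - 3 by ring, ← h_density] at h_layer
  rw [← lintegral_const_mul' _ _ ENNReal.ofReal_ne_top, h_layer, ← mul_assoc,
    ENNReal.inv_mul_cancel (ENNReal.ofReal_pos.2 hp_sub).ne' ENNReal.ofReal_ne_top, one_mul]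

theorem lintegral_enorm_rpow_le_of_meas_lt_le {X Y : Type*} [MeasurableSpace X]
    [MeasurableSpace Y] {μ : Measure X} {ν : Measure Y} {F : X → ℝ} {f : Y → ℝ}
    (hF : Measurable F) (hf : Measurable f) {p c : ℝ} (hp : 2 < p) (hc : 0 < c) {A : ℝ≥0∞}
    (hA : A ≠ ∞) (h_weak : ∀ t : ℝ, 0 < t → μ {q | t < |F q|} ≤
      A * (ENNReal.ofReal (t ^ 2))⁻¹ * ∫⁻ x in {x | t < c * |f x|}, ‖f x‖ₑ ^ 2 ∂ν) :
    ∫⁻ q, ‖F q‖ₑ ^ p ∂μ ≤ ENNReal.ofReal p * A * ((ENNReal.ofReal (p - 2))⁻¹ *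
      ENNReal.ofReal (c ^ (p - 2))) * ∫⁻ x, ‖f x‖ₑ ^ p ∂ν := by
  have h_pow {t : ℝ} (ht : 0 < t) : (ENNReal.ofReal (t ^ 2))⁻¹ * ENNReal.ofReal (t ^ (p - 1)) =
      ENNReal.ofReal (t ^ (p - 3)) := by
    rw [← ENNReal.ofReal_inv_of_pos (by positivity), ← ENNReal.ofReal_mul (by positivity),
      ← Real.rpow_natCast, ← Real.rpow_neg ht.le, ← Real.rpow_add ht]
    congr 2
    push_cast
    ring
  calc ∫⁻ q, ‖F q‖ₑ ^ p ∂μ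
      = ENNReal.ofReal p *
          ∫⁻ t in Ioi (0 : ℝ), μ {q | t < |F q|} * ENNReal.ofReal (t ^ (p - 1)) :=
        lintegral_enorm_rpow_eq_lintegral_meas_lt_mul hF (by positivity)
    _ ≤ ENNReal.ofReal p * ∫⁻ t in Ioi (0 : ℝ), A *
          ((∫⁻ x in {x | t < c * |f x|}, ‖f x‖ₑ ^ 2 ∂ν) * ENNReal.ofReal (t ^ (p - 3))) := by
        refine mul_le_mul_right (setLIntegral_mono' measurableSet_Ioi fun t ht => ?_) _
        refine (mul_le_mul_left (h_weak t ht) _).trans_eq ?_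
        rw [← h_pow ht]
        ring
    _ = _ := by
        rw [lintegral_const_mul' _ _ hA, lintegral_setLIntegral_enorm_sq_mul_rpow hf hp hc]
        ring

variable {n : ℕ} {Λ R : ℝ}

/-- The X-ray transform of the difference of the averages of `f` at scales `r` and `2 r`, as a
function of the rotation and the position of the line. -/
noncomputable def xrayDiff (r : ℝ) (f : E (n + 1) → ℝ) (q : O (n + 1) × E n) : ℝ :=
  xray q.1 (fun x => ballAvg r f x - ballAvg (2 * r) f x) q.2

namespace BddSupported

theorem indicator {d : ℕ} {f : E d → ℝ} (hf : BddSupported Λ R f) {S : Set (E d)}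
    (hS : MeasurableSet S) {Λ' : ℝ} (hΛ' : 0 ≤ Λ') (hb : ∀ x ∈ S, |f x| ≤ Λ') :
    BddSupported Λ' R (S.indicator f) where
  meas := hf.meas.indicator hS
  bound x := by
    by_cases hx : x ∈ S
    · rw [indicator_of_mem hx]; exact hb x hx
    · rw [indicator_of_notMem hx, abs_zero]; exact hΛ'
  supp x hx := indicator_apply_eq_zero.2 fun _ => hf.supp x hx

theorem ballAvg_sub_ballAvg {d : ℕ} {f : E d → ℝ} (hf : BddSupported Λ R f) {r : ℝ} (hr : 0 < r)
    (hr1 : r < 1) :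
    BddSupported (2 * Λ) (R + 2) fun x => KPlane.ballAvg r f x - KPlane.ballAvg (2 * r) f x :=
  ((hf.ballAvg hr).sub (hf.ballAvg (show 0 < 2 * r by positivity))).mono (by linarith)
    (max_le (by linarith) (by linarith))

variable {f g : E (n + 1) → ℝ} {r : ℝ}

theorem abs_xrayDiff_le (hf : BddSupported Λ R f) (hR : 0 ≤ R) (hr : 0 < r) (hr1 : r < 1)
    (q : O (n + 1) × E n) : |xrayDiff r f q| ≤ 4 * (R + 2) * Λ :=
  (((hf.ballAvg_sub_ballAvg hr hr1).xray (by linarith) q.1).bound q.2).trans_eq (by ring)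

theorem measurable_xrayDiff (hf : BddSupported Λ R f) (hr : 0 < r) (hr1 : r < 1) :
    Measurable (xrayDiff (n := n) r f) :=
  measurable_xray (hf.ballAvg_sub_ballAvg hr hr1).meas

theorem xrayDiff_sub {Λ' : ℝ} (hf : BddSupported Λ R f) (hg : BddSupported Λ' R g) (hr : 0 < r)
    (hr1 : r < 1) (q : O (n + 1) × E n) :
    xrayDiff r (fun x => f x - g x) q = xrayDiff r f q - xrayDiff r g q := by
  unfold xrayDiff
  rw [← (hf.ballAvg_sub_ballAvg hr hr1).xray_sub (hg.ballAvg_sub_ballAvg hr hr1)]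
  congr 1
  funext x
  rw [hf.ballAvg_sub hg, hf.ballAvg_sub hg]
  ring

theorem half_lt_abs_xrayDiff_indicator (hf : BddSupported Λ R f) (hR : 0 ≤ R) (hr : 0 < r)
    (hr1 : r < 1) {t : ℝ} (ht : 0 < t) {q : O (n + 1) × E n} (hq : t < |xrayDiff r f q|) :
    t / 2 < |xrayDiff r ({x | t < 8 * (R + 2) * |f x|}.indicator f) q| := by
  set S : Set (E (n + 1)) := {x | t < 8 * (R + 2) * |f x|}
  have hS_meas : MeasurableSet S := measurableSet_lt measurable_const (hf.meas.abs.const_mul _)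
  have h_const : 0 < 8 * (R + 2) := by positivity
  have h_large := hf.indicator hS_meas hf.nonneg fun x _ => hf.bound x
  have h_small : BddSupported (t / (8 * (R + 2))) R (Sᶜ.indicator f) :=
    hf.indicator hS_meas.compl (by positivity) fun x hx => by
      rw [le_div_iff₀' h_const]
      exact not_lt.1 hx
  have h_split : xrayDiff r (Sᶜ.indicator f) q =
      xrayDiff r f q - xrayDiff r (S.indicator f) q := by
    rw [← hf.xrayDiff_sub h_large hr hr1]
    congr 1
    funext x
    rw [indicator_compl, Pi.sub_apply]
  have h_small_bound : |xrayDiff r f q - xrayDiff r (S.indicator f) q| ≤ t / 2 := by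
    rw [← h_split]
    refine (h_small.abs_xrayDiff_le hR hr hr1 q).trans_eq ?_
    field_simp
    norm_num
  linarith [abs_sub_abs_le_abs_sub (xrayDiff r f q) (xrayDiff r (S.indicator f) q)]

theorem measure_lt_abs_xrayDiff_le (hf : BddSupported Λ R f) (hR : 0 ≤ R) (hr : 0 < r)
    (hr1 : r < 1) {t : ℝ} (ht : 0 < t) (P : Measure (O (n + 1) × E n)) :
    P {q | t < |xrayDiff r f q|} ≤ 4 * (ENNReal.ofReal (t ^ 2))⁻¹ *
      ∫⁻ q, ‖xrayDiff r ({x | t < 8 * (R + 2) * |f x|}.indicator f) q‖ₑ ^ 2 ∂P := by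
  have h_large := hf.indicator
    (measurableSet_lt (measurable_const (a := t)) (hf.meas.abs.const_mul (8 * (R + 2))))
    hf.nonneg fun x _ => hf.bound x
  have h_half : 0 < (t / 2) ^ 2 := by positivity
  calc P {q | t < |xrayDiff r f q|}
      ≤ P {q | ENNReal.ofReal ((t / 2) ^ 2) ≤
          ‖xrayDiff r ({x | t < 8 * (R + 2) * |f x|}.indicator f) q‖ₑ ^ 2} := by
        refine measure_mono fun q hq => ?_
        rw [mem_ofPred_eq, Real.enorm_eq_ofReal_abs, ← ENNReal.ofReal_pow (abs_nonneg _)]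
        have h_lt := hf.half_lt_abs_xrayDiff_indicator hR hr hr1 ht hq
        gcongr
    _ ≤ (∫⁻ q, ‖xrayDiff r ({x | t < 8 * (R + 2) * |f x|}.indicator f) q‖ₑ ^ 2 ∂P) /
          ENNReal.ofReal ((t / 2) ^ 2) :=
        meas_ge_le_lintegral_div
          ((h_large.measurable_xrayDiff hr hr1).enorm.pow_const 2).aemeasurable
          (ENNReal.ofReal_pos.2 h_half).ne' ENNReal.ofReal_ne_top
    _ = _ := by
        rw [div_pow, ENNReal.ofReal_div_of_pos (by norm_num), div_eq_mul_inv,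
          ENNReal.inv_div (by simp) (by simp), div_eq_mul_inv, mul_comm]
        norm_num

end BddSupported

theorem exists_lintegral_xrayDiff_sq_le (n : ℕ) : ∃ C : ℝ≥0∞, C ≠ ∞ ∧
    ∀ {Λ R : ℝ}, 0 ≤ R → ∀ {f : E (n + 1) → ℝ}, BddSupported Λ R f →
    ∀ {r : ℝ}, 0 < r → r < 1 →
    ∫⁻ q, ‖xrayDiff r f q‖ₑ ^ 2 ∂((haarO (n + 1)).prod volume) ≤
      C * ENNReal.ofReal r * ∫⁻ x, ‖f x‖ₑ ^ 2 := by
  obtain ⟨C, hC, h_sq⟩ := exists_lintegral_xray_ballAvg_sub_sq_le n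
  refine ⟨C, hC, fun hR f hf r hr hr1 => ?_⟩
  rw [lintegral_prod _ ((hf.measurable_xrayDiff hr hr1).enorm.pow_const 2).aemeasurable]
  exact h_sq hR hf hr

/-- Marcinkiewicz interpolation of the `L²` smoothing estimate with the trivial `L^∞` bound. -/
theorem exists_lintegral_xrayDiff_rpow_le (n : ℕ) {R : ℝ} (hR : 0 ≤ R) {p : ℝ} (hp : 2 ≤ p) :
    ∃ C : ℝ≥0∞, C ≠ ∞ ∧ ∀ {Λ : ℝ} {f : E (n + 1) → ℝ}, BddSupported Λ R f →
    ∀ {r : ℝ}, 0 < r → r < 1 →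
    ∫⁻ q, ‖xrayDiff r f q‖ₑ ^ p ∂((haarO (n + 1)).prod volume) ≤
      C * ENNReal.ofReal r * ∫⁻ x, ‖f x‖ₑ ^ p := by
  obtain ⟨C, hC, h_sq⟩ := exists_lintegral_xrayDiff_sq_le n
  rcases hp.eq_or_lt with rfl | hp_lt
  · exact ⟨C, hC, fun hf r hr hr1 => by simpa using h_sq hR hf hr hr1⟩
  have hp_sub : ENNReal.ofReal (p - 2) ≠ 0 := (ENNReal.ofReal_pos.2 (sub_pos.2 hp_lt)).ne'
  refine ⟨ENNReal.ofReal p * (4 * C) * ((ENNReal.ofReal (p - 2))⁻¹ *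
    ENNReal.ofReal ((8 * (R + 2)) ^ (p - 2))), by finiteness, fun {Λ f} hf r hr hr1 => ?_⟩
  have h_weak (t : ℝ) (ht : 0 < t) :
      ((haarO (n + 1)).prod volume) {q | t < |xrayDiff r f q|} ≤
        4 * C * ENNReal.ofReal r * (ENNReal.ofReal (t ^ 2))⁻¹ *
          ∫⁻ x in {x | t < 8 * (R + 2) * |f x|}, ‖f x‖ₑ ^ 2 := by
    have hS : MeasurableSet {x | t < 8 * (R + 2) * |f x|} :=
      measurableSet_lt measurable_const (hf.meas.abs.const_mul _)
    have h_ind : ∫⁻ x, ‖{x | t < 8 * (R + 2) * |f x|}.indicator f x‖ₑ ^ 2 =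
        ∫⁻ x in {x | t < 8 * (R + 2) * |f x|}, ‖f x‖ₑ ^ 2 := by
      rw [← lintegral_indicator hS]
      exact lintegral_congr fun x => (congr_fun (indicator_comp_of_zero (f := f)
        (g := fun a : ℝ => ‖a‖ₑ ^ 2) (by simp)) x).symm
    refine (hf.measure_lt_abs_xrayDiff_le hR hr hr1 ht _).trans ((mul_le_mul_right
      (h_sq hR (hf.indicator hS hf.nonneg fun x _ => hf.bound x) hr hr1) _).trans_eq ?_)
    rw [h_ind]
    ring
  refine (lintegral_enorm_rpow_le_of_meas_lt_le (hf.measurable_xrayDiff hr hr1) hf.meas hp_lt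
    (by positivity) (by finiteness) h_weak).trans_eq ?_
  ring

end Interpolation

section BallAverage

variable {d k : ℕ}

/-- The average of a `[0,∞]`-valued function over the ball of radius `r` around `x`. -/
noncomputable def lballAvg (r : ℝ) (F : E d → ℝ≥0∞) (x : E d) : ℝ≥0∞ :=
  ∫⁻ z, F (x + z) ∂uniformBall d r

theorem setLIntegral_ball_zero_comp_add (r : ℝ) (F : E d → ℝ≥0∞) (x : E d) :
    ∫⁻ z in Metric.ball 0 r, F (x + z) = ∫⁻ u in Metric.ball x r, F u := by
  have h_translate := (measurePreserving_add_left volume x).setLIntegral_comp_preimage_emb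
    (measurableEmbedding_addLeft x) F (Metric.ball x r)
  rwa [preimage_add_ball, sub_self] at h_translate

theorem lballAvg_eq (r : ℝ) (F : E d → ℝ≥0∞) (x : E d) :
    lballAvg r F x = (volume (Metric.ball (0 : E d) r))⁻¹ * ∫⁻ u in Metric.ball x r, F u := by
  rw [lballAvg, lintegral_uniformBall, setLIntegral_ball_zero_comp_add]

theorem lowerSemicontinuous_lballAvg {r : ℝ} (hr : 0 < r) {F : E d → ℝ≥0∞} :
    LowerSemicontinuous (lballAvg r F) := by
  have h_eq : lballAvg r F = fun x => (volume (Metric.ball (0 : E d) r))⁻¹ *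
      (volume.withDensity F) (Metric.ball x r) := by
    funext x
    rw [lballAvg_eq, withDensity_apply _ Metric.isOpen_ball.measurableSet]
  rw [h_eq]
  refine (ENNReal.continuous_const_mul ?_).comp_lowerSemicontinuous ?_ ?_
  · exact ENNReal.inv_ne_top.2 (Metric.measure_ball_pos _ _ hr).ne'
  · refine lowerSemicontinuous_measure (fun _ => Metric.isOpen_ball.measurableSet) fun y => ?_
    simp only [Metric.mem_ball, dist_comm y]
    exact Metric.isOpen_ball
  · exact fun x y h => mul_le_mul_right h _

theorem measurable_lballAvg {r : ℝ} (hr : 0 < r) {F : E d → ℝ≥0∞} : Measurable (lballAvg r F) :=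
  (lowerSemicontinuous_lballAvg hr).measurable

theorem lballAvg_mono (r : ℝ) {F G : E d → ℝ≥0∞} (h : ∀ x, F x ≤ G x) (x : E d) :
    lballAvg r F x ≤ lballAvg r G x := lintegral_mono fun _ => h _

theorem lballAvg_le_of_forall_le {r : ℝ} {F : E d → ℝ≥0∞} {B : ℝ≥0∞} (h : ∀ x, F x ≤ B) (x : E d) :
    lballAvg r F x ≤ B :=
  calc lballAvg r F x ≤ ∫⁻ _, B ∂uniformBall d r := lintegral_mono fun _ => h _
    _ = B * uniformBall d r univ := lintegral_const B
    _ ≤ B * 1 := mul_le_mul_right prob_le_one B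
    _ = B := mul_one B

theorem lballAvg_le_inv_volume_mul_lintegral (r : ℝ) (F : E d → ℝ≥0∞) (x : E d) :
    lballAvg r F x ≤ (volume (Metric.ball (0 : E d) r))⁻¹ * ∫⁻ u, F u :=
  (lballAvg_eq r F x).trans_le (mul_le_mul_right (setLIntegral_le_lintegral _ _) _)

theorem lballAvg_eq_zero_of_le_norm {r R : ℝ} {F : E d → ℝ≥0∞} (hF : ∀ x, R ≤ ‖x‖ → F x = 0)
    {x : E d} (hx : R + r ≤ ‖x‖) : lballAvg r F x = 0 := by
  refine (lintegral_congr_ae (g := fun _ => 0) ?_).trans lintegral_zero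
  filter_upwards [ae_uniformBall_norm_lt d r] with z hz
  exact hF _ (by linarith [norm_le_add_norm_add x z])

theorem ballAvg_nonneg (r : ℝ) {f : E d → ℝ} (hf : ∀ x, 0 ≤ f x) (x : E d) : 0 ≤ ballAvg r f x :=
  integral_nonneg fun _ => hf _

namespace BddSupported

variable {Λ R : ℝ} {f : E d → ℝ}

theorem enorm_ballAvg (hf : BddSupported Λ R f) (h_nonneg : ∀ x, 0 ≤ f x) (r : ℝ) (x : E d) :
    ‖KPlane.ballAvg r f x‖ₑ = lballAvg r (fun x => ‖f x‖ₑ) x := by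
  rw [Real.enorm_eq_ofReal (ballAvg_nonneg r h_nonneg x), KPlane.ballAvg,
    ofReal_integral_eq_lintegral_ofReal (hf.integrable_uniformBall x r)
      (ae_of_all _ fun _ => h_nonneg _)]
  exact lintegral_congr fun z => (Real.enorm_eq_ofReal (h_nonneg _)).symm

theorem enorm_ballAvg_ballAvg (hf : BddSupported Λ R f) (h_nonneg : ∀ x, 0 ≤ f x) {r : ℝ}
    (hr : 0 < r) (x : E d) : ‖KPlane.ballAvg r (KPlane.ballAvg r f) x‖ₑ =
      lballAvg r (lballAvg r fun x => ‖f x‖ₑ) x := by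
  rw [(hf.ballAvg hr).enorm_ballAvg (ballAvg_nonneg r h_nonneg)]
  congr 1
  funext x
  exact hf.enorm_ballAvg h_nonneg r x

theorem lintegral_lballAvg_lballAvg (hf : BddSupported Λ R f) (h_nonneg : ∀ x, 0 ≤ f x) {r : ℝ}
    (hr : 0 < r) (U : E k →ₗᵢ[ℝ] E d) (x : E d) :
    ∫⁻ v, lballAvg r (lballAvg r fun x => ‖f x‖ₑ) (x + U v) =
      ‖∫ v, KPlane.ballAvg r (KPlane.ballAvg r f) (x + U v)‖ₑ := by
  have h_avg_nonneg := ballAvg_nonneg r (ballAvg_nonneg r h_nonneg)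
  rw [Real.enorm_eq_ofReal (integral_nonneg fun v => h_avg_nonneg _),
    ofReal_integral_eq_lintegral_ofReal
      (((hf.ballAvg hr).ballAvg hr).integrable_comp_isometry U x)
      (ae_of_all _ fun v => h_avg_nonneg _)]
  refine lintegral_congr fun v => ?_
  rw [← hf.enorm_ballAvg_ballAvg h_nonneg hr, Real.enorm_eq_ofReal (h_avg_nonneg _)]

end BddSupported

theorem iSup_lballAvg (r : ℝ) {F : ℕ → E d → ℝ≥0∞} (hm : ∀ i, Measurable (F i)) (hF : Monotone F)
    (x : E d) : lballAvg r (fun x => ⨆ i, F i x) x = ⨆ i, lballAvg r (F i) x :=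
  lintegral_iSup (fun i => (hm i).comp (measurable_const_add x)) fun _ _ h _ => hF h _

theorem iSup_planeMax {F : ℕ → E d → ℝ≥0∞} (hm : ∀ i, Measurable (F i)) (hF : Monotone F)
    (L : Gr d k) : planeMax (fun x => ⨆ i, F i x) L = ⨆ i, planeMax (F i) L := by
  unfold planeMax
  rw [iSup_comm]
  congr 1
  funext x
  exact lintegral_iSup (fun i => (hm i).comp (by fun_prop)) fun _ _ h _ => hF h _

end BallAverage

section LowFrequency

variable {d k : ℕ}

theorem lintegral_rpow_le_measure_univ_rpow_mul {X : Type*} [MeasurableSpace X] {μ : Measure X}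
    {p : ℝ} (hp : 1 ≤ p) {F : X → ℝ≥0∞} (hF : AEMeasurable F μ) :
    (∫⁻ x, F x ∂μ) ^ p ≤ μ univ ^ (p - 1) * ∫⁻ x, F x ^ p ∂μ := by
  have hp_pos : 0 < p := one_pos.trans_le hp
  have h_holder := eLpNorm'_le_eLpNorm'_mul_rpow_measure_univ one_pos hp hF.aestronglyMeasurable
  simp only [eLpNorm', enorm_eq_self, ENNReal.rpow_one, div_one] at h_holder
  refine (ENNReal.rpow_le_rpow h_holder hp_pos.le).trans_eq ?_
  rw [ENNReal.mul_rpow_of_nonneg _ _ hp_pos.le, ← ENNReal.rpow_mul, ← ENNReal.rpow_mul,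
    one_div_mul_cancel hp_pos.ne', ENNReal.rpow_one, mul_comm, sub_mul, one_mul,
    one_div_mul_cancel hp_pos.ne']

theorem lintegral_rpow_le_volume_ball_rpow_mul {R p : ℝ} (hp : 1 ≤ p) {F : E d → ℝ≥0∞}
    (hF : Measurable F) (hs : ∀ x, R ≤ ‖x‖ → F x = 0) :
    (∫⁻ x, F x) ^ p ≤ volume (Metric.ball (0 : E d) R) ^ (p - 1) * ∫⁻ x, F x ^ p := by
  have h_supp : Function.support F ⊆ Metric.ball 0 R := fun x hx => by
    by_contra h
    exact hx (hs x (by simpa using h))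
  rw [← setLIntegral_eq_of_support_subset h_supp]
  refine (lintegral_rpow_le_measure_univ_rpow_mul hp hF.aemeasurable).trans ?_
  rw [Measure.restrict_apply_univ]
  exact mul_le_mul_right (setLIntegral_le_lintegral _ _) _

theorem planeMax_le_of_forall_le {s : ℝ} (hs : 0 < s) {G : E d → ℝ≥0∞} {B : ℝ≥0∞}
    (h_le : ∀ x, G x ≤ B) (h_supp : ∀ x, s ≤ ‖x‖ → G x = 0) (L : Gr d k) :
    planeMax G L ≤ B * (ENNReal.ofReal (2 * s) ^ k * unitBallVolume k) := by
  obtain ⟨U, hU⟩ := exists_linearIsometry_range_eq L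
  rw [planeMax_eq_iSup hU]
  refine iSup_le fun x => ?_
  have h_meas : MeasurableSet {v : E k | ‖-x - U v‖ < s} :=
    measurableSet_lt (by fun_prop) measurable_const
  calc ∫⁻ v, G (x + U v)
      ≤ ∫⁻ v, {v : E k | ‖-x - U v‖ < s}.indicator (fun _ => B) v := by
        refine lintegral_mono fun v => ?_
        by_cases hv : v ∈ {v : E k | ‖-x - U v‖ < s}
        · rw [indicator_of_mem hv]
          exact h_le _
        · rw [indicator_of_notMem hv, h_supp]
          rwa [mem_ofPred_eq, not_lt, ← neg_add', norm_neg] at hv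
    _ = B * volume {v : E k | ‖-x - U v‖ < s} := lintegral_indicator_const h_meas _
    _ ≤ B * (ENNReal.ofReal (2 * s) ^ k * unitBallVolume k) :=
        mul_le_mul_right (volume_setOf_norm_sub_lt_le U (-x) hs) _

theorem exists_planeMax_lballAvg_lballAvg_rpow_le (d k : ℕ) (R : ℝ) {p : ℝ} (hp : 1 ≤ p) {r : ℝ}
    (hr : 0 < r) : ∃ C : ℝ≥0∞, C ≠ ∞ ∧ ∀ {F : E d → ℝ≥0∞}, Measurable F →
      (∀ x, R ≤ ‖x‖ → F x = 0) → ∀ L : Gr d k,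
      planeMax (lballAvg r (lballAvg r F)) L ^ p ≤ C * ∫⁻ x, F x ^ p := by
  have hp_nonneg : 0 ≤ p := by positivity
  set V := volume (Metric.ball (0 : E d) r)
  set s := |R| + 2 * r
  set A := ENNReal.ofReal (2 * s) ^ k * unitBallVolume k
  have hV : V⁻¹ ≠ ∞ := ENNReal.inv_ne_top.2 (Metric.measure_ball_pos _ _ hr).ne'
  have hA : A ≠ ∞ := ENNReal.mul_ne_top (by finiteness) (unitBallVolume_ne_top k)
  refine ⟨(V⁻¹ * A) ^ p * volume (Metric.ball (0 : E d) R) ^ (p - 1), ?_,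
    fun {F} hF h_supp L => ?_⟩
  · exact ENNReal.mul_ne_top (ENNReal.rpow_ne_top_of_nonneg hp_nonneg (ENNReal.mul_ne_top hV hA))
      (ENNReal.rpow_ne_top_of_nonneg (sub_nonneg.2 hp) measure_ball_lt_top.ne)
  have h_avg_supp (x : E d) (hx : s ≤ ‖x‖) : lballAvg r (lballAvg r F) x = 0 :=
    lballAvg_eq_zero_of_le_norm (fun _ => lballAvg_eq_zero_of_le_norm h_supp)
      (by linarith [le_abs_self R])
  calc planeMax (lballAvg r (lballAvg r F)) L ^ p
      ≤ (V⁻¹ * (∫⁻ x, F x) * A) ^ p := by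
        gcongr
        exact planeMax_le_of_forall_le (by positivity)
          (lballAvg_le_of_forall_le (lballAvg_le_inv_volume_mul_lintegral r F)) h_avg_supp L
    _ = (V⁻¹ * A) ^ p * (∫⁻ x, F x) ^ p := by
        rw [mul_right_comm, ENNReal.mul_rpow_of_nonneg _ _ hp_nonneg]
    _ ≤ _ := by
        rw [mul_assoc]
        exact mul_le_mul_right (lintegral_rpow_le_volume_ball_rpow_mul hp hF h_supp) _

end LowFrequency

section Telescoping

variable {n m d : ℕ} {Λ R : ℝ}

/-- The dyadic radii `2^{-(j+1)}`. -/
noncomputable def dyadicRad (j : ℕ) : ℝ := (1 / 2) ^ (j + 1)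

theorem dyadicRad_pos (j : ℕ) : 0 < dyadicRad j := by unfold dyadicRad; positivity

theorem dyadicRad_lt_one (j : ℕ) : dyadicRad j < 1 :=
  pow_lt_one₀ (by norm_num) (by norm_num) (by simp)

theorem two_mul_dyadicRad_succ (j : ℕ) : 2 * dyadicRad (j + 1) = dyadicRad j := by
  unfold dyadicRad; rw [pow_succ _ (j + 1)]; ring

/-- The contribution of the dyadic scale `j` to the telescoping sum: the plate averages, over
plates of thickness `dyadicRad (j + 1)` and `dyadicRad j`, of the X-ray transform of the difference
of the ball averages of `f` at these two scales. -/
noncomputable def scaleTerm (f : E (n + 1) → ℝ) (θ : O (n + 1)) (j : ℕ) (L : Gr n m) : ℝ≥0∞ :=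
  plateMax (dyadicRad (j + 1)) (fun y => ‖xrayDiff (dyadicRad (j + 1)) f (θ, y)‖ₑ) L +
    plateMax (dyadicRad j) (fun y => ‖xrayDiff (dyadicRad (j + 1)) f (θ, y)‖ₑ) L

theorem measurable_scaleTerm (f : E (n + 1) → ℝ) (θ : O (n + 1)) (j : ℕ) :
    Measurable (scaleTerm f θ j : Gr n m → ℝ≥0∞) :=
  (lowerSemicontinuous_plateMax (dyadicRad_pos _) _).measurable.add
    (lowerSemicontinuous_plateMax (dyadicRad_pos _) _).measurable

-- Averages at different scales commute, so `A_r² - A_s² = (A_r + A_s)(A_r - A_s)`.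
theorem BddSupported.ballAvg_ballAvg_eq_add {f : E d → ℝ} (hf : BddSupported Λ R f) {r s : ℝ}
    (hr : 0 < r) (hs : 0 < s) (x : E d) :
    KPlane.ballAvg r (KPlane.ballAvg r f) x =
      KPlane.ballAvg s (KPlane.ballAvg s f) x +
        (KPlane.ballAvg r (fun y => KPlane.ballAvg r f y - KPlane.ballAvg s f y) x +
          KPlane.ballAvg s (fun y => KPlane.ballAvg r f y - KPlane.ballAvg s f y) x) := by
  rw [(hf.ballAvg hr).ballAvg_sub (hf.ballAvg hs), (hf.ballAvg hr).ballAvg_sub (hf.ballAvg hs),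
    hf.ballAvg_comm r s]
  ring

theorem exists_planeMax_lballAvg_dyadicRad_succ_le (n m : ℕ) (hR : 0 ≤ R) :
    ∃ C : ℝ≥0∞, C ≠ ∞ ∧ ∀ {Λ : ℝ} {f : E (n + 1) → ℝ}, BddSupported Λ R f → (∀ x, 0 ≤ f x) →
      ∀ (θ : O (n + 1)) (L : Gr n m) (j : ℕ),
      planeMax (lballAvg (dyadicRad (j + 1)) (lballAvg (dyadicRad (j + 1)) fun x => ‖f x‖ₑ))
          (rotate θ L.cons) ≤
        planeMax (lballAvg (dyadicRad j) (lballAvg (dyadicRad j) fun x => ‖f x‖ₑ))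
          (rotate θ L.cons) + C * scaleTerm f θ j L := by
  obtain ⟨C, hC, h_plate⟩ :=
    exists_enorm_integral_ballAvg_le_plateMax n m (show 0 ≤ R + 2 by linarith)
  refine ⟨C, hC, fun {Λ f} hf h_nonneg θ L j => ?_⟩
  obtain ⟨U, hU⟩ := exists_linearIsometry_range_eq L
  set V := rotateIsometry θ (consIsometry U)
  have hV : LinearMap.range V.toLinearMap = (rotate θ L.cons).1 :=
    range_rotateIsometry (range_consIsometry hU) θ
  rw [scaleTerm, ← two_mul_dyadicRad_succ j]
  have hr := dyadicRad_pos (j + 1)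
  have hr1 := dyadicRad_lt_one (j + 1)
  have h2r1 : 2 * dyadicRad (j + 1) < 1 := two_mul_dyadicRad_succ j ▸ dyadicRad_lt_one j
  generalize dyadicRad (j + 1) = r at hr hr1 h2r1 ⊢
  have h2r : 0 < 2 * r := by positivity
  have hD := hf.ballAvg_sub_ballAvg hr hr1
  have h_int {s : ℝ} (hs : 0 < s) (x : E (n + 1)) :=
    (hD.ballAvg hs).integrable_comp_isometry V x
  rw [planeMax_eq_iSup hV, planeMax_eq_iSup hV]
  refine iSup_le fun x => ?_
  rw [hf.lintegral_lballAvg_lballAvg h_nonneg hr]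
  simp_rw [hf.ballAvg_ballAvg_eq_add hr h2r]
  rw [integral_add (((hf.ballAvg h2r).ballAvg h2r).integrable_comp_isometry V x)
    ((h_int hr x).fun_add (h_int h2r x)), integral_add (h_int hr x) (h_int h2r x), mul_add]
  refine (enorm_add_le _ _).trans (add_le_add ?_ ((enorm_add_le _ _).trans (add_le_add ?_ ?_)))
  · rw [← hf.lintegral_lballAvg_lballAvg h_nonneg h2r]
    exact le_iSup (fun x => ∫⁻ v, lballAvg (2 * r) (lballAvg (2 * r) fun x => ‖f x‖ₑ) (x + V v)) x
  · exact h_plate r hr hr1 L U hU _ _ hD θ x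
  · exact h_plate _ h2r h2r1 L U hU _ _ hD θ x

theorem exists_planeMax_lballAvg_le_add_sum_scaleTerm (n m : ℕ) (hR : 0 ≤ R) :
    ∃ C : ℝ≥0∞, C ≠ ∞ ∧ ∀ {Λ : ℝ} {f : E (n + 1) → ℝ}, BddSupported Λ R f → (∀ x, 0 ≤ f x) →
      ∀ (θ : O (n + 1)) (L : Gr n m) (J : ℕ),
      planeMax (lballAvg (dyadicRad J) (lballAvg (dyadicRad J) fun x => ‖f x‖ₑ))
          (rotate θ L.cons) ≤
        planeMax (lballAvg (dyadicRad 0) (lballAvg (dyadicRad 0) fun x => ‖f x‖ₑ))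
          (rotate θ L.cons) + C * ∑ j ∈ Finset.range J, scaleTerm f θ j L := by
  obtain ⟨C, hC, h_succ⟩ := exists_planeMax_lballAvg_dyadicRad_succ_le n m hR
  refine ⟨C, hC, fun hf h_nonneg θ L J => ?_⟩
  induction J with
  | zero => simp
  | succ J ih =>
    refine (h_succ hf h_nonneg θ L J).trans ((add_le_add_left ih _).trans_eq ?_)
    rw [Finset.sum_range_succ, mul_add, add_assoc]

end Telescoping

section KeyEstimate

variable {n m : ℕ} {R p α : ℝ}

/-- The hypothesis of the induction on dimension: on bounded functions of bounded support, the plate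
maximal function satisfies the `L^p` bound with constant `A δ^{-α}` (for `p`-th powers of norms). -/
def PlateBound (n m : ℕ) (p α : ℝ) (A : ℝ≥0∞) : Prop :=
  ∀ δ : ℝ, 0 < δ → δ < 1 → ∀ (Λ R : ℝ) (h : E n → ℝ), BddSupported Λ R h →
    ∫⁻ L : Gr n m, plateMax δ (fun y => ‖h y‖ₑ) L ^ p ∂gamma n m ≤
      A * ENNReal.ofReal (δ ^ (-α)) * ∫⁻ y, ‖h y‖ₑ ^ p

/-- The size `r^{-(α-1)/p}` of the operator norm of the part of frequency about `1 / r`, where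
`r = dyadicRad (j + 1)`. -/
noncomputable def scaleWeight (p α : ℝ) (j : ℕ) : ℝ≥0∞ :=
  ENNReal.ofReal (dyadicRad (j + 1) ^ (-(α - 1) / p))

theorem scaleWeight_ne_zero (p α : ℝ) (j : ℕ) : scaleWeight p α j ≠ 0 :=
  (ENNReal.ofReal_pos.2 (Real.rpow_pos_of_pos (dyadicRad_pos _) _)).ne'

theorem scaleWeight_ne_top (p α : ℝ) (j : ℕ) : scaleWeight p α j ≠ ∞ := ENNReal.ofReal_ne_top

theorem scaleWeight_rpow (hp : 0 < p) (j : ℕ) : scaleWeight p α j ^ p =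
    ENNReal.ofReal (dyadicRad (j + 1) ^ (-α)) * ENNReal.ofReal (dyadicRad (j + 1)) := by
  have hr := dyadicRad_pos (j + 1)
  rw [scaleWeight, ENNReal.ofReal_rpow_of_nonneg (by positivity) hp.le, ← Real.rpow_mul hr.le,
    div_mul_cancel₀ _ hp.ne', ← ENNReal.ofReal_mul (by positivity), neg_sub, sub_eq_neg_add,
    Real.rpow_add_one hr.ne']

theorem scaleWeight_rpow_one_sub_ne_top (p α : ℝ) (j : ℕ) : scaleWeight p α j ^ (1 - p) ≠ ∞ :=
  ENNReal.rpow_ne_top_of_ne_zero (scaleWeight_ne_zero p α j) (scaleWeight_ne_top p α j)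

theorem scaleWeight_rpow_one_sub_mul_rpow (p α : ℝ) (j : ℕ) :
    scaleWeight p α j ^ (1 - p) * scaleWeight p α j ^ p = scaleWeight p α j := by
  rw [← ENNReal.rpow_add _ _ (scaleWeight_ne_zero p α j) (scaleWeight_ne_top p α j),
    sub_add_cancel, ENNReal.rpow_one]

theorem rpow_sum_le_rpow_sum_mul_sum {ι : Type*} (s : Finset ι) (hp : 1 ≤ p) {w : ι → ℝ≥0∞}
    (h_ne_zero : ∀ i, w i ≠ 0) (h_ne_top : ∀ i, w i ≠ ∞) (S : ι → ℝ≥0∞) :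
    (∑ i ∈ s, S i) ^ p ≤ (∑ i ∈ s, w i) ^ (p - 1) * ∑ i ∈ s, w i ^ (1 - p) * S i ^ p := by
  have hp_pos : 0 < p := one_pos.trans_le hp
  have h_cancel (i : ι) : w i * ((w i)⁻¹ * S i) = S i := by
    rw [← mul_assoc, ENNReal.mul_inv_cancel (h_ne_zero i) (h_ne_top i), one_mul]
  have h_weight (i : ι) : w i * ((w i)⁻¹ * S i) ^ p = w i ^ (1 - p) * S i ^ p := by
    rw [ENNReal.mul_rpow_of_nonneg _ _ hp_pos.le, ← mul_assoc, ENNReal.inv_rpow, ← div_eq_mul_inv,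
      ENNReal.rpow_sub _ _ (h_ne_zero i) (h_ne_top i), ENNReal.rpow_one]
  have h_holder := ENNReal.inner_le_weight_mul_Lp_of_nonneg s hp w fun i => (w i)⁻¹ * S i
  simp_rw [h_cancel, h_weight] at h_holder
  refine (ENNReal.rpow_le_rpow h_holder hp_pos.le).trans_eq ?_
  rw [ENNReal.mul_rpow_of_nonneg _ _ hp_pos.le, ← ENNReal.rpow_mul, ← ENNReal.rpow_mul,
    inv_mul_cancel₀ hp_pos.ne', ENNReal.rpow_one, sub_mul, inv_mul_cancel₀ hp_pos.ne', one_mul]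

namespace PlateBound

variable {A : ℝ≥0∞}

theorem exists_lintegral_scaleTerm_rpow_le (hA : PlateBound n m p α A) (hA_top : A ≠ ∞)
    (hp : 1 ≤ p) (hR : 0 ≤ R) : ∃ C : ℝ≥0∞, C ≠ ∞ ∧
      ∀ {Λ : ℝ} {f : E (n + 1) → ℝ}, BddSupported Λ R f → ∀ (θ : O (n + 1)) (j : ℕ),
      ∫⁻ L : Gr n m, scaleTerm f θ j L ^ p ∂gamma n m ≤
        C * ENNReal.ofReal (dyadicRad (j + 1) ^ (-α)) *
          ∫⁻ y, ‖xrayDiff (dyadicRad (j + 1)) f (θ, y)‖ₑ ^ p := by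
  have h_two : (2 : ℝ≥0∞) ^ (p - 1) ≠ ∞ :=
    ENNReal.rpow_ne_top_of_nonneg (by linarith) ENNReal.ofNat_ne_top
  refine ⟨2 ^ (p - 1) * (A + A * ENNReal.ofReal (2 ^ (-α))), by finiteness,
    fun {Λ f} hf θ j => ?_⟩
  have h_supp : BddSupported _ _ fun y => xrayDiff (dyadicRad (j + 1)) f (θ, y) :=
    (hf.ballAvg_sub_ballAvg (dyadicRad_pos (j + 1)) (dyadicRad_lt_one _)).xray (by linarith) θ
  have h_fine := hA (dyadicRad (j + 1)) (dyadicRad_pos (j + 1)) (dyadicRad_lt_one _) _ _ _ h_supp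
  have h_coarse := hA (dyadicRad j) (dyadicRad_pos j) (dyadicRad_lt_one _) _ _ _ h_supp
  have h_two_mul : ENNReal.ofReal (dyadicRad j ^ (-α)) =
      ENNReal.ofReal (2 ^ (-α)) * ENNReal.ofReal (dyadicRad (j + 1) ^ (-α)) := by
    rw [← two_mul_dyadicRad_succ j, Real.mul_rpow zero_le_two (dyadicRad_pos _).le,
      ENNReal.ofReal_mul (by positivity)]
  rw [h_two_mul] at h_coarse
  unfold scaleTerm
  generalize (fun y => ‖xrayDiff (dyadicRad (j + 1)) f (θ, y)‖ₑ) = G at h_fine h_coarse ⊢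
  have h_meas := (lowerSemicontinuous_plateMax (dyadicRad_pos (j + 1)) G (k := m)).measurable
  calc ∫⁻ L : Gr n m, (plateMax (dyadicRad (j + 1)) G L + plateMax (dyadicRad j) G L) ^ p
        ∂gamma n m
      ≤ ∫⁻ L : Gr n m, 2 ^ (p - 1) *
          (plateMax (dyadicRad (j + 1)) G L ^ p + plateMax (dyadicRad j) G L ^ p) ∂gamma n m :=
        lintegral_mono fun L => ENNReal.rpow_add_le_mul_rpow_add_rpow _ _ hp
    _ = 2 ^ (p - 1) * (∫⁻ L : Gr n m, plateMax (dyadicRad (j + 1)) G L ^ p ∂gamma n m +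
          ∫⁻ L : Gr n m, plateMax (dyadicRad j) G L ^ p ∂gamma n m) := by
        rw [lintegral_const_mul' _ _ h_two, lintegral_add_left (h_meas.pow_const p)]
    _ ≤ _ := mul_le_mul_right (add_le_add h_fine h_coarse) _
    _ = _ := by ring

theorem exists_lintegral_sum_scaleTerm_rpow_le (hA : PlateBound n m p α A) (hA_top : A ≠ ∞)
    (hp : 1 ≤ p) (hR : 0 ≤ R) : ∃ C : ℝ≥0∞, C ≠ ∞ ∧
      ∀ {Λ : ℝ} {f : E (n + 1) → ℝ}, BddSupported Λ R f → ∀ (θ : O (n + 1)) (J : ℕ),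
      ∫⁻ L : Gr n m, (∑ j ∈ Finset.range J, scaleTerm f θ j L) ^ p ∂gamma n m ≤
        (∑ j ∈ Finset.range J, scaleWeight p α j) ^ (p - 1) *
          ∑ j ∈ Finset.range J, scaleWeight p α j ^ (1 - p) *
            (C * ENNReal.ofReal (dyadicRad (j + 1) ^ (-α))) *
              ∫⁻ y, ‖xrayDiff (dyadicRad (j + 1)) f (θ, y)‖ₑ ^ p := by
  obtain ⟨C, hC, h_scale⟩ := hA.exists_lintegral_scaleTerm_rpow_le hA_top hp hR
  refine ⟨C, hC, fun {Λ f} hf θ J => ?_⟩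
  set W := ∑ j ∈ Finset.range J, scaleWeight p α j
  have hW : W ^ (p - 1) ≠ ∞ := ENNReal.rpow_ne_top_of_nonneg (sub_nonneg.2 hp)
    (ENNReal.sum_ne_top.2 fun j _ => scaleWeight_ne_top p α j)
  calc ∫⁻ L : Gr n m, (∑ j ∈ Finset.range J, scaleTerm f θ j L) ^ p ∂gamma n m
      ≤ ∫⁻ L : Gr n m, W ^ (p - 1) * ∑ j ∈ Finset.range J,
          scaleWeight p α j ^ (1 - p) * scaleTerm f θ j L ^ p ∂gamma n m :=
        lintegral_mono fun L => rpow_sum_le_rpow_sum_mul_sum _ hp (scaleWeight_ne_zero p α)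
          (scaleWeight_ne_top p α) _
    _ = W ^ (p - 1) * ∑ j ∈ Finset.range J, scaleWeight p α j ^ (1 - p) *
          ∫⁻ L : Gr n m, scaleTerm f θ j L ^ p ∂gamma n m := by
        rw [lintegral_const_mul' _ _ hW, lintegral_finsetSum _ fun j _ =>
          ((measurable_scaleTerm f θ j).pow_const p).const_mul _]
        simp_rw [lintegral_const_mul' _ _ (scaleWeight_rpow_one_sub_ne_top p α _)]
    _ ≤ _ := by
        simp_rw [mul_assoc (scaleWeight p α _ ^ (1 - p))]
        exact mul_le_mul_right
          (Finset.sum_le_sum fun j _ => mul_le_mul_right (h_scale hf θ j) _) _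

theorem exists_lintegral_lintegral_sum_scaleTerm_rpow_le (hA : PlateBound n m p α A)
    (hA_top : A ≠ ∞) (hp : 2 ≤ p) (hR : 0 ≤ R) : ∃ C : ℝ≥0∞, C ≠ ∞ ∧
      ∀ {Λ : ℝ} {f : E (n + 1) → ℝ}, BddSupported Λ R f → ∀ J : ℕ,
      ∫⁻ θ, (∫⁻ L : Gr n m, (∑ j ∈ Finset.range J, scaleTerm f θ j L) ^ p ∂gamma n m)
          ∂haarO (n + 1) ≤
        C * (∑ j ∈ Finset.range J, scaleWeight p α j) ^ p * ∫⁻ x, ‖f x‖ₑ ^ p := by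
  have hp_one : 1 ≤ p := by linarith
  obtain ⟨C₁, hC₁, h_sum⟩ := hA.exists_lintegral_sum_scaleTerm_rpow_le hA_top hp_one hR
  obtain ⟨C₂, hC₂, h_xray⟩ := exists_lintegral_xrayDiff_rpow_le n hR hp
  refine ⟨C₁ * C₂, ENNReal.mul_ne_top hC₁ hC₂, fun {Λ f} hf J => ?_⟩
  set w := scaleWeight p α
  set W := ∑ j ∈ Finset.range J, w j
  have hW : W ≠ ∞ := ENNReal.sum_ne_top.2 fun j _ => scaleWeight_ne_top p α j
  have hW_rpow : W ^ (p - 1) ≠ ∞ := ENNReal.rpow_ne_top_of_nonneg (sub_nonneg.2 hp_one) hW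
  have h_meas (j : ℕ) := (hf.measurable_xrayDiff (dyadicRad_pos (j + 1))
    (dyadicRad_lt_one _)).enorm.pow_const p
  calc _ ≤ _ := lintegral_mono fun θ => h_sum hf θ J
    _ = W ^ (p - 1) * ∑ j ∈ Finset.range J, w j ^ (1 - p) *
          (C₁ * ENNReal.ofReal (dyadicRad (j + 1) ^ (-α))) *
            ∫⁻ q, ‖xrayDiff (dyadicRad (j + 1)) f q‖ₑ ^ p ∂((haarO (n + 1)).prod volume) := by
        rw [lintegral_const_mul' _ _ hW_rpow, lintegral_finsetSum _ fun j _ =>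
          ((h_meas j).lintegral_prod_right').const_mul _]
        congr! 2 with j
        rw [lintegral_const_mul' _ _ (by finiteness [scaleWeight_rpow_one_sub_ne_top p α j]),
          lintegral_prod _ (h_meas j).aemeasurable]
    _ ≤ W ^ (p - 1) * ∑ j ∈ Finset.range J, w j ^ (1 - p) *
          (C₁ * ENNReal.ofReal (dyadicRad (j + 1) ^ (-α))) *
            (C₂ * ENNReal.ofReal (dyadicRad (j + 1)) * ∫⁻ x, ‖f x‖ₑ ^ p) := by
        gcongr with j
        exact h_xray hf (dyadicRad_pos _) (dyadicRad_lt_one _)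
    _ = W ^ (p - 1) * ∑ j ∈ Finset.range J, w j ^ (1 - p) * w j ^ p *
          (C₁ * C₂ * ∫⁻ x, ‖f x‖ₑ ^ p) := by
        congr! 2 with j
        rw [scaleWeight_rpow (by linarith)]
        ring
    _ = W ^ (p - 1) * W ^ (1 : ℝ) * (C₁ * C₂ * ∫⁻ x, ‖f x‖ₑ ^ p) := by
        simp_rw [w, scaleWeight_rpow_one_sub_mul_rpow]
        rw [← Finset.sum_mul, ENNReal.rpow_one, mul_assoc (W ^ (p - 1))]
    _ = _ := by
        rw [← ENNReal.rpow_add_of_nonneg _ _ (by linarith) zero_le_one, sub_add_cancel]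
        ring

end PlateBound

end KeyEstimate

section BallAverageBound

variable {d k n m : ℕ} {R p α : ℝ} {A : ℝ≥0∞}

theorem PlateBound.exists_lintegral_planeMax_rpow_le_of_bddSupported [Nonempty (Gr n m)]
    (hA : PlateBound n m p α A) (hA_top : A ≠ ∞) (hp : 2 ≤ p) (hR : 0 ≤ R) :
    ∃ C : ℝ≥0∞, C ≠ ∞ ∧
      ∀ {Λ : ℝ} {f : E (n + 1) → ℝ}, BddSupported Λ R f → (∀ x, 0 ≤ f x) → ∀ J : ℕ,
      ∫⁻ M : Gr (n + 1) (m + 1),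
          planeMax (lballAvg (dyadicRad J) (lballAvg (dyadicRad J) fun x => ‖f x‖ₑ)) M ^ p
          ∂gamma (n + 1) (m + 1) ≤
        C * (1 + (∑ j ∈ Finset.range J, scaleWeight p α j) ^ p) * ∫⁻ x, ‖f x‖ₑ ^ p := by
  have hp_one : 1 ≤ p := by linarith
  have hp_nonneg : 0 ≤ p := by linarith
  obtain ⟨C₁, hC₁, h_telescope⟩ := exists_planeMax_lballAvg_le_add_sum_scaleTerm n m hR
  obtain ⟨C₂, hC₂, h_high⟩ := hA.exists_lintegral_lintegral_sum_scaleTerm_rpow_le hA_top hp hR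
  obtain ⟨C₃, hC₃, h_low⟩ := exists_planeMax_lballAvg_lballAvg_rpow_le (n + 1) (m + 1) R hp_one
    (dyadicRad_pos 0)
  have h_two : (2 : ℝ≥0∞) ^ (p - 1) ≠ ∞ :=
    ENNReal.rpow_ne_top_of_nonneg (by linarith) ENNReal.ofNat_ne_top
  have hC₁_rpow : C₁ ^ p ≠ ∞ := ENNReal.rpow_ne_top_of_nonneg hp_nonneg hC₁
  refine ⟨2 ^ (p - 1) * (C₃ + C₁ ^ p * C₂), by finiteness, fun {Λ f} hf h_nonneg J => ?_⟩
  set N := ∫⁻ x, ‖f x‖ₑ ^ p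
  set W := ∑ j ∈ Finset.range J, scaleWeight p α j
  have h_pointwise (θ : O (n + 1)) (L : Gr n m) :
      planeMax (lballAvg (dyadicRad J) (lballAvg (dyadicRad J) fun x => ‖f x‖ₑ))
          (rotate θ L.cons) ^ p ≤
        2 ^ (p - 1) * (C₃ * N) +
          2 ^ (p - 1) * C₁ ^ p * (∑ j ∈ Finset.range J, scaleTerm f θ j L) ^ p := by
    refine (ENNReal.rpow_le_rpow (h_telescope hf h_nonneg θ L J) hp_nonneg).trans ?_
    refine (ENNReal.rpow_add_le_mul_rpow_add_rpow _ _ hp_one).trans ?_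
    rw [mul_add, ENNReal.mul_rpow_of_nonneg _ _ hp_nonneg, mul_assoc]
    refine add_le_add_left (mul_le_mul_right (h_low hf.meas.enorm (fun x hx => ?_) _) _) _
    rw [hf.supp x hx, enorm_zero]
  calc _ = ∫⁻ θ, ∫⁻ L : Gr n m, planeMax (lballAvg (dyadicRad J) (lballAvg (dyadicRad J)
          fun x => ‖f x‖ₑ)) (rotate θ L.cons) ^ p ∂gamma n m ∂haarO (n + 1) :=
        lintegral_gamma_succ ((lowerSemicontinuous_planeMax
          (lowerSemicontinuous_lballAvg (dyadicRad_pos J))).measurable.pow_const p)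
    _ ≤ _ := lintegral_mono fun θ => lintegral_mono fun L => h_pointwise θ L
    _ = 2 ^ (p - 1) * (C₃ * N) + 2 ^ (p - 1) * C₁ ^ p *
          ∫⁻ θ, (∫⁻ L : Gr n m, (∑ j ∈ Finset.range J, scaleTerm f θ j L) ^ p ∂gamma n m)
            ∂haarO (n + 1) := by
        simp_rw [lintegral_add_left measurable_const, lintegral_const, measure_univ, mul_one,
          lintegral_const_mul' _ _ (ENNReal.mul_ne_top h_two hC₁_rpow)]
    _ ≤ 2 ^ (p - 1) * (C₃ * N) + 2 ^ (p - 1) * C₁ ^ p * (C₂ * W ^ p * N) :=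
        add_le_add_right (mul_le_mul_right (h_high hf J) _) _
    _ ≤ 2 ^ (p - 1) * (C₃ * N) + 2 ^ (p - 1) * C₁ ^ p * (C₂ * W ^ p * N) +
          (2 ^ (p - 1) * (C₃ * W ^ p * N) + 2 ^ (p - 1) * C₁ ^ p * (C₂ * N)) := le_self_add
    _ = _ := by ring

theorem bddSupported_toReal_min {F : E d → ℝ≥0∞} (hF : Measurable F)
    (h_supp : ∀ x, R ≤ ‖x‖ → F x = 0) (i : ℕ) :
    BddSupported (i : ℝ) R fun x => (min (F x) i).toReal where
  meas := (hF.min measurable_const).ennreal_toReal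
  bound x := by
    rw [abs_of_nonneg ENNReal.toReal_nonneg]
    exact (ENNReal.toReal_mono (ENNReal.natCast_ne_top i) (min_le_right _ _)).trans_eq
      (ENNReal.toReal_natCast i)
  supp x hx := by rw [h_supp x hx, zero_min, ENNReal.toReal_zero]

theorem iSup_rpow {ι : Sort*} (hp : 0 < p) (u : ι → ℝ≥0∞) : (⨆ i, u i) ^ p = ⨆ i, u i ^ p :=
  (ENNReal.orderIsoRpow p hp).map_iSup u

theorem lintegral_planeMax_lballAvg_iSup_rpow {r : ℝ} (hr : 0 < r) (hp : 0 < p)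
    {F : ℕ → E d → ℝ≥0∞} (hF : ∀ i, Measurable (F i)) (h_mono : Monotone F)
    (ν : Measure (Gr d k)) :
    ∫⁻ L, planeMax (lballAvg r (lballAvg r fun x => ⨆ i, F i x)) L ^ p ∂ν =
      ⨆ i, ∫⁻ L, planeMax (lballAvg r (lballAvg r (F i))) L ^ p ∂ν := by
  have h_avg_mono : Monotone fun i => lballAvg r (F i) := fun i j hij =>
    lballAvg_mono r (h_mono hij)
  have h_avg_avg_mono : Monotone fun i => lballAvg r (lballAvg r (F i)) := fun i j hij =>
    lballAvg_mono r (h_avg_mono hij)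
  have h_avg : lballAvg r (lballAvg r fun x => ⨆ i, F i x) =
      fun x => ⨆ i, lballAvg r (lballAvg r (F i)) x := by
    funext x
    rw [funext (iSup_lballAvg r hF h_mono),
      iSup_lballAvg r (fun _ => measurable_lballAvg hr) h_avg_mono]
  simp_rw [h_avg, iSup_planeMax (fun _ => measurable_lballAvg hr) h_avg_avg_mono, iSup_rpow hp]
  exact lintegral_iSup
    (fun i => (lowerSemicontinuous_planeMax (lowerSemicontinuous_lballAvg hr)).measurable.pow_const
      p)
    fun i j hij L => ENNReal.rpow_le_rpow (planeMax_mono (h_avg_avg_mono hij) L) hp.le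

theorem PlateBound.exists_lintegral_planeMax_lballAvg_rpow_le [Nonempty (Gr n m)]
    (hA : PlateBound n m p α A) (hA_top : A ≠ ∞) (hp : 2 ≤ p) (hR : 0 ≤ R) :
    ∃ C : ℝ≥0∞, C ≠ ∞ ∧
      ∀ {F : E (n + 1) → ℝ≥0∞}, Measurable F → (∀ x, R ≤ ‖x‖ → F x = 0) → ∀ J : ℕ,
      ∫⁻ M : Gr (n + 1) (m + 1), planeMax (lballAvg (dyadicRad J) (lballAvg (dyadicRad J) F)) M ^ p
          ∂gamma (n + 1) (m + 1) ≤
        C * (1 + ∑ j ∈ Finset.range J, scaleWeight p α j) ^ p * ∫⁻ x, F x ^ p := by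
  have hp_pos : 0 < p := by linarith
  obtain ⟨C, hC, h_bdd⟩ := hA.exists_lintegral_planeMax_rpow_le_of_bddSupported hA_top hp hR
  refine ⟨C, hC, fun {F} hF h_supp J => ?_⟩
  have h_iSup (x : E (n + 1)) : ⨆ i : ℕ, min (F x) i = F x := by
    rw [← inf_iSup_eq, ENNReal.iSup_natCast, inf_top_eq]
  have h_enorm (i : ℕ) (x : E (n + 1)) : ‖(min (F x) i).toReal‖ₑ = min (F x) i := by
    rw [Real.enorm_eq_ofReal ENNReal.toReal_nonneg, ENNReal.ofReal_toReal]
    exact ne_top_of_le_ne_top (ENNReal.natCast_ne_top i) (min_le_right _ _)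
  have h_add_rpow (W : ℝ≥0∞) : 1 + W ^ p ≤ (1 + W) ^ p := by
    simpa only [ENNReal.one_rpow] using
      ENNReal.add_rpow_le_rpow_add 1 W (show 1 ≤ p from one_le_two.trans hp)
  have h_monotone := lintegral_planeMax_lballAvg_iSup_rpow (dyadicRad_pos J) hp_pos
    (F := fun i x => min (F x) i) (fun i => hF.min measurable_const)
    (fun i j hij x => min_le_min_left _ (Nat.cast_le.2 hij)) (gamma (n + 1) (m + 1))
  simp_rw [h_iSup] at h_monotone
  refine h_monotone.trans_le (iSup_le fun i => ?_)
  have h_trunc := h_bdd (bddSupported_toReal_min hF h_supp i) (fun _ => ENNReal.toReal_nonneg) J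
  simp_rw [h_enorm] at h_trunc
  refine h_trunc.trans (mul_le_mul' (mul_le_mul_right (h_add_rpow _) _)
    (lintegral_mono fun x => ?_))
  exact ENNReal.rpow_le_rpow (min_le_left _ _) hp_pos.le

end BallAverageBound

section PlateAverage

variable {d k : ℕ}

theorem setLIntegral_half_ball_le_lballAvg_lballAvg {r : ℝ} (hr : 0 < r) (F : E d → ℝ≥0∞)
    (x : E d) : ∫⁻ u in Metric.ball x (r / 2), F u ≤
      2 ^ d * volume (Metric.ball (0 : E d) r) * lballAvg r (lballAvg r F) x := by
  set V := volume (Metric.ball (0 : E d) r) with hV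
  have hV0 : V ≠ 0 := (Metric.measure_ball_pos _ _ hr).ne'
  have hV_top : V ≠ ∞ := measure_ball_lt_top.ne
  set B := Metric.ball x (r / 2)
  set I := ∫⁻ u in B, F u
  have h_half : 2 ^ d * volume B = V := by
    rw [hV, volume_ball_eq_mul _ hr, volume_ball_eq_mul _ (half_pos hr), ← mul_assoc, ← mul_pow,
      ENNReal.ofReal_div_of_pos two_pos, ENNReal.ofReal_ofNat,
      ENNReal.mul_div_cancel two_ne_zero (by finiteness)]
  have h_inner : ∀ u ∈ B, V⁻¹ * I ≤ lballAvg r F u := by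
    intro u hu
    rw [lballAvg_eq]
    refine mul_le_mul_right (lintegral_mono_set (Metric.ball_subset_ball' ?_)) _
    rw [dist_comm]
    linarith [Metric.mem_ball.1 hu]
  have h_outer : V⁻¹ * (V⁻¹ * I * volume B) ≤ lballAvg r (lballAvg r F) x := by
    rw [lballAvg_eq r (lballAvg r F), ← setLIntegral_const]
    exact mul_le_mul_right ((setLIntegral_mono' Metric.isOpen_ball.measurableSet h_inner).trans
      (lintegral_mono_set (Metric.ball_subset_ball (by linarith)))) _
  calc I = (V * V⁻¹) * (V * V⁻¹) * I := by simp [ENNReal.mul_inv_cancel hV0 hV_top]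
    _ = V * (V⁻¹ * (V⁻¹ * I * V)) := by ring
    _ = V * (V⁻¹ * (V⁻¹ * I * (2 ^ d * volume B))) := by rw [h_half]
    _ = 2 ^ d * V * (V⁻¹ * (V⁻¹ * I * volume B)) := by ring
    _ ≤ 2 ^ d * V * lballAvg r (lballAvg r F) x := mul_le_mul_right h_outer _

theorem le_volume_setOf_norm_sub_lt_of_mem_plate {U : E k →ₗᵢ[ℝ] E d} {L : Gr d k}
    (hU : U.toLinearMap.range = L.1) {δ s : ℝ} (hδ : 0 < δ) (hs : 2 * δ ≤ s) {a u : E d}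
    (hu : u ∈ plate δ L a) :
    ENNReal.ofReal δ ^ k * unitBallVolume k ≤ volume {v : E k | ‖u - a - U v‖ < s} := by
  obtain ⟨v₀, -, hv₀⟩ := (mem_plate_iff_of_range_eq hU).1 hu
  rw [← volume_ball_eq_mul v₀ hδ]
  refine measure_mono fun v hv => ?_
  rw [mem_ball_iff_norm, ← U.norm_map, map_sub] at hv
  calc ‖u - a - U v‖ = ‖(u - a - U v₀) - (U v - U v₀)‖ := by congr 1; abel
    _ ≤ ‖u - a - U v₀‖ + ‖U v - U v₀‖ := norm_sub_le _ _
    _ < s := by linarith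

theorem mul_setLIntegral_plate_le_mul_planeMax {δ r : ℝ} (hδ : 0 < δ) (hr : 4 * δ ≤ r)
    {F : E d → ℝ≥0∞} (hF : Measurable F) (L : Gr d k) (a : E d) :
    ENNReal.ofReal δ ^ k * unitBallVolume k * ∫⁻ u in plate δ L a, F u ≤
      2 ^ d * volume (Metric.ball (0 : E d) r) * planeMax (lballAvg r (lballAvg r F)) L := by
  have hr_pos : 0 < r := by linarith
  obtain ⟨U, hU⟩ := exists_linearIsometry_range_eq L
  calc ENNReal.ofReal δ ^ k * unitBallVolume k * ∫⁻ u in plate δ L a, F u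
      = ∫⁻ u in plate δ L a, F u * (ENNReal.ofReal δ ^ k * unitBallVolume k) := by
        rw [lintegral_mul_const _ hF, mul_comm]
    _ ≤ ∫⁻ u in plate δ L a, F u * volume {v : E k | ‖u - a - U v‖ < r / 2} :=
        setLIntegral_mono' isOpen_plate.measurableSet fun u hu => mul_le_mul_right
          (le_volume_setOf_norm_sub_lt_of_mem_plate hU hδ (by linarith) hu) _
    _ ≤ ∫⁻ u, F u * volume {v : E k | ‖u - a - U v‖ < r / 2} := setLIntegral_le_lintegral _ _
    _ = ∫⁻ v : E k, ∫⁻ w in Metric.ball (0 : E d) (r / 2), F (a + U v + w) :=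
        (lintegral_lintegral_ball U a _ hF).symm
    _ ≤ ∫⁻ v : E k, 2 ^ d * volume (Metric.ball (0 : E d) r) *
          lballAvg r (lballAvg r F) (a + U v) := lintegral_mono fun v =>
        (setLIntegral_ball_zero_comp_add _ F _).trans_le
          (setLIntegral_half_ball_le_lballAvg_lballAvg hr_pos F _)
    _ = 2 ^ d * volume (Metric.ball (0 : E d) r) *
          ∫⁻ v : E k, lballAvg r (lballAvg r F) (a + U v) :=
        lintegral_const_mul' _ _ (ENNReal.mul_ne_top (by simp) measure_ball_lt_top.ne)
    _ ≤ 2 ^ d * volume (Metric.ball (0 : E d) r) * planeMax (lballAvg r (lballAvg r F)) L := by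
        rw [planeMax_eq_iSup hU]
        exact mul_le_mul_right (le_iSup (fun x => ∫⁻ v, lballAvg r (lballAvg r F) (x + U v)) a) _

theorem exists_volume_ball_le_volume_plate (d k : ℕ) : ∃ C : ℝ≥0∞, C ≠ ∞ ∧ ∀ {δ r : ℝ}, 0 < δ →
    r ≤ 8 * δ → ∀ (L : Gr d k) (a : E d), volume (Metric.ball (0 : E d) r) ≤
      C * ENNReal.ofReal δ ^ k * volume (plate δ L a) := by
  obtain ⟨C, hC, h_plate⟩ := exists_le_volume_plate d k
  have hU := unitBallVolume_ne_top d
  refine ⟨8 ^ d * unitBallVolume d * C, by finiteness, fun {δ r} hδ hr L a => ?_⟩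
  calc volume (Metric.ball (0 : E d) r) ≤ volume (Metric.ball (0 : E d) (8 * δ)) :=
        measure_mono (Metric.ball_subset_ball hr)
    _ = 8 ^ d * unitBallVolume d * ENNReal.ofReal δ ^ d := by
        rw [volume_ball_eq_mul _ (by positivity), ENNReal.ofReal_mul (by norm_num), mul_pow,
          ENNReal.ofReal_ofNat]
        ring
    _ ≤ 8 ^ d * unitBallVolume d * (C * ENNReal.ofReal δ ^ k * volume (plate δ L a)) :=
        mul_le_mul_right (h_plate δ hδ L a) _
    _ = 8 ^ d * unitBallVolume d * C * ENNReal.ofReal δ ^ k * volume (plate δ L a) := by ring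

theorem exists_plateMax_le_planeMax_lballAvg (d k : ℕ) : ∃ C : ℝ≥0∞, C ≠ ∞ ∧ ∀ {δ r : ℝ}, 0 < δ →
    4 * δ ≤ r → r ≤ 8 * δ → ∀ {F : E d → ℝ≥0∞}, Measurable F → ∀ L : Gr d k,
      plateMax δ F L ≤ C * planeMax (lballAvg r (lballAvg r F)) L := by
  obtain ⟨C, hC, h_ball⟩ := exists_volume_ball_le_volume_plate d k
  have hU0 := unitBallVolume_ne_zero k
  have hU_top := unitBallVolume_ne_top k
  refine ⟨(unitBallVolume k)⁻¹ * (2 ^ d * C),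
    ENNReal.mul_ne_top (ENNReal.inv_ne_top.2 hU0) (by finiteness),
    fun {δ r} hδ hr hr' {F} hF L => iSup_le fun a => ?_⟩
  set S := planeMax (lballAvg r (lballAvg r F)) L
  set P := volume (plate δ L a)
  set I := ∫⁻ u in plate δ L a, F u
  set e := ENNReal.ofReal δ ^ k
  have hP0 : P ≠ 0 := (volume_plate_pos hδ L a).ne'
  have hP_top : P ≠ ∞ := ((measure_mono plate_subset_ball).trans_lt measure_ball_lt_top).ne
  have h_mul : e * (unitBallVolume k * I) ≤ e * (P * (2 ^ d * C * S)) :=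
    calc e * (unitBallVolume k * I) = e * unitBallVolume k * I := by ring
      _ ≤ 2 ^ d * volume (Metric.ball (0 : E d) r) * S :=
          mul_setLIntegral_plate_le_mul_planeMax hδ hr hF L a
      _ ≤ 2 ^ d * (C * e * P) * S := by
          gcongr
          exact h_ball hδ hr' L a
      _ = e * (P * (2 ^ d * C * S)) := by ring
  have h_cancel : unitBallVolume k * I ≤ P * (2 ^ d * C * S) :=
    (ENNReal.mul_le_mul_iff_right (ofReal_pow_ne_zero hδ k) (ofReal_pow_ne_top δ k)).1 h_mul
  rw [ENNReal.inv_mul_le_iff hP0 hP_top, mul_assoc, mul_left_comm P,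
    ← ENNReal.inv_mul_le_iff (ENNReal.inv_ne_zero.2 hU_top) (ENNReal.inv_ne_top.2 hU0), inv_inv]
  exact h_cancel

theorem plateMax_le_inv_volume_mul_lintegral {δ₀ δ : ℝ} (hδ : δ₀ ≤ δ) (F : E d → ℝ≥0∞)
    (L : Gr d k) : plateMax δ F L ≤ (volume (Metric.ball (0 : E d) δ₀))⁻¹ * ∫⁻ x, F x := by
  refine iSup_le fun a => mul_le_mul' (ENNReal.inv_le_inv.2 ?_) (setLIntegral_le_lintegral _ _)
  rw [← Measure.addHaar_ball_center volume a δ₀]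
  exact measure_mono ((Metric.ball_subset_ball hδ).trans ball_subset_plate)

theorem exists_plateMax_rpow_le (d k : ℕ) (R : ℝ) {p : ℝ} (hp : 1 ≤ p) {δ₀ : ℝ} (hδ₀ : 0 < δ₀) :
    ∃ C : ℝ≥0∞, C ≠ ∞ ∧ ∀ {δ : ℝ}, δ₀ ≤ δ → ∀ {F : E d → ℝ≥0∞}, Measurable F →
      (∀ x, R ≤ ‖x‖ → F x = 0) → ∀ L : Gr d k, plateMax δ F L ^ p ≤ C * ∫⁻ x, F x ^ p := by
  have hp_nonneg : 0 ≤ p := zero_le_one.trans hp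
  set V := volume (Metric.ball (0 : E d) δ₀)
  have hV : V⁻¹ ≠ ∞ := ENNReal.inv_ne_top.2 (Metric.measure_ball_pos _ _ hδ₀).ne'
  refine ⟨V⁻¹ ^ p * volume (Metric.ball (0 : E d) R) ^ (p - 1),
    ENNReal.mul_ne_top (ENNReal.rpow_ne_top_of_nonneg hp_nonneg hV)
      (ENNReal.rpow_ne_top_of_nonneg (sub_nonneg.2 hp) measure_ball_lt_top.ne),
    fun {δ} hδ {F} hF hs L => ?_⟩
  calc plateMax δ F L ^ p ≤ (V⁻¹ * ∫⁻ x, F x) ^ p :=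
        ENNReal.rpow_le_rpow (plateMax_le_inv_volume_mul_lintegral hδ F L) hp_nonneg
    _ = V⁻¹ ^ p * (∫⁻ x, F x) ^ p := ENNReal.mul_rpow_of_nonneg _ _ hp_nonneg
    _ ≤ V⁻¹ ^ p * (volume (Metric.ball (0 : E d) R) ^ (p - 1) * ∫⁻ x, F x ^ p) :=
        mul_le_mul_right (lintegral_rpow_le_volume_ball_rpow_mul hp hF hs) _
    _ = V⁻¹ ^ p * volume (Metric.ball (0 : E d) R) ^ (p - 1) * ∫⁻ x, F x ^ p :=
        (mul_assoc _ _ _).symm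

end PlateAverage

section ScaleWeightSum

variable {p α : ℝ}

theorem exists_dyadicRad_mem_Icc {δ : ℝ} (hδ : 0 < δ) (hδ' : δ < 1 / 8) :
    ∃ J, 4 * δ ≤ dyadicRad J ∧ dyadicRad J ≤ 8 * δ := by
  obtain ⟨J, h_lt, h_le⟩ := exists_nat_pow_near_of_lt_one (show 0 < 8 * δ by linarith)
    (show 8 * δ ≤ 1 by linarith) (show (0 : ℝ) < 1 / 2 by norm_num) (by norm_num)
  refine ⟨J, ?_, h_lt.le⟩
  rw [dyadicRad, pow_succ]
  linarith

theorem sum_dyadicRad_rpow_neg_le {s : ℝ} (hs : 0 < s) (J : ℕ) :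
    ∑ j ∈ Finset.range J, dyadicRad (j + 1) ^ (-s) ≤ 2 ^ s / (2 ^ s - 1) * dyadicRad J ^ (-s) := by
  set b : ℝ := 2 ^ s with hb
  have hb_pos : 0 < b - 1 := sub_pos.2 (Real.one_lt_rpow one_lt_two hs)
  have h_succ : ∀ j, dyadicRad (j + 1) ^ (-s) = b * dyadicRad j ^ (-s) := fun j => by
    rw [← two_mul_dyadicRad_succ j, Real.mul_rpow zero_le_two (dyadicRad_pos _).le, hb, ← mul_assoc,
      ← Real.rpow_add two_pos, add_neg_cancel, Real.rpow_zero, one_mul]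
  induction J with
  | zero =>
    have := dyadicRad_pos 0
    rw [Finset.sum_range_zero]
    positivity
  | succ J ih =>
    rw [Finset.sum_range_succ]
    refine (add_le_add_left ih _).trans_eq ?_
    rw [h_succ J]
    field_simp
    ring

theorem exists_sum_scaleWeight_le_of_one_lt (hp : 0 < p) (hα : 1 < α) :
    ∃ K : ℝ≥0∞, K ≠ ∞ ∧ ∀ {δ : ℝ}, 0 < δ → ∀ {J}, δ ≤ dyadicRad J →
      ∑ j ∈ Finset.range J, scaleWeight p α j ≤ K * ENNReal.ofReal (δ ^ (-(α - 1) / p)) := by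
  have hs : 0 < (α - 1) / p := div_pos (sub_pos.2 hα) hp
  have hb : (0 : ℝ) < 2 ^ ((α - 1) / p) - 1 := sub_pos.2 (Real.one_lt_rpow one_lt_two hs)
  refine ⟨ENNReal.ofReal (2 ^ ((α - 1) / p) / (2 ^ ((α - 1) / p) - 1)), ENNReal.ofReal_ne_top,
    fun {δ} hδ {J} hJ => ?_⟩
  simp only [scaleWeight, neg_div]
  rw [← ENNReal.ofReal_sum_of_nonneg fun j _ => Real.rpow_nonneg (dyadicRad_pos _).le _,
    ← ENNReal.ofReal_mul (by positivity)]
  refine ENNReal.ofReal_le_ofReal ((sum_dyadicRad_rpow_neg_le hs J).trans ?_)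
  exact mul_le_mul_of_nonneg_left
    (Real.rpow_le_rpow_of_nonpos hδ hJ (neg_nonpos.2 hs.le)) (by positivity)

theorem sum_scaleWeight_one_le_log {δ : ℝ} (hδ : 0 < δ) {J : ℕ} (hJ : δ ≤ dyadicRad J) :
    ∑ j ∈ Finset.range J, scaleWeight p 1 j ≤ 2 * ENNReal.ofReal (Real.log (1 / δ)) := by
  have h_weight : ∀ j, scaleWeight p 1 j = 1 := fun j => by simp [scaleWeight]
  have h_log : (J + 1) * Real.log 2 ≤ Real.log (1 / δ) := by
    rw [one_div, Real.log_inv, le_neg]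
    calc Real.log δ ≤ Real.log (dyadicRad J) := Real.log_le_log hδ hJ
      _ = -((J + 1) * Real.log 2) := by
        rw [dyadicRad, Real.log_pow, one_div, Real.log_inv]
        push_cast
        ring
  simp only [h_weight, Finset.sum_const, Finset.card_range, nsmul_eq_mul, mul_one]
  rw [← ENNReal.ofReal_ofNat 2, ← ENNReal.ofReal_mul zero_le_two, ← ENNReal.ofReal_natCast]
  refine ENNReal.ofReal_le_ofReal ?_
  nlinarith [Real.log_two_gt_d9, (J.cast_nonneg : (0 : ℝ) ≤ J)]

theorem exists_sum_scaleWeight_le_of_lt_one (hp : 0 < p) (hα : α < 1) :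
    ∃ K : ℝ≥0∞, K ≠ ∞ ∧ ∀ J, ∑ j ∈ Finset.range J, scaleWeight p α j ≤ K := by
  set s := -(α - 1) / p with hs
  have hs_pos : 0 < s := div_pos (by linarith) hp
  set q : ℝ := (1 / 2) ^ s with hq
  have hq_lt : q < 1 := Real.rpow_lt_one (by norm_num) (by norm_num) hs_pos
  refine ⟨(1 - ENNReal.ofReal q)⁻¹,
    ENNReal.inv_ne_top.2 (tsub_pos_of_lt (ENNReal.ofReal_lt_one.2 hq_lt)).ne', fun J => ?_⟩
  rw [← ENNReal.tsum_geometric]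
  refine le_trans (Finset.sum_le_sum fun j _ => ?_) (ENNReal.sum_le_tsum _)
  rw [scaleWeight, ← hs, ← ENNReal.ofReal_pow (by positivity), hq,
    ← Real.rpow_mul_natCast (by norm_num), mul_comm, Real.rpow_natCast_mul (by norm_num)]
  refine ENNReal.ofReal_le_ofReal (Real.rpow_le_rpow (dyadicRad_pos _).le ?_ hs_pos.le)
  exact pow_le_pow_of_le_one (by norm_num) (by norm_num) (by omega)

end ScaleWeightSum

section Localization

variable {d k : ℕ}

/-- The point of the lattice `ℤ^d ⊆ ℝ^d` with the given coordinates. -/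
noncomputable def latticePoint (m : Fin d → ℤ) : E d := WithLp.toLp 2 fun i => (m i : ℝ)

theorem exists_norm_sub_latticePoint_le (a : E d) : ∃ m, ‖a - latticePoint m‖ ≤ d := by
  refine ⟨fun i => round (a i), ?_⟩
  rw [EuclideanSpace.norm_eq, Real.sqrt_le_iff]
  refine ⟨Nat.cast_nonneg _, ?_⟩
  calc ∑ i, ‖(a - latticePoint fun i => round (a i)) i‖ ^ 2 ≤ ∑ _i : Fin d, (1 : ℝ) := by
        refine Finset.sum_le_sum fun i _ => pow_le_one₀ (norm_nonneg _) ?_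
        change |a i - (round (a i) : ℝ)| ≤ 1
        linarith [abs_sub_round (a i)]
    _ = d := by simp
    _ ≤ (d : ℝ) ^ 2 := by exact_mod_cast Nat.le_self_pow two_ne_zero d

/-- The restriction of `F` to the ball of radius `d + 2` about a lattice point, translated to the
origin. The radius is large enough for every plate to lie in one of these balls. -/
noncomputable def localize (F : E d → ℝ≥0∞) (m : Fin d → ℤ) (x : E d) : ℝ≥0∞ :=
  (Metric.ball (latticePoint m) (d + 2)).indicator F (x + latticePoint m)

theorem measurable_localize {F : E d → ℝ≥0∞} (hF : Measurable F) (m : Fin d → ℤ) :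
    Measurable (localize F m) :=
  (hF.indicator Metric.isOpen_ball.measurableSet).comp (measurable_add_const _)

theorem localize_eq_zero (F : E d → ℝ≥0∞) (m : Fin d → ℤ) (x : E d) (hx : (d : ℝ) + 2 ≤ ‖x‖) :
    localize F m x = 0 := by
  rw [localize, indicator_of_notMem]
  simpa using hx

theorem setLIntegral_plate_comp_add (δ : ℝ) (F : E d → ℝ≥0∞) (v : E d) (L : Gr d k) (a : E d) :
    ∫⁻ y in plate δ L a, F (y + v) = ∫⁻ y in plate δ L (a + v), F y := by
  have h_translate := (measurePreserving_add_right volume v).setLIntegral_comp_preimage_emb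
    (measurableEmbedding_addRight v) F (plate δ L (a + v))
  have h_preimage : (· + v) ⁻¹' plate δ L (a + v) = plate δ L a := by
    ext y
    rw [mem_preimage, mem_plate, mem_plate]
    simp only [add_sub_add_right_eq_sub]
  rwa [h_preimage] at h_translate

theorem plateMax_comp_add (δ : ℝ) (F : E d → ℝ≥0∞) (v : E d) (L : Gr d k) :
    plateMax δ (fun x => F (x + v)) L = plateMax δ F L :=
  (Equiv.addRight v).iSup_congr fun a => by
    rw [setLIntegral_plate_comp_add, Equiv.coe_addRight, volume_plate_eq_volume_plate δ L L a]

theorem plateMax_le_iSup_localize {δ : ℝ} (hδ : δ < 1) (F : E d → ℝ≥0∞) (L : Gr d k) :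
    plateMax δ F L ≤ ⨆ m, plateMax δ (localize F m) L := by
  refine iSup_le fun a => ?_
  obtain ⟨m, hm⟩ := exists_norm_sub_latticePoint_le a
  set B := Metric.ball (latticePoint m) ((d : ℝ) + 2)
  have h_plate : plate δ L a ⊆ B := plate_subset_ball.trans
    (Metric.ball_subset_ball' (by rw [dist_eq_norm]; linarith))
  calc (volume (plate δ L a))⁻¹ * ∫⁻ y in plate δ L a, F y
      = (volume (plate δ L a))⁻¹ * ∫⁻ y in plate δ L a, B.indicator F y := by
        congr 1
        exact setLIntegral_congr_fun isOpen_plate.measurableSet fun y hy =>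
          (indicator_of_mem (h_plate hy) F).symm
    _ ≤ plateMax δ (B.indicator F) L :=
        le_iSup (fun a => (volume (plate δ L a))⁻¹ * ∫⁻ y in plate δ L a, B.indicator F y) a
    _ = plateMax δ (localize F m) L := (plateMax_comp_add δ (B.indicator F) _ L).symm
    _ ≤ ⨆ m, plateMax δ (localize F m) L := le_iSup (fun m => plateMax δ (localize F m) L) m

theorem tsum_indicator_ball_latticePoint_le (x : E d) (c : ℝ≥0∞) :
    ∑' m, (Metric.ball (latticePoint m) ((d : ℝ) + 2)).indicator (fun _ => c) x ≤
      ((2 * d + 6) ^ d : ℕ) * c := by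
  set T : Finset (Fin d → ℤ) := Fintype.piFinset fun i =>
    Finset.Icc (⌊x i⌋ - (d + 2)) (⌊x i⌋ + (d + 3)) with hT
  have h_card : T.card = (2 * d + 6) ^ d := by
    rw [hT, Fintype.card_piFinset]
    simp only [Int.card_Icc]
    rw [Finset.prod_congr rfl (g := fun _ => 2 * d + 6) fun i _ => by omega]
    simp
  have h_mem : ∀ m, x ∈ Metric.ball (latticePoint m) ((d : ℝ) + 2) → m ∈ T := by
    intro m hx
    rw [hT, Fintype.mem_piFinset]
    intro i
    rw [mem_ball_iff_norm] at hx
    have h_coord : |x i - (m i : ℝ)| < d + 2 :=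
      (PiLp.norm_apply_le (x - latticePoint m) i).trans_lt hx
    obtain ⟨h_lower, h_upper⟩ := abs_lt.1 h_coord
    rw [Finset.mem_Icc, sub_le_iff_le_add, Int.floor_le_iff, ← sub_le_iff_le_add, Int.le_floor]
    push_cast
    constructor <;> linarith
  rw [tsum_eq_sum (s := T) fun m hm => indicator_of_notMem (fun hx => hm (h_mem m hx)) _]
  calc ∑ m ∈ T, (Metric.ball (latticePoint m) ((d : ℝ) + 2)).indicator (fun _ => c) x
      ≤ T.card • c :=
        Finset.sum_le_card_nsmul T _ c fun m _ => indicator_le_self' (fun _ _ => zero_le) x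
    _ = ((2 * d + 6) ^ d : ℕ) * c := by rw [h_card, nsmul_eq_mul]

theorem lintegral_localize_rpow (F : E d → ℝ≥0∞) {p : ℝ} (hp : 0 < p) (m : Fin d → ℤ) :
    ∫⁻ x, localize F m x ^ p =
      ∫⁻ x, (Metric.ball (latticePoint m) ((d : ℝ) + 2)).indicator (fun x => F x ^ p) x := by
  unfold localize
  rw [lintegral_add_right_eq_self (fun x => (Metric.ball _ _).indicator F x ^ p)]
  exact lintegral_congr fun x => (congrFun
    (indicator_comp_of_zero (g := fun t : ℝ≥0∞ => t ^ p) (ENNReal.zero_rpow_of_pos hp)) x).symm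

theorem tsum_lintegral_localize_rpow_le {F : E d → ℝ≥0∞} (hF : Measurable F) {p : ℝ} (hp : 0 < p) :
    ∑' m, ∫⁻ x, localize F m x ^ p ≤ ((2 * d + 6) ^ d : ℕ) * ∫⁻ x, F x ^ p := by
  simp_rw [lintegral_localize_rpow F hp]
  rw [← lintegral_tsum fun m =>
    ((hF.pow_const p).indicator Metric.isOpen_ball.measurableSet).aemeasurable,
    ← lintegral_const_mul _ (hF.pow_const p)]
  exact lintegral_mono fun x => tsum_indicator_ball_latticePoint_le x (F x ^ p)

end Localization

section PlateEstimate

variable {n m : ℕ} {p α : ℝ} {A : ℝ≥0∞}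

theorem PlateBound.exists_lintegral_plateMax_rpow_le_of_forall_eq_zero [Nonempty (Gr n m)]
    (hA : PlateBound n m p α A) (hA_top : A ≠ ∞) (hp : 2 ≤ p) {R : ℝ} (hR : 0 ≤ R) :
    ∃ C : ℝ≥0∞, C ≠ ∞ ∧ ∀ {δ : ℝ}, 0 < δ → ∀ {K : ℝ≥0∞},
      (∀ J, δ ≤ dyadicRad J → ∑ j ∈ Finset.range J, scaleWeight p α j ≤ K) →
      ∀ {F : E (n + 1) → ℝ≥0∞}, Measurable F → (∀ x, R ≤ ‖x‖ → F x = 0) →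
        ∫⁻ M : Gr (n + 1) (m + 1), plateMax δ F M ^ p ∂gamma (n + 1) (m + 1) ≤
          C * (1 + K) ^ p * ∫⁻ x, F x ^ p := by
  have hp_one : 1 ≤ p := one_le_two.trans hp
  have hp_pos : 0 < p := one_pos.trans_le hp_one
  have : Nonempty (Gr (n + 1) (m + 1)) := ‹Nonempty (Gr n m)›.map Gr.cons
  obtain ⟨C₁, hC₁, h_plate⟩ := exists_plateMax_le_planeMax_lballAvg (n + 1) (m + 1)
  obtain ⟨C₂, hC₂, h_plane⟩ := hA.exists_lintegral_planeMax_lballAvg_rpow_le hA_top hp hR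
  obtain ⟨C₃, hC₃, h_coarse⟩ := exists_plateMax_rpow_le (n + 1) (m + 1) R hp_one
    (show (0 : ℝ) < 1 / 8 by norm_num)
  have hC₁p : C₁ ^ p ≠ ∞ := ENNReal.rpow_ne_top_of_nonneg hp_pos.le hC₁
  refine ⟨C₁ ^ p * C₂ + C₃, by finiteness, fun {δ} hδ {K} hK {F} hF hs => ?_⟩
  rcases lt_or_ge δ (1 / 8) with h_small | h_large
  · obtain ⟨J, hJ, hJ'⟩ := exists_dyadicRad_mem_Icc hδ h_small
    calc ∫⁻ M : Gr (n + 1) (m + 1), plateMax δ F M ^ p ∂gamma (n + 1) (m + 1)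
        ≤ ∫⁻ M : Gr (n + 1) (m + 1), C₁ ^ p *
            planeMax (lballAvg (dyadicRad J) (lballAvg (dyadicRad J) F)) M ^ p
              ∂gamma (n + 1) (m + 1) := lintegral_mono fun M =>
          (ENNReal.rpow_le_rpow (h_plate hδ hJ hJ' hF M) hp_pos.le).trans_eq
            (ENNReal.mul_rpow_of_nonneg _ _ hp_pos.le)
      _ ≤ C₁ ^ p * (C₂ * (1 + ∑ j ∈ Finset.range J, scaleWeight p α j) ^ p * ∫⁻ x, F x ^ p) := by
          rw [lintegral_const_mul' _ _ hC₁p]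
          exact mul_le_mul_right (h_plane hF hs J) _
      _ ≤ C₁ ^ p * (C₂ * (1 + K) ^ p * ∫⁻ x, F x ^ p) := by
          gcongr
          exact hK J (by linarith)
      _ = C₁ ^ p * C₂ * (1 + K) ^ p * ∫⁻ x, F x ^ p := by ring
      _ ≤ (C₁ ^ p * C₂ + C₃) * (1 + K) ^ p * ∫⁻ x, F x ^ p := by gcongr; exact le_self_add
  · calc ∫⁻ M : Gr (n + 1) (m + 1), plateMax δ F M ^ p ∂gamma (n + 1) (m + 1)
        ≤ ∫⁻ _ : Gr (n + 1) (m + 1), (C₃ * ∫⁻ x, F x ^ p) ∂gamma (n + 1) (m + 1) :=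
          lintegral_mono fun M => h_coarse h_large hF hs M
      _ = C₃ * 1 ^ p * ∫⁻ x, F x ^ p := by
          rw [lintegral_const, measure_univ, mul_one, ENNReal.one_rpow, mul_one]
      _ ≤ (C₁ ^ p * C₂ + C₃) * (1 + K) ^ p * ∫⁻ x, F x ^ p := by
          gcongr
          exacts [le_add_self, le_self_add]

theorem PlateBound.exists_lintegral_plateMax_rpow_le [Nonempty (Gr n m)]
    (hA : PlateBound n m p α A) (hA_top : A ≠ ∞) (hp : 2 ≤ p) :
    ∃ C : ℝ≥0∞, C ≠ ∞ ∧ ∀ {δ : ℝ}, 0 < δ → δ < 1 → ∀ {K : ℝ≥0∞},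
      (∀ J, δ ≤ dyadicRad J → ∑ j ∈ Finset.range J, scaleWeight p α j ≤ K) →
      ∀ {F : E (n + 1) → ℝ≥0∞}, Measurable F →
        ∫⁻ M : Gr (n + 1) (m + 1), plateMax δ F M ^ p ∂gamma (n + 1) (m + 1) ≤
          C * (1 + K) ^ p * ∫⁻ x, F x ^ p := by
  have hp_pos : 0 < p := two_pos.trans_le hp
  obtain ⟨C, hC, h_local⟩ := hA.exists_lintegral_plateMax_rpow_le_of_forall_eq_zero hA_top hp
    (R := (n + 1 : ℕ) + 2) (by positivity)
  refine ⟨((2 * (n + 1) + 6) ^ (n + 1) : ℕ) * C, by finiteness, fun {δ} hδ hδ' {K} hK {F} hF => ?_⟩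
  calc ∫⁻ M : Gr (n + 1) (m + 1), plateMax δ F M ^ p ∂gamma (n + 1) (m + 1)
      ≤ ∫⁻ M : Gr (n + 1) (m + 1), ∑' i, plateMax δ (localize F i) M ^ p
          ∂gamma (n + 1) (m + 1) := by
        refine lintegral_mono fun M => ?_
        refine (ENNReal.rpow_le_rpow (plateMax_le_iSup_localize hδ' F M) hp_pos.le).trans ?_
        rw [iSup_rpow hp_pos]
        exact iSup_le fun i => ENNReal.le_tsum (f := fun i => plateMax δ (localize F i) M ^ p) i
    _ = ∑' i, ∫⁻ M : Gr (n + 1) (m + 1), plateMax δ (localize F i) M ^ p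
          ∂gamma (n + 1) (m + 1) :=
        lintegral_tsum fun i =>
          ((lowerSemicontinuous_plateMax hδ _).measurable.pow_const p).aemeasurable
    _ ≤ ∑' i, C * (1 + K) ^ p * ∫⁻ x, localize F i x ^ p :=
        ENNReal.tsum_le_tsum fun i =>
          h_local hδ hK (measurable_localize hF i) (localize_eq_zero F i)
    _ ≤ C * (1 + K) ^ p * (((2 * (n + 1) + 6) ^ (n + 1) : ℕ) * ∫⁻ x, F x ^ p) := by
        rw [ENNReal.tsum_mul_left]
        exact mul_le_mul_right (tsum_lintegral_localize_rpow_le hF hp_pos) _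
    _ = ((2 * (n + 1) + 6) ^ (n + 1) : ℕ) * C * (1 + K) ^ p * ∫⁻ x, F x ^ p := by ring

end PlateEstimate

section LowerSemicontinuousBound

variable {d k n m : ℕ} {p α : ℝ}

theorem le_lballAvg {r : ℝ} (hr : 0 < r) {G : E d → ℝ≥0∞} {c : ℝ≥0∞} {x : E d}
    (h : ∀ y, ‖y - x‖ < r → c ≤ G y) : c ≤ lballAvg r G x := by
  have := isProbabilityMeasure_uniformBall d hr
  calc c = ∫⁻ _, c ∂uniformBall d r := by rw [lintegral_const, measure_univ, mul_one]
    _ ≤ ∫⁻ z, G (x + z) ∂uniformBall d r := by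
      refine lintegral_mono_ae ?_
      filter_upwards [ae_uniformBall_norm_lt d r] with z hz
      exact h _ (by rwa [add_sub_cancel_left])

theorem tendsto_dyadicRad : Tendsto dyadicRad atTop (𝓝 0) :=
  (tendsto_pow_atTop_nhds_zero_of_lt_one (by norm_num) (by norm_num)).comp (tendsto_add_atTop_nat 1)

theorem le_liminf_lballAvg {G : E d → ℝ≥0∞} (hG : LowerSemicontinuous G) (x : E d) :
    G x ≤ liminf (fun J => lballAvg (dyadicRad J) (lballAvg (dyadicRad J) G) x) atTop := by
  refine le_of_forall_lt fun c hc => ?_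
  obtain ⟨c', hcc', hc'⟩ := exists_between hc
  refine hcc'.trans_le (le_liminf_of_le (by isBoundedDefault) ?_)
  obtain ⟨ε, hε, h_near⟩ := Metric.eventually_nhds_iff.1 (hG x c' hc')
  filter_upwards [tendsto_dyadicRad.eventually_lt_const (half_pos hε)] with J hJ
  refine le_lballAvg (dyadicRad_pos J) fun y hy =>
    le_lballAvg (dyadicRad_pos J) fun z hz => (h_near ?_).le
  rw [← dist_eq_norm] at hy hz
  linarith [dist_triangle z y x]

theorem planeMax_le_liminf {G : E d → ℝ≥0∞} (hG : LowerSemicontinuous G) (L : Gr d k) :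
    planeMax G L ≤
      liminf (fun J => planeMax (lballAvg (dyadicRad J) (lballAvg (dyadicRad J) G)) L) atTop := by
  set H : ℕ → E d → ℝ≥0∞ := fun J => lballAvg (dyadicRad J) (lballAvg (dyadicRad J) G)
  refine iSup_le fun x => ?_
  calc ∫⁻ y : L.1, G (x + (y : E d)) ∂leb L
      ≤ ∫⁻ y : L.1, liminf (fun J => H J (x + (y : E d))) atTop ∂leb L :=
        lintegral_mono fun y => le_liminf_lballAvg hG _
    _ ≤ liminf (fun J => ∫⁻ y : L.1, H J (x + (y : E d)) ∂leb L) atTop :=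
        lintegral_liminf_le fun J => (measurable_lballAvg (dyadicRad_pos J)).comp (by fun_prop)
    _ ≤ liminf (fun J => planeMax (H J) L) atTop := liminf_le_liminf (Eventually.of_forall fun J =>
        le_iSup (fun x : E d => ∫⁻ y : L.1, H J (x + (y : E d)) ∂leb L) x)

theorem PlateBound.exists_lintegral_planeMax_rpow_le [Nonempty (Gr n m)] {A : ℝ≥0∞}
    (hA : PlateBound n m p α A) (hA_top : A ≠ ∞) (hp : 2 ≤ p) (hα : α < 1) {R : ℝ} (hR : 0 ≤ R) :
    ∃ C : ℝ≥0∞, C ≠ ∞ ∧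
      ∀ G : E (n + 1) → ℝ≥0∞, LowerSemicontinuous G → (∀ x, R ≤ ‖x‖ → G x = 0) →
        ∫⁻ M : Gr (n + 1) (m + 1), planeMax G M ^ p ∂gamma (n + 1) (m + 1) ≤
          C * ∫⁻ x, G x ^ p := by
  have hp_pos : 0 < p := two_pos.trans_le hp
  obtain ⟨C, hC, h_avg⟩ := hA.exists_lintegral_planeMax_lballAvg_rpow_le hA_top hp hR
  obtain ⟨K, hK, h_sum⟩ := exists_sum_scaleWeight_le_of_lt_one hp_pos hα
  have h_rpow : (1 + K) ^ p ≠ ∞ := ENNReal.rpow_ne_top_of_nonneg hp_pos.le (by finiteness)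
  refine ⟨C * (1 + K) ^ p, by finiteness, fun G hG h_supp => ?_⟩
  set H : ℕ → E (n + 1) → ℝ≥0∞ := fun J => lballAvg (dyadicRad J) (lballAvg (dyadicRad J) G)
  calc ∫⁻ M : Gr (n + 1) (m + 1), planeMax G M ^ p ∂gamma (n + 1) (m + 1)
      ≤ ∫⁻ M : Gr (n + 1) (m + 1), liminf (fun J => planeMax (H J) M ^ p) atTop
          ∂gamma (n + 1) (m + 1) :=
        lintegral_mono fun M =>
          (ENNReal.rpow_le_rpow (planeMax_le_liminf hG M) hp_pos.le).trans_eq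
            (ENNReal.orderIsoRpow p hp_pos).liminf_apply
    _ ≤ liminf (fun J => ∫⁻ M : Gr (n + 1) (m + 1), planeMax (H J) M ^ p
          ∂gamma (n + 1) (m + 1)) atTop :=
        lintegral_liminf_le fun J => (lowerSemicontinuous_planeMax
          (lowerSemicontinuous_lballAvg (dyadicRad_pos J))).measurable.pow_const p
    _ ≤ C * (1 + K) ^ p * ∫⁻ x, G x ^ p := by
        refine liminf_le_of_frequently_le' (Frequently.of_forall fun J => ?_)
        refine (h_avg hG.measurable h_supp J).trans ?_
        gcongr
        exact h_sum J

end LowerSemicontinuousBound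

section LowerSemicontinuousApproximation

variable {n : ℕ} {p R : ℝ}

theorem eLpNorm_ofReal_rpow_eq_lintegral {X ε : Type*} [MeasurableSpace X] [ENorm ε]
    (hp : 0 < p) (f : X → ε) (μ : Measure X) :
    eLpNorm f (ENNReal.ofReal p) μ ^ p = ∫⁻ x, ‖f x‖ₑ ^ p ∂μ := by
  simpa only [ENNReal.ofReal, Real.coe_toNNReal p hp.le] using
    eLpNorm_nnreal_pow_eq_lintegral (f := f) (μ := μ) (Real.toNNReal_pos.2 hp).ne'

theorem lowerSemicontinuous_indicator {X : Type*} [TopologicalSpace X] {S : Set X} (hS : IsOpen S)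
    {g : X → ℝ≥0∞} (hg : LowerSemicontinuous g) : LowerSemicontinuous (S.indicator g) := by
  rw [lowerSemicontinuous_iff_isOpen_preimage]
  intro c
  have h_preimage : S.indicator g ⁻¹' Ioi c = S ∩ g ⁻¹' Ioi c := by
    ext x
    by_cases hx : x ∈ S <;> simp [hx]
  rw [h_preimage]
  exact hS.inter (hg.isOpen_preimage c)

theorem exists_lowerSemicontinuous_majorant (hp : 0 < p) {f : E n → ℝ} (hf : AEMeasurable f)
    (h_supp : ∀ x, R ≤ ‖x‖ → f x = 0) {ε : ℝ≥0∞} (hε : ε ≠ 0) :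
    ∃ G : E n → ℝ≥0∞, LowerSemicontinuous G ∧ (∀ x, R ≤ ‖x‖ → G x = 0) ∧
      (∀ x, ‖f x‖ₑ ≤ G x) ∧ ∫⁻ x, G x ^ p ≤ (∫⁻ x, ‖f x‖ₑ ^ p) + ε := by
  obtain ⟨g, hfg, hg, h_int⟩ := exists_lt_lowerSemicontinuous_lintegral_ge_of_aemeasurable volume
    (fun x => ‖f x‖₊ ^ p) (hf.nnnorm.pow_const p) hε
  simp_rw [ENNReal.coe_rpow_of_nonneg _ hp.le, ← enorm_eq_nnnorm] at hfg h_int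
  have hg_root : LowerSemicontinuous fun x => g x ^ (1 / p) :=
    ENNReal.continuous_rpow_const.comp_lowerSemicontinuous hg
      (ENNReal.monotone_rpow_of_nonneg (by positivity))
  refine ⟨(Metric.ball 0 R).indicator fun x => g x ^ (1 / p),
    lowerSemicontinuous_indicator Metric.isOpen_ball hg_root, fun x hx => ?_, fun x => ?_, ?_⟩
  · exact indicator_of_notMem (by simpa using hx) _
  · by_cases hx : x ∈ Metric.ball (0 : E n) R
    · rw [indicator_of_mem hx, one_div, ENNReal.le_rpow_inv_iff hp]
      exact (hfg x).le
    · rw [h_supp x (by simpa using hx), enorm_zero]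
      exact zero_le
  · refine (lintegral_mono fun x => ?_).trans h_int
    by_cases hx : x ∈ Metric.ball (0 : E n) R
    · rw [indicator_of_mem hx, ← ENNReal.rpow_mul, one_div_mul_cancel hp.ne', ENNReal.rpow_one]
    · rw [indicator_of_notMem hx, ENNReal.zero_rpow_of_pos hp]
      exact zero_le

theorem exists_lowerSemicontinuous_enorm_lintegral_sub_rpow_le (hp : 0 < p) {f : E n → ℝ}
    (hf : MemLp f (ENNReal.ofReal p)) (h_supp : ∀ x, R ≤ ‖x‖ → f x = 0) {ε : ℝ≥0∞}
    (hε : ε ≠ 0) :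
    ∃ h : E n → ℝ, Measurable h ∧ LowerSemicontinuous (fun x => ‖h x‖ₑ) ∧
      (∀ x, R ≤ ‖x‖ → h x = 0) ∧ ∫⁻ x, ‖f x - h x‖ₑ ^ p ≤ ε := by
  have h_root : ε ^ (1 / p) ≠ 0 := (ENNReal.rpow_pos_of_nonneg hε.bot_lt (by positivity)).ne'
  obtain ⟨g, -, hfg, hg, -⟩ :=
    hf.exists_hasCompactSupport_eLpNorm_sub_le ENNReal.ofReal_ne_top h_root
  set B : Set (E n) := Metric.ball 0 R
  have h_sub : f - B.indicator g = B.indicator (f - g) := by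
    ext x
    by_cases hx : x ∈ B
    · rw [Pi.sub_apply, indicator_of_mem hx, indicator_of_mem hx, Pi.sub_apply]
    · rw [Pi.sub_apply, indicator_of_notMem hx, indicator_of_notMem hx, sub_zero]
      exact h_supp x (by simpa [B] using hx)
  refine ⟨B.indicator g, hg.measurable.indicator Metric.isOpen_ball.measurableSet, ?_, ?_, ?_⟩
  · simp_rw [enorm_indicator_eq_indicator_enorm]
    exact lowerSemicontinuous_indicator Metric.isOpen_ball hg.enorm.lowerSemicontinuous
  · exact fun x hx => indicator_of_notMem (by simpa [B] using hx) g
  · calc ∫⁻ x, ‖f x - B.indicator g x‖ₑ ^ p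
        = eLpNorm (B.indicator (f - g)) (ENNReal.ofReal p) volume ^ p := by
          rw [eLpNorm_ofReal_rpow_eq_lintegral hp, ← h_sub]; rfl
      _ ≤ (ε ^ (1 / p)) ^ p :=
          ENNReal.rpow_le_rpow ((eLpNorm_indicator_le _).trans hfg) hp.le
      _ = ε := by rw [← ENNReal.rpow_mul, one_div_mul_cancel hp.ne', ENNReal.rpow_one]

theorem exists_lowerSemicontinuous_approx (hp : 0 < p) {f : E n → ℝ}
    (hf : MemLp f (ENNReal.ofReal p)) (h_supp : ∀ x, R ≤ ‖x‖ → f x = 0) {ε : ℝ≥0∞}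
    (hε : ε ≠ 0) :
    ∃ (H : E n → ℝ≥0∞) (G : E n → ℝ≥0∞), LowerSemicontinuous H ∧ LowerSemicontinuous G ∧
      (∀ x, R ≤ ‖x‖ → G x = 0) ∧ (∀ x, ‖f x‖ₑ ≤ H x + G x) ∧ (∀ x, H x ≤ ‖f x‖ₑ + G x) ∧
      ∫⁻ x, G x ^ p ≤ 2 * ε := by
  obtain ⟨h, h_meas, h_lsc, hh_supp, h_sub⟩ :=
    exists_lowerSemicontinuous_enorm_lintegral_sub_rpow_le hp hf h_supp hε
  obtain ⟨G, hG, hG_supp, h_le, h_int⟩ := exists_lowerSemicontinuous_majorant hp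
    (hf.aestronglyMeasurable.aemeasurable.sub h_meas.aemeasurable) (R := R)
    (fun x hx => by rw [Pi.sub_apply, h_supp x hx, hh_supp x hx, sub_zero]) hε
  refine ⟨fun x => ‖h x‖ₑ, G, h_lsc, hG, hG_supp, fun x => ?_, fun x => ?_, ?_⟩
  · calc ‖f x‖ₑ = ‖h x + (f x - h x)‖ₑ := by rw [add_sub_cancel]
      _ ≤ ‖h x‖ₑ + ‖f x - h x‖ₑ := enorm_add_le _ _
      _ ≤ ‖h x‖ₑ + G x := add_le_add_right (h_le x) _
  · calc ‖h x‖ₑ = ‖f x - (f x - h x)‖ₑ := by rw [sub_sub_cancel]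
      _ ≤ ‖f x‖ₑ + ‖f x - h x‖ₑ := enorm_sub_le
      _ ≤ ‖f x‖ₑ + G x := add_le_add_right (h_le x) _
  · rw [two_mul]
    exact h_int.trans (add_le_add_left h_sub ε)

end LowerSemicontinuousApproximation

section PlaneMaximal

variable {n m : ℕ} {p R : ℝ} {C : ℝ≥0∞}

theorem lintegral_maxN_rpow_le (hp : 0 < p) (hC : C ≠ ∞)
    (h_lsc : ∀ G : E n → ℝ≥0∞, LowerSemicontinuous G → (∀ x, R ≤ ‖x‖ → G x = 0) →
      ∫⁻ M : Gr n m, planeMax G M ^ p ∂gamma n m ≤ C * ∫⁻ x, G x ^ p)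
    {f : E n → ℝ} (hf : AEMeasurable f) (h_supp : ∀ x, R ≤ ‖x‖ → f x = 0) :
    ∫⁻ M : Gr n m, maxN f M ^ p ∂gamma n m ≤ (C + 1) * ∫⁻ x, ‖f x‖ₑ ^ p := by
  have hC_add_one : C + 1 ≠ ∞ := by finiteness
  refine ENNReal.le_of_forall_pos_le_add fun ε hε _ => ?_
  obtain ⟨G, hG, hG_supp, hfG, h_int⟩ := exists_lowerSemicontinuous_majorant hp hf h_supp
    (ε := (ε : ℝ≥0∞) / (C + 1)) (ENNReal.div_pos (by exact_mod_cast hε.ne') hC_add_one).ne'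
  calc ∫⁻ M : Gr n m, maxN f M ^ p ∂gamma n m
      ≤ ∫⁻ M : Gr n m, planeMax G M ^ p ∂gamma n m :=
        lintegral_mono fun M => ENNReal.rpow_le_rpow (planeMax_mono hfG M) hp.le
    _ ≤ C * ∫⁻ x, G x ^ p := h_lsc G hG hG_supp
    _ ≤ (C + 1) * ((∫⁻ x, ‖f x‖ₑ ^ p) + ε / (C + 1)) := mul_le_mul' le_self_add h_int
    _ ≤ (C + 1) * (∫⁻ x, ‖f x‖ₑ ^ p) + ε := by
        rw [mul_add]
        exact add_le_add_right ENNReal.mul_div_le _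

theorem tendsto_zero_of_tsum_rpow_ne_top (hp : 0 < p) {u : ℕ → ℝ≥0∞}
    (hu : ∑' i, u i ^ p ≠ ∞) : Tendsto u atTop (𝓝 0) := by
  have h_root := ((ENNReal.continuous_rpow_const (y := p⁻¹)).tendsto 0).comp
    (ENNReal.tendsto_atTop_zero_of_tsum_ne_top hu)
  rw [ENNReal.zero_rpow_of_pos (inv_pos.2 hp)] at h_root
  exact h_root.congr fun i => ENNReal.rpow_rpow_inv hp.ne' _

theorem tendsto_of_le_add_of_le_add {a : ℝ≥0∞} {u v : ℕ → ℝ≥0∞} (hv : Tendsto v atTop (𝓝 0))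
    (hau : ∀ i, a ≤ u i + v i) (hua : ∀ i, u i ≤ a + v i) : Tendsto u atTop (𝓝 a) := by
  have h_upper : Tendsto (fun i => a + v i) atTop (𝓝 a) := by
    simpa only [add_zero] using (tendsto_const_nhds (x := a)).add hv
  have h_lower : Tendsto (fun i => a - v i) atTop (𝓝 a) := by
    simpa only [tsub_zero] using
      ENNReal.Tendsto.sub (tendsto_const_nhds (x := a)) hv (Or.inr ENNReal.zero_ne_top)
  exact tendsto_of_tendsto_of_tendsto_of_le_of_le h_lower h_upper
    (fun i => tsub_le_iff_right.2 (hau i)) hua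

theorem ae_tendsto_planeMax_zero (hp : 0 < p) (hC : C ≠ ∞) {G : ℕ → E n → ℝ≥0∞}
    (hG : ∀ i, LowerSemicontinuous (G i))
    (h_int : ∀ i, ∫⁻ M : Gr n m, planeMax (G i) M ^ p ∂gamma n m ≤ C * 2⁻¹ ^ i) :
    ∀ᵐ M ∂gamma n m, Tendsto (fun i => planeMax (G i) M) atTop (𝓝 0) := by
  have h_meas (i : ℕ) : Measurable fun M : Gr n m => planeMax (G i) M ^ p :=
    (lowerSemicontinuous_planeMax (hG i)).measurable.pow_const p
  have h_sum : ∫⁻ M : Gr n m, ∑' i, planeMax (G i) M ^ p ∂gamma n m ≠ ∞ := by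
    rw [lintegral_tsum fun i => (h_meas i).aemeasurable]
    refine ne_top_of_le_ne_top ?_ (ENNReal.tsum_le_tsum h_int)
    rw [ENNReal.tsum_mul_left, ENNReal.tsum_geometric, ENNReal.one_sub_inv_two, inv_inv]
    finiteness
  filter_upwards [ae_lt_top (Measurable.tsum h_meas) h_sum] with M hM
  exact tendsto_zero_of_tsum_rpow_ne_top hp hM.ne

theorem aemeasurable_maxN (hp : 0 < p) (hC : C ≠ ∞)
    (h_lsc : ∀ G : E n → ℝ≥0∞, LowerSemicontinuous G → (∀ x, R ≤ ‖x‖ → G x = 0) →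
      ∫⁻ M : Gr n m, planeMax G M ^ p ∂gamma n m ≤ C * ∫⁻ x, G x ^ p)
    {f : E n → ℝ} (hf : MemLp f (ENNReal.ofReal p)) (h_supp : ∀ x, R ≤ ‖x‖ → f x = 0) :
    AEMeasurable (maxN f) (gamma n m) := by
  choose H G hH hG hG_supp hfH hHf h_int using fun i : ℕ =>
    exists_lowerSemicontinuous_approx hp hf h_supp (ε := 2⁻¹ ^ i) (by simp)
  have h_error (i : ℕ) : ∫⁻ M : Gr n m, planeMax (G i) M ^ p ∂gamma n m ≤ C * 2 * 2⁻¹ ^ i := by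
    rw [mul_assoc]
    exact (h_lsc (G i) (hG i) (hG_supp i)).trans (mul_le_mul_right (h_int i) C)
  refine aemeasurable_of_tendsto_metrizable_ae atTop
    (fun i => (lowerSemicontinuous_planeMax (hH i)).measurable.aemeasurable) ?_
  filter_upwards [ae_tendsto_planeMax_zero hp (by finiteness) hG h_error] with M hM
  exact tendsto_of_le_add_of_le_add hM
    (fun i => (planeMax_mono (hfH i) M).trans (planeMax_add_le (hG i).measurable M))
    fun i => (planeMax_mono (hHf i) M).trans (planeMax_add_le (hG i).measurable M)

end PlaneMaximal

section LpBounds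

variable {d k n m : ℕ} {p α : ℝ} {A : ℝ≥0∞}

theorem BddSupported.memLp {Λ R : ℝ} {f : E d → ℝ} (hf : BddSupported Λ R f) (q : ℝ≥0∞) :
    MemLp f q := by
  have h_indicator : (Metric.ball (0 : E d) R).indicator f = f :=
    indicator_eq_self.2 fun x hx => by
      by_contra h
      exact hx (hf.supp x (by simpa using h))
  have : IsFiniteMeasure (volume.restrict (Metric.ball (0 : E d) R)) :=
    isFiniteMeasure_restrict.2 measure_ball_lt_top.ne
  rw [← h_indicator, memLp_indicator_iff_restrict Metric.isOpen_ball.measurableSet]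
  exact MemLp.of_bound hf.meas.aestronglyMeasurable Λ
    (ae_of_all _ fun x => (Real.norm_eq_abs _).trans_le (hf.bound x))

theorem eLpNorm_le_mul_eLpNorm_of_lintegral_rpow_le {X Y ε ε' : Type*} [MeasurableSpace X]
    [MeasurableSpace Y] [ENorm ε] [ENorm ε'] {μ : Measure X} {ν : Measure Y} (hp : 0 < p)
    {f : X → ε} {g : Y → ε'} {C : ℝ≥0∞} (h : ∫⁻ x, ‖f x‖ₑ ^ p ∂μ ≤ C * ∫⁻ y, ‖g y‖ₑ ^ p ∂ν) :
    eLpNorm f (ENNReal.ofReal p) μ ≤ C ^ p⁻¹ * eLpNorm g (ENNReal.ofReal p) ν := by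
  rw [← ENNReal.rpow_le_rpow_iff hp, ENNReal.mul_rpow_of_nonneg _ _ hp.le,
    eLpNorm_ofReal_rpow_eq_lintegral hp, eLpNorm_ofReal_rpow_eq_lintegral hp,
    ENNReal.rpow_inv_rpow hp.ne']
  exact h

theorem plateBound_of_eLpNorm_le (hp : 0 < p)
    (h : ∀ δ : ℝ, 0 < δ → δ < 1 → ∀ f : E n → ℝ, MemLp f (ENNReal.ofReal p) volume →
      eLpNorm (maxM (k := m) δ f) (ENNReal.ofReal p) (gamma n m) ≤
        A * ENNReal.ofReal (δ ^ (-α / p)) * eLpNorm f (ENNReal.ofReal p) volume) :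
    PlateBound n m p α (A ^ p) := by
  intro δ hδ hδ' Λ R f hf
  have h_rpow := ENNReal.rpow_le_rpow (h δ hδ hδ' f (hf.memLp _)) hp.le
  rwa [ENNReal.mul_rpow_of_nonneg _ _ hp.le, ENNReal.mul_rpow_of_nonneg _ _ hp.le,
    eLpNorm_ofReal_rpow_eq_lintegral hp, eLpNorm_ofReal_rpow_eq_lintegral hp,
    ENNReal.ofReal_rpow_of_nonneg (by positivity) hp.le, ← Real.rpow_mul hδ.le,
    div_mul_cancel₀ _ hp.ne'] at h_rpow

theorem maxM_congr_ae (δ : ℝ) {f g : E d → ℝ} (h : f =ᵐ[volume] g) :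
    (maxM δ f : Gr d k → ℝ≥0∞) = maxM δ g := by
  funext L
  unfold maxM
  congr! 3 with a
  exact lintegral_congr_ae (ae_restrict_of_ae (h.fun_comp fun t => ‖t‖ₑ))

theorem PlateBound.exists_eLpNorm_maxM_le [Nonempty (Gr n m)] (hA : PlateBound n m p α A)
    (hA_top : A ≠ ∞) (hp : 2 ≤ p) :
    ∃ C : ℝ≥0∞, C ≠ ∞ ∧ ∀ {δ : ℝ}, 0 < δ → δ < 1 → ∀ {K : ℝ≥0∞},
      (∀ J, δ ≤ dyadicRad J → ∑ j ∈ Finset.range J, scaleWeight p α j ≤ K) →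
      ∀ {f : E (n + 1) → ℝ}, AEStronglyMeasurable f →
        eLpNorm (maxM (k := m + 1) δ f) (ENNReal.ofReal p) (gamma (n + 1) (m + 1)) ≤
          C * (1 + K) * eLpNorm f (ENNReal.ofReal p) volume := by
  have hp_pos : 0 < p := two_pos.trans_le hp
  obtain ⟨C, hC, h_plate⟩ := hA.exists_lintegral_plateMax_rpow_le hA_top hp
  refine ⟨C ^ p⁻¹, ENNReal.rpow_ne_top_of_nonneg (by positivity) hC,
    fun {δ} hδ hδ' {K} hK {f} hf => ?_⟩
  rw [maxM_congr_ae δ hf.ae_eq_mk, eLpNorm_congr_ae hf.ae_eq_mk]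
  have h_norm := eLpNorm_le_mul_eLpNorm_of_lintegral_rpow_le hp_pos
    (f := maxM (k := m + 1) δ (hf.mk f)) (g := hf.mk f)
    (h_plate hδ hδ' hK hf.stronglyMeasurable_mk.measurable.enorm)
  rwa [ENNReal.mul_rpow_of_nonneg _ _ (inv_nonneg.2 hp_pos.le),
    ENNReal.rpow_rpow_inv hp_pos.ne'] at h_norm

theorem PlateBound.exists_eLpNorm_maxM_le_of_one_lt [Nonempty (Gr n m)]
    (hA : PlateBound n m p α A) (hA_top : A ≠ ∞) (hp : 2 ≤ p) (hα : 1 < α) :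
    ∃ C : ℝ≥0, ∀ δ : ℝ, 0 < δ → δ < 1 → ∀ f : E (n + 1) → ℝ, AEStronglyMeasurable f →
      eLpNorm (maxM (k := m + 1) δ f) (ENNReal.ofReal p) (gamma (n + 1) (m + 1)) ≤
        C * ENNReal.ofReal (δ ^ (-(α - 1) / p)) * eLpNorm f (ENNReal.ofReal p) volume := by
  have hp_pos : 0 < p := two_pos.trans_le hp
  obtain ⟨C, hC, h_max⟩ := hA.exists_eLpNorm_maxM_le hA_top hp
  obtain ⟨K, hK, h_sum⟩ := exists_sum_scaleWeight_le_of_one_lt hp_pos hα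
  lift C to ℝ≥0 using hC
  lift K to ℝ≥0 using hK
  refine ⟨C * (1 + K), fun δ hδ hδ' f hf => ?_⟩
  have h_one : 1 ≤ ENNReal.ofReal (δ ^ (-(α - 1) / p)) :=
    ENNReal.one_le_ofReal.2 (Real.one_le_rpow_of_pos_of_le_one_of_nonpos hδ hδ'.le
      (div_nonpos_of_nonpos_of_nonneg (by linarith) hp_pos.le))
  refine (h_max hδ hδ' (fun J hJ => h_sum hδ hJ) hf).trans (mul_le_mul_left ?_ _)
  push_cast
  rw [mul_assoc, add_mul, one_mul]
  gcongr

theorem PlateBound.exists_eLpNorm_maxM_le_log [Nonempty (Gr n m)]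
    (hA : PlateBound n m p 1 A) (hA_top : A ≠ ∞) (hp : 2 ≤ p) :
    ∃ C : ℝ≥0, ∀ δ : ℝ, 0 < δ → δ < 1 → ∀ f : E (n + 1) → ℝ, AEStronglyMeasurable f →
      eLpNorm (maxM (k := m + 1) δ f) (ENNReal.ofReal p) (gamma (n + 1) (m + 1)) ≤
        C * ENNReal.ofReal (1 + Real.log (1 / δ)) * eLpNorm f (ENNReal.ofReal p) volume := by
  obtain ⟨C, hC, h_max⟩ := hA.exists_eLpNorm_maxM_le hA_top hp
  lift C to ℝ≥0 using hC
  refine ⟨C * 2, fun δ hδ hδ' f hf => ?_⟩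
  have h_log : 0 ≤ Real.log (1 / δ) := Real.log_nonneg ((one_le_div hδ).2 hδ'.le)
  refine (h_max hδ hδ' (fun J hJ => sum_scaleWeight_one_le_log hδ hJ) hf).trans
    (mul_le_mul_left ?_ _)
  push_cast
  rw [mul_assoc, ENNReal.ofReal_add zero_le_one h_log, ENNReal.ofReal_one, mul_add 2, mul_one]
  gcongr
  exact one_le_two

theorem PlateBound.exists_aemeasurable_maxN_and_eLpNorm_le [Nonempty (Gr n m)]
    (hA : PlateBound n m p α A) (hA_top : A ≠ ∞) (hp : 2 ≤ p) (hα : α < 1) {R : ℝ}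
    (hR : 0 ≤ R) :
    ∃ C : ℝ≥0, ∀ f : E (n + 1) → ℝ, MemLp f (ENNReal.ofReal p) volume →
      (∀ x, R ≤ ‖x‖ → f x = 0) →
        AEMeasurable (maxN (k := m + 1) f) (gamma (n + 1) (m + 1)) ∧
        eLpNorm (maxN (k := m + 1) f) (ENNReal.ofReal p) (gamma (n + 1) (m + 1)) ≤
          C * eLpNorm f (ENNReal.ofReal p) volume := by
  have hp_pos : 0 < p := two_pos.trans_le hp
  obtain ⟨C, hC, h_lsc⟩ := hA.exists_lintegral_planeMax_rpow_le hA_top hp hα hR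
  have h_root : (C + 1) ^ p⁻¹ ≠ ∞ :=
    ENNReal.rpow_ne_top_of_nonneg (by positivity) (by finiteness)
  refine ⟨((C + 1) ^ p⁻¹).toNNReal, fun f hf h_supp =>
    ⟨aemeasurable_maxN hp_pos hC h_lsc hf h_supp, ?_⟩⟩
  rw [ENNReal.coe_toNNReal h_root]
  exact eLpNorm_le_mul_eLpNorm_of_lintegral_rpow_le hp_pos
    (lintegral_maxN_rpow_le hp_pos hC h_lsc hf.aestronglyMeasurable.aemeasurable h_supp)

end LpBounds

end KPlane

theorem mainTheorem5_general (d k : ℕ) (hk : 1 ≤ k) (hkd : k ≤ d) (p : ℝ) (hp : 2 ≤ p) (α R : ℝ)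
    (hbound : ∃ A : ℝ≥0, ∀ δ : ℝ, 0 < δ → δ < 1 → ∀ f : KPlane.E (d - 1) → ℝ,
      MemLp f (ENNReal.ofReal p) volume →
        eLpNorm (KPlane.maxM (k := k - 1) δ f) (ENNReal.ofReal p) (KPlane.gamma (d - 1) (k - 1)) ≤
          A * ENNReal.ofReal (δ ^ (-α / p)) * eLpNorm f (ENNReal.ofReal p) volume) :
    (1 < α → ∃ C : ℝ≥0, ∀ δ : ℝ, 0 < δ → δ < 1 → ∀ f : KPlane.E d → ℝ,
      MemLp f (ENNReal.ofReal p) volume →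
        eLpNorm (KPlane.maxM (k := k) δ f) (ENNReal.ofReal p) (KPlane.gamma d k) ≤
          C * ENNReal.ofReal (δ ^ (-(α - 1) / p)) * eLpNorm f (ENNReal.ofReal p) volume) ∧
    (α = 1 → ∃ C : ℝ≥0, ∀ δ : ℝ, 0 < δ → δ < 1 → ∀ f : KPlane.E d → ℝ,
      MemLp f (ENNReal.ofReal p) volume →
        eLpNorm (KPlane.maxM (k := k) δ f) (ENNReal.ofReal p) (KPlane.gamma d k) ≤
          C * ENNReal.ofReal (1 + Real.log (1 / δ)) * eLpNorm f (ENNReal.ofReal p) volume) ∧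
    (α < 1 → ∃ C : ℝ≥0, ∀ f : KPlane.E d → ℝ,
      MemLp f (ENNReal.ofReal p) volume → Function.support f ⊆ Metric.closedBall 0 R →
        AEMeasurable (KPlane.maxN (k := k) f) (KPlane.gamma d k) ∧
        eLpNorm (KPlane.maxN (k := k) f) (ENNReal.ofReal p) (KPlane.gamma d k) ≤
          C * eLpNorm f (ENNReal.ofReal p) volume) := by
  obtain ⟨n, rfl⟩ : ∃ n, d = n + 1 := ⟨d - 1, by omega⟩
  obtain ⟨m, rfl⟩ : ∃ m, k = m + 1 := ⟨k - 1, by omega⟩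
  obtain ⟨A, hA⟩ := hbound
  have : Nonempty (KPlane.Gr n m) := KPlane.nonempty_gr_of_le (by omega)
  have h_plate := KPlane.plateBound_of_eLpNorm_le (n := n) (m := m) (two_pos.trans_le hp) hA
  have hA_top : (A : ℝ≥0∞) ^ p ≠ ∞ :=
    ENNReal.rpow_ne_top_of_nonneg (zero_le_two.trans hp) ENNReal.coe_ne_top
  refine ⟨fun hα => ?_, ?_, fun hα => ?_⟩
  · obtain ⟨C, h_max⟩ := h_plate.exists_eLpNorm_maxM_le_of_one_lt hA_top hp hα
    exact ⟨C, fun δ hδ hδ' f hf => h_max δ hδ hδ' f hf.aestronglyMeasurable⟩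
  · rintro rfl
    obtain ⟨C, h_max⟩ := h_plate.exists_eLpNorm_maxM_le_log hA_top hp
    exact ⟨C, fun δ hδ hδ' f hf => h_max δ hδ hδ' f hf.aestronglyMeasurable⟩
  · obtain ⟨C, h_plane⟩ := h_plate.exists_aemeasurable_maxN_and_eLpNorm_le hA_top hp hα
      (R := |R| + 1) (by positivity)
    refine ⟨C, fun f hf h_supp => h_plane f hf fun x hx => Function.notMem_support.1 fun hfx => ?_⟩
    linarith [mem_closedBall_zero_iff.1 (h_supp hfx), le_abs_self R]

theorem mainTheorem5 (d k : ℕ) (hk : 2 ≤ k) (hkd : k ≤ d) (p : ℝ) (hp : 2 ≤ p) (α : ℝ)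
    (hbound : ∃ A : ℝ≥0, ∀ δ : ℝ, 0 < δ → δ < 1 → ∀ f : KPlane.E (d - 1) → ℝ,
      MemLp f (ENNReal.ofReal p) volume →
        eLpNorm (KPlane.maxM (k := k - 1) δ f) (ENNReal.ofReal p) (KPlane.gamma (d - 1) (k - 1)) ≤
          A * ENNReal.ofReal (δ ^ (-α / p)) * eLpNorm f (ENNReal.ofReal p) volume) :
    (1 < α → ∃ C : ℝ≥0, ∀ δ : ℝ, 0 < δ → δ < 1 → ∀ f : KPlane.E d → ℝ,
      MemLp f (ENNReal.ofReal p) volume →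
        eLpNorm (KPlane.maxM (k := k) δ f) (ENNReal.ofReal p) (KPlane.gamma d k) ≤
          C * ENNReal.ofReal (δ ^ (-(α - 1) / p)) * eLpNorm f (ENNReal.ofReal p) volume) ∧
    (α = 1 → ∃ C : ℝ≥0, ∀ δ : ℝ, 0 < δ → δ < 1 → ∀ f : KPlane.E d → ℝ,
      MemLp f (ENNReal.ofReal p) volume →
        eLpNorm (KPlane.maxM (k := k) δ f) (ENNReal.ofReal p) (KPlane.gamma d k) ≤
          C * ENNReal.ofReal (1 + Real.log (1 / δ)) * eLpNorm f (ENNReal.ofReal p) volume) ∧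
    (α < 1 → ∃ C : ℝ≥0, ∀ f : KPlane.E d → ℝ,
      MemLp f (ENNReal.ofReal p) volume → Function.support f ⊆ Metric.closedBall 0 1 →
        AEMeasurable (KPlane.maxN (k := k) f) (KPlane.gamma d k) ∧
        eLpNorm (KPlane.maxN (k := k) f) (ENNReal.ofReal p) (KPlane.gamma d k) ≤
          C * eLpNorm f (ENNReal.ofReal p) volume) :=
  mainTheorem5_general d k (one_le_two.trans hk) hkd p hp α 1 hbound
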